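/- Let $n\in\mathbb N$, $p\in(0,1)$ and $q=\frac{p}{p-1}\in(-\infty,0)$. For a Borel measurable $h:\mathbb R^n\to[0,\infty]$ write $\tau_z h(x)=h(x-z)$ and $$\mathcal L_p(h)(x)=\Big(\int_{\mathbb R^n}h(y)^{1/p}e^{x\cdot y}\,dy\Big)^{q},\qquad M_p(h)=\Big(\int_{\mathbb R^n}h\Big)\,\inf_{z\in\mathbb R^n}\Big(\int_{\mathbb R^n}\mathcal L_p(\tau_z h)(x/p)\,dx\Big)^{-p/q},$$ with values in $[0,\infty]$ and the conventions $0^{q}=\infty$, $\infty^{q}=0$, $\infty\cdot 0=0$. Let $\gamma_1(x)=e^{-|x|^2/2}$. Let $f:\mathbb R^n\to[0,\infty]$ be Borel measurable. Let $(f_t)_{t\ge0}$ be its evolution along either the heat semigroup, $f_0=f$ and $$f_t(x)=\int_{\mathbb R^n}f(y)\,e^{-|x-y|^2/(2t)}\,\frac{dy}{(2\pi t)^{n/2}}\qquad(t>0),$$ or the Fokker–Planck semigroup, $f_0=f$ and $$f_t(x)=e^{nt/2}\int_{\mathbb R^n}f(y)\,e^{-|e^{t/2}x-y|^2/(2(e^t-1))}\,\frac{dy}{(2\pi(e^t-1))^{n/2}}\qquad(t>0).$$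 Then, in both cases, the function $t\mapsto M_p(f_t)$ is nondecreasing on $[0,\infty)$, and $M_p(f_t)\le M_p(\gamma_1)$ for every $t\ge0$. -/

import Mathlib

open MeasureTheory
open scoped ENNReal

namespace LpVolume

/-- The conjugate exponent `q = p / (p - 1)`, which is negative for `p ∈ (0, 1)`. -/
noncomputable def conjExp (p : ℝ) : ℝ := p / (p - 1)

/-- The Laplace transform `Lf(x) = ∫ f(y) e^{x·y} dy` of a nonnegative function, with values
in `[0, ∞]`. -/
noncomputable def laplace {n : ℕ} (f : EuclideanSpace ℝ (Fin n) → ℝ≥0∞)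
    (x : EuclideanSpace ℝ (Fin n)) : ℝ≥0∞ :=
  ∫⁻ y, f y * ENNReal.ofReal (Real.exp (inner ℝ x y))

/-- The `p`-Laplace transform `(L(f^{1/p}))^q`, with `0^q = ∞` and `∞^q = 0` since `q < 0`. -/
noncomputable def pLaplace {n : ℕ} (p : ℝ) (f : EuclideanSpace ℝ (Fin n) → ℝ≥0∞)
    (x : EuclideanSpace ℝ (Fin n)) : ℝ≥0∞ :=
  (laplace (fun y => f y ^ (1 / p)) x) ^ conjExp p

/-- The translate `τ_z f(x) = f(x - z)`. -/
def translate {n : ℕ} (z : EuclideanSpace ℝ (Fin n)) (f : EuclideanSpace ℝ (Fin n) → ℝ≥0∞)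
    (x : EuclideanSpace ℝ (Fin n)) : ℝ≥0∞ :=
  f (x - z)

/-- The `L^p` functional volume product
`M_p(f) = (∫ f) · inf_z (∫ 𝓛_p(τ_z f)(x/p) dx)^{-p/q}`, with the convention `∞ · 0 = 0`. -/
noncomputable def volumeProduct {n : ℕ} (p : ℝ)
    (f : EuclideanSpace ℝ (Fin n) → ℝ≥0∞) : ℝ≥0∞ :=
  (∫⁻ x, f x) *
    ⨅ z : EuclideanSpace ℝ (Fin n),
      (∫⁻ x, pLaplace p (translate z f) (p⁻¹ • x)) ^ (-p / conjExp p)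

/-- The Gaussian function `γ_σ(x) = e^{-|x|²/(2σ)}`. -/
noncomputable def gaussian {n : ℕ} (σ : ℝ) (x : EuclideanSpace ℝ (Fin n)) : ℝ≥0∞ :=
  ENNReal.ofReal (Real.exp (-‖x‖ ^ 2 / (2 * σ)))

/-- The heat flow with generator `Δ/2`: `E_0 f = f`, and for `t > 0`
`E_t f(x) = ∫ f(y) e^{-|x-y|²/(2t)} dy / (2πt)^{n/2}` (only used for `t ≥ 0`). -/
noncomputable def heatFlow {n : ℕ} (f : EuclideanSpace ℝ (Fin n) → ℝ≥0∞) (t : ℝ)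
    (x : EuclideanSpace ℝ (Fin n)) : ℝ≥0∞ :=
  if t = 0 then f x
  else ∫⁻ y, f y * ENNReal.ofReal
    (Real.exp (-‖x - y‖ ^ 2 / (2 * t)) / (2 * Real.pi * t) ^ ((n : ℝ) / 2))

/-- The Fokker-Planck flow with generator `f ↦ (Δf + div(x f))/2`: `P_0 f = f`, and for `t > 0`
`P_t f(x) = e^{nt/2} ∫ f(y) e^{-|e^{t/2}x-y|²/(2(e^t-1))} dy / (2π(e^t-1))^{n/2}`
(only used for `t ≥ 0`). -/
noncomputable def fokkerPlanckFlow {n : ℕ} (f : EuclideanSpace ℝ (Fin n) → ℝ≥0∞) (t : ℝ)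
    (x : EuclideanSpace ℝ (Fin n)) : ℝ≥0∞ :=
  if t = 0 then f x
  else ENNReal.ofReal (Real.exp (n * t / 2)) * ∫⁻ y, f y * ENNReal.ofReal
    (Real.exp (-‖Real.exp (t / 2) • x - y‖ ^ 2 / (2 * (Real.exp t - 1))) /
      (2 * Real.pi * (Real.exp t - 1)) ^ ((n : ℝ) / 2))

end LpVolume

open Filter Topology

/-! ### The Prékopa–Leindler inequality for midpoints. -/

section PrekopaLeindler

/-! Put `Q = p / (1 - p)` and `X_t = L(f_t^{1/p})`. Translating `f` multiplies `L(f^{1/p})` by an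
exponential, so `M_p(f)` is the mass of `f` times a positive power of `min_z ∫ X^{-Q} e^{z·x}`
(`volumeProduct_eq`). The heat flow preserves mass, and the claim becomes that this minimum is
nondecreasing in `t`.

For compactly supported data the heat kernel is a product of one-dimensional Gaussians, so the
variances can be raised one coordinate at a time. Let `S` be the smoothed function and `S'` the one
with the variance in direction `i` lowered by `ε²`. Take `κ² = p` and `β² = 1 - p`. A second order
expansion (`one_sub_le_two_point`, `smooth_rpow_le`) bounds `S^{1/p}`, up to `O(ε³)`, by the average
over the sign of `κ` of the geometric mean of `S'^{1/p}` at the shifts `(±κ ± β)ε`. The choice of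
`κ` and `β` kills all second order terms. After the Laplace transform the `κ`-shifts give a cosh,
bounded by a Gaussian factor, and Cauchy–Schwarz treats the `β`-shifts (`smoothLaplace_step_le`).
Raising to the power `-Q` gives exactly the hypothesis of Prékopa–Leindler for the densities
`X'^{-Q} e^{z·x}` tilted by `exp(±σ x_i - σ² x_i² / 2)`, with `σ` of order `ε`
(`tiltDens_mul_le_sq`).

Since `exp(u - u² / 2) = 1 + u + O(u³)`, the resulting inequality says that the tilted integral
before the step is at most the one after it, plus `O(ε³)`, plus a multiple of `ε²` times the squared
first moment (`integral_tiltDens_step`). If `z` is the minimizer after the step, that moment tends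
to zero by the first order condition. The error is thus `o(ε²)`, a left Dini inequality in the
variance. Together with lower semicontinuity, obtained from coercivity and Fatou, it yields
monotonicity (`le_of_left_dini_of_right_lsc`).

General `f` and the initial time follow by truncation, monotone limits and a Jensen bound. The
Fokker–Planck flow is a rescaled heat flow at time `e^t - 1`, and `M_p` is invariant under
rescaling. For the Gaussian bound, the heat flow of a truncation at large time, rescaled, is bounded
below by radial profiles increasing to a Gaussian of the same mass. By monotonicity `M_p` of the
truncation is at most the limiting value, and evenness puts the Gaussian's minimum at `z = 0`. -/

theorem volume_add_le_of_isCompact {K L C : Set ℝ} (hK : IsCompact K) (hL : IsCompact L)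
    (hK0 : K.Nonempty) (hL0 : L.Nonempty)
    (h : ∀ a ∈ K, ∀ b ∈ L, (a + b) / 2 ∈ C) : volume K + volume L ≤ 2 * volume C := by
  obtain ⟨k, hk, hkmax⟩ := hK.exists_isGreatest hK0
  obtain ⟨l, hl, hlmin⟩ := hL.exists_isLeast hL0
  -- The half-size copies `(K + l) / 2` and `(L + k) / 2` lie in `C`, the first to the left of `c`
  -- and the second to its right, so they meet at most in the null set `{c}`.
  set c : ℝ := (k + l) / 2 with hc
  have key : ∀ (S : Set ℝ) (d : ℝ), volume ((fun x : ℝ => 2 * x - d) ⁻¹' S) = 2⁻¹ * volume S := by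
    intro S d
    have e1 : (fun x : ℝ => 2 * x - d) ⁻¹' S = (fun x : ℝ => 2 * x) ⁻¹' ((fun x => x + (-d)) ⁻¹' S) := by
      ext x; simp [sub_eq_add_neg]
    rw [e1, Real.volume_preimage_mul_left (by norm_num : (2:ℝ) ≠ 0), measure_preimage_add_right]
    congr 1
    rw [abs_of_pos (by norm_num), ENNReal.ofReal_inv_of_pos (by norm_num)]
    norm_num
  have h1 : (fun x : ℝ => 2 * x - l) ⁻¹' K ⊆ C ∩ Set.Iic c := by
    intro x hx
    simp only [Set.mem_preimage] at hx
    refine ⟨?_, ?_⟩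
    · have := h _ hx l hl
      simpa using this
    · have := hkmax hx
      simp only [Set.mem_Iic, hc]; linarith
  have h2 : (fun x : ℝ => 2 * x - k) ⁻¹' L ⊆ C ∩ Set.Ici c := by
    intro x hx
    simp only [Set.mem_preimage] at hx
    refine ⟨?_, ?_⟩
    · have := h k hk _ hx
      simpa using this
    · have := hlmin hx
      simp only [Set.mem_Ici, hc]; linarith
  have h3 : volume (C ∩ Set.Ici c) = volume (C \ Set.Iic c) := by
    refine measure_congr ?_
    have : C \ Set.Iic c = C ∩ Set.Ioi c := by ext; simp
    rw [this]
    exact (ae_eq_refl _).inter Ioi_ae_eq_Ici.symm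
  have h4 : volume C = volume (C ∩ Set.Iic c) + volume (C \ Set.Iic c) :=
    (measure_inter_add_sdiff C measurableSet_Iic).symm
  have h5 : 2⁻¹ * volume K ≤ volume (C ∩ Set.Iic c) := by
    rw [← key K l]; exact measure_mono h1
  have h6 : 2⁻¹ * volume L ≤ volume (C \ Set.Iic c) := by
    rw [← key L k, ← h3]; exact measure_mono h2
  have h7 : ∀ a : ℝ≥0∞, a = 2 * (2⁻¹ * a) := by
    intro a
    rw [← mul_assoc, ENNReal.mul_inv_cancel (by norm_num) (by norm_num), one_mul]
  calc volume K + volume L = 2 * (2⁻¹ * volume K + 2⁻¹ * volume L) := by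
        rw [mul_add, ← h7, ← h7]
    _ ≤ 2 * volume C := by
        rw [h4]; gcongr

/-- Inner regularity reduces this to compact sets. `C` need not be measurable, which spares any
discussion of the midpoint set. -/
theorem volume_add_le_of_midpoint_mem {A B C : Set ℝ} (hA : MeasurableSet A) (hB : MeasurableSet B)
    (hA0 : A.Nonempty) (hB0 : B.Nonempty)
    (h : ∀ a ∈ A, ∀ b ∈ B, (a + b) / 2 ∈ C) : volume A + volume B ≤ 2 * volume C := by
  rw [hA.measure_eq_iSup_isCompact, hB.measure_eq_iSup_isCompact]
  have main : ∀ K, K ⊆ A → IsCompact K → ∀ L, L ⊆ B → IsCompact L →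
      volume K + volume L ≤ 2 * volume C := by
    intro K hKA hK L hLB hL
    obtain ⟨a, ha⟩ := hA0
    obtain ⟨b, hb⟩ := hB0
    -- Adjoining a point keeps the compact sets nonempty; the supremum also ranges over the empty
    -- set.
    calc volume K + volume L ≤ volume (insert a K) + volume (insert b L) := by
          gcongr <;> exact Set.subset_insert _ _
      _ ≤ _ := by
          refine volume_add_le_of_isCompact (hK.insert a) (hL.insert b) (Set.insert_nonempty _ _)
            (Set.insert_nonempty _ _) fun x hx y hy => h x ?_ y ?_
          · exact (Set.insert_subset ha hKA) hx
          · exact (Set.insert_subset hb hLB) hy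
  simp only [iSup_and']
  exact ENNReal.biSup_add_biSup_le' ⟨∅, Set.empty_subset _, isCompact_empty⟩
    ⟨∅, Set.empty_subset _, isCompact_empty⟩ fun K hK L hL => main K hK.1 hK.2 L hL.1 hL.2

theorem lintegral_eq_lintegral_volume_lt {f : ℝ → ℝ≥0∞} (hf : Measurable f) (hf1 : ∀ x, f x ≤ 1) :
    ∫⁻ x, f x = ∫⁻ t in Set.Ioo (0 : ℝ) 1, volume {x | ENNReal.ofReal t < f x} := by
  have hfin : ∀ x, f x ≠ ⊤ := fun x => ne_top_of_le_ne_top ENNReal.one_ne_top (hf1 x)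
  have e : ∀ x, f x = ENNReal.ofReal (f x).toReal := fun x => (ENNReal.ofReal_toReal (hfin x)).symm
  have h1 : ∫⁻ x, f x = ∫⁻ t in Set.Ioi (0 : ℝ), volume {x | t < (f x).toReal} := by
    rw [← lintegral_eq_lintegral_meas_lt volume (Filter.Eventually.of_forall fun x => by simp)
      hf.ennreal_toReal.aemeasurable]
    exact lintegral_congr e
  have h2 : ∫⁻ t in Set.Ioi (0 : ℝ), volume {x | t < (f x).toReal}
      = ∫⁻ t in Set.Ioo (0 : ℝ) 1, volume {x | t < (f x).toReal} := by
    rw [← lintegral_indicator measurableSet_Ioi, ← lintegral_indicator measurableSet_Ioo]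
    refine lintegral_congr fun t => ?_
    by_cases h0 : 0 < t
    · by_cases h1 : t < 1
      · simp [Set.indicator, h0, h1]
      · have : {x | t < (f x).toReal} = ∅ := by
          ext x
          simp only [Set.mem_ofPred_eq, Set.mem_empty_iff_false, iff_false, not_lt]
          refine le_trans (ENNReal.toReal_mono ENNReal.one_ne_top (hf1 x)) ?_
          simpa using h1
        simp [Set.indicator, h0, h1, this]
    · simp [Set.indicator, h0]
  rw [h1, h2]
  refine setLIntegral_congr_fun measurableSet_Ioo fun t ht => ?_
  congr 1
  ext x
  simp only [Set.mem_ofPred_eq]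
  rw [ENNReal.ofReal_lt_iff_lt_toReal ht.1.le (hfin x)]

/-- Because both suprema are 1, the superlevel sets of `f` and `g` at every height below 1 are
nonempty, so the one-dimensional midpoint inequality applies at each height; the layer cake formula
integrates it. Cutting `h` at 1 confines the heights to the same interval. -/
theorem lintegral_add_le_of_iSup_eq_one {f g h : ℝ → ℝ≥0∞} (hf : Measurable f)
    (hg : Measurable g) (hh : Measurable h) (hf1 : ⨆ x, f x = 1) (hg1 : ⨆ x, g x = 1)
    (H : ∀ x y, f x * g y ≤ h ((x + y) / 2) ^ 2) :
    (∫⁻ x, f x) + ∫⁻ x, g x ≤ 2 * ∫⁻ x, h x := by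
  have hm : ∫⁻ x, min (h x) 1 ≤ ∫⁻ x, h x := lintegral_mono fun x => min_le_left _ _
  refine le_trans ?_ (mul_le_mul_right hm 2)
  have hfm : ∀ x, f x ≤ 1 := fun x => hf1 ▸ le_iSup f x
  have hgm : ∀ x, g x ≤ 1 := fun x => hg1 ▸ le_iSup g x
  have mf : ∀ f : ℝ → ℝ≥0∞, Measurable fun t : ℝ => volume {x | ENNReal.ofReal t < f x} := by
    intro f
    refine Antitone.measurable fun s t hst => measure_mono fun x hx => ?_
    exact lt_of_le_of_lt (ENNReal.ofReal_le_ofReal hst) hx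
  rw [lintegral_eq_lintegral_volume_lt hf hfm, lintegral_eq_lintegral_volume_lt hg hgm,
    lintegral_eq_lintegral_volume_lt (f := fun x => min (h x) 1) (hh.min measurable_const)
      (fun x => min_le_right _ _), ← lintegral_add_left (mf f), ← lintegral_const_mul _ (mf _)]
  refine setLIntegral_mono' measurableSet_Ioo fun t ht => ?_
  have ht1 : ENNReal.ofReal t < 1 := by
    rw [ENNReal.ofReal_lt_one]; exact ht.2
  refine volume_add_le_of_midpoint_mem (measurableSet_lt measurable_const hf)
    (measurableSet_lt measurable_const hg) ?_ ?_ ?_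
  · obtain ⟨x, hx⟩ := lt_iSup_iff.1 (hf1.symm ▸ ht1); exact ⟨x, hx⟩
  · obtain ⟨x, hx⟩ := lt_iSup_iff.1 (hg1.symm ▸ ht1); exact ⟨x, hx⟩
  · intro a ha b hb
    simp only [Set.mem_ofPred_eq] at ha hb ⊢
    refine lt_min ?_ ht1
    have h2 := ENNReal.mul_lt_mul ha hb
    have h3 := lt_of_lt_of_le h2 (H a b)
    rw [← sq] at h3
    exact lt_of_not_ge fun hle => absurd (h3.trans_le (pow_le_pow_left' hle 2)) (lt_irrefl _)

theorem ENNReal.four_mul_le_add_sq (a b : ℝ≥0∞) : 4 * (a * b) ≤ (a + b) ^ 2 := by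
  by_cases ha : a = ⊤
  · simp [ha]
  by_cases hb : b = ⊤
  · simp [hb]
  lift a to NNReal using ha
  lift b to NNReal using hb
  have : 4 * (a * b) ≤ (a + b) ^ 2 := by
    have := four_mul_le_sq_add (a : ℝ) b
    rw [← NNReal.coe_le_coe]; push_cast; linarith
  exact_mod_cast this

/-- Dividing `f`, `g`, `h` by `a`, `b`, `√(ab)` preserves the hypothesis and makes both suprema 1.
The additive inequality then becomes multiplicative by the arithmetic–geometric mean inequality. -/
theorem prekopaLeindler_real_of_bounded {f g h : ℝ → ℝ≥0∞} (hf : Measurable f)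
    (hg : Measurable g) (hh : Measurable h) (hf1 : ⨆ x, f x ≠ ⊤) (hg1 : ⨆ x, g x ≠ ⊤)
    (H : ∀ x y, f x * g y ≤ h ((x + y) / 2) ^ 2) :
    (∫⁻ x, f x) * ∫⁻ x, g x ≤ (∫⁻ x, h x) ^ 2 := by
  set a := ⨆ x, f x with ha
  set b := ⨆ x, g x with hb
  by_cases ha0 : a = 0
  · have : ∀ x, f x = 0 := by rw [ha] at ha0; simpa using ha0
    simp [this]
  by_cases hb0 : b = 0
  · have : ∀ x, g x = 0 := by rw [hb] at hb0; simpa using hb0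
    simp [this]
  set c : ℝ≥0∞ := (a * b) ^ (1 / 2 : ℝ) with hc
  have hcc : c ^ 2 = a * b := by
    rw [hc, ← ENNReal.rpow_natCast, ← ENNReal.rpow_mul]; norm_num
  have hc0 : c ≠ 0 := by
    intro h0; rw [h0] at hcc; simp at hcc; tauto
  have hct : c ≠ ⊤ := by
    intro h0; rw [h0] at hcc; exact (ENNReal.mul_ne_top hf1 hg1) (hcc.symm.trans (by simp))
  have key := lintegral_add_le_of_iSup_eq_one (f := fun x => a⁻¹ * f x) (g := fun x => b⁻¹ * g x)
    (h := fun x => c⁻¹ * h x) (hf.const_mul _) (hg.const_mul _) (hh.const_mul _)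
    (by rw [← ENNReal.mul_iSup, ← ha, ENNReal.inv_mul_cancel ha0 hf1])
    (by rw [← ENNReal.mul_iSup, ← hb, ENNReal.inv_mul_cancel hb0 hg1])
    (by
      intro x y
      rw [mul_pow, ← ENNReal.inv_pow, hcc, mul_mul_mul_comm,
        ENNReal.mul_inv (Or.inl ha0) (Or.inl hf1)]
      gcongr
      exact H x y)
  rw [lintegral_const_mul _ hf, lintegral_const_mul _ hg, lintegral_const_mul _ hh] at key
  have h2 := (ENNReal.four_mul_le_add_sq _ _).trans (pow_le_pow_left' key 2)
  rw [mul_pow, mul_pow, ← ENNReal.inv_pow, hcc, mul_mul_mul_comm,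
    ← ENNReal.mul_inv (Or.inl ha0) (Or.inl hf1)] at h2
  norm_num at h2
  rw [ENNReal.mul_le_mul_iff_right (by norm_num) (by norm_num), ENNReal.mul_le_mul_iff_right] at h2
  · exact h2
  · rw [← hcc]; simp [hct]
  · rw [← hcc]; simp [hc0]

theorem prekopaLeindler_real {f g h : ℝ → ℝ≥0∞} (hf : Measurable f)
    (hg : Measurable g) (hh : Measurable h)
    (H : ∀ x y, f x * g y ≤ h ((x + y) / 2) ^ 2) :
    (∫⁻ x, f x) * ∫⁻ x, g x ≤ (∫⁻ x, h x) ^ 2 := by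
  have trunc : ∀ f : ℝ → ℝ≥0∞, Measurable f → ∫⁻ x, f x = ⨆ N : ℕ, ∫⁻ x, min (f x) N := by
    intro f hf
    rw [← lintegral_iSup (fun N => hf.min measurable_const)
      (fun N M hNM x => min_le_min le_rfl (by exact_mod_cast hNM))]
    refine lintegral_congr fun x => ?_
    rw [← inf_iSup_eq, ENNReal.iSup_natCast, inf_top_eq]
  have hb : ∀ (f : ℝ → ℝ≥0∞) (N : ℕ), ⨆ x, min (f x) (N : ℝ≥0∞) ≠ ⊤ := fun f N =>
    ne_top_of_le_ne_top (ENNReal.natCast_ne_top N) (iSup_le fun x => min_le_right _ _)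
  rw [trunc f hf, trunc g hg, ENNReal.iSup_mul]
  refine iSup_le fun N => ?_
  rw [ENNReal.mul_iSup]
  refine iSup_le fun M => ?_
  refine prekopaLeindler_real_of_bounded (hf.min measurable_const) (hg.min measurable_const) hh
    (hb f N) (hb g M) fun x y => le_trans ?_ (H x y)
  gcongr <;> exact min_le_left _ _

/-- The inequality tensorizes: by induction it holds for the slices over first coordinates `a`, `b`
and `(a + b) / 2`, which is the one-dimensional hypothesis for the slice integrals. -/
theorem prekopaLeindler_pi {n : ℕ} {f g h : (Fin n → ℝ) → ℝ≥0∞} (hf : Measurable f)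
    (hg : Measurable g) (hh : Measurable h)
    (H : ∀ x y, f x * g y ≤ h (fun i => (x i + y i) / 2) ^ 2) :
    (∫⁻ x, f x) * ∫⁻ x, g x ≤ (∫⁻ x, h x) ^ 2 := by
  induction n with
  | zero =>
    rw [lintegral_unique, lintegral_unique, lintegral_unique]
    have : (volume : Measure (Fin 0 → ℝ)) Set.univ = 1 := by
      rw [volume_pi, Measure.pi_univ]; simp
    simp only [this, mul_one]
    convert H default default using 3
  | succ n ih =>
    have e := (volume_preserving_piFinSuccAbove (fun _ : Fin (n + 1) => ℝ) 0).symm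
    have he : ∀ q, (MeasurableEquiv.piFinSuccAbove (fun _ : Fin (n + 1) => ℝ) 0).symm q
        = Fin.cons q.1 q.2 := by
      intro q
      ext i
      refine Fin.cases ?_ (fun j => ?_) i <;> simp [MeasurableEquiv.piFinSuccAbove]
    have split : ∀ f : (Fin (n + 1) → ℝ) → ℝ≥0∞, Measurable f →
        ∫⁻ x, f x = ∫⁻ a : ℝ, ∫⁻ x : Fin n → ℝ, f (Fin.cons a x) := by
      intro f hf
      rw [← e.lintegral_comp hf, Measure.volume_eq_prod, lintegral_prod]
      · simp only [he]
      · exact (hf.comp (MeasurableEquiv.measurable _)).aemeasurable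
    have hm2 : ∀ f : (Fin (n + 1) → ℝ) → ℝ≥0∞, Measurable f →
        Measurable fun q : ℝ × (Fin n → ℝ) => f (Fin.cons q.1 q.2) := by
      intro f hf
      simp only [← he]
      exact hf.comp (MeasurableEquiv.piFinSuccAbove (fun _ : Fin (n + 1) => ℝ) 0).symm.measurable
    rw [split f hf, split g hg, split h hh]
    refine prekopaLeindler_real (hm2 f hf).lintegral_prod_right' (hm2 g hg).lintegral_prod_right'
      (hm2 h hh).lintegral_prod_right' fun a b => ?_
    refine ih ((hm2 f hf).comp measurable_prodMk_left) ((hm2 g hg).comp measurable_prodMk_left)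
      ((hm2 h hh).comp measurable_prodMk_left) fun x y => ?_
    have := H (Fin.cons a x) (Fin.cons b y)
    convert this using 3
    ext i
    refine Fin.cases ?_ (fun j => ?_) i <;> simp

/-- The Prékopa–Leindler inequality for midpoints on Euclidean space. -/
theorem prekopaLeindler {n : ℕ} {f g h : EuclideanSpace ℝ (Fin n) → ℝ≥0∞} (hf : Measurable f)
    (hg : Measurable g) (hh : Measurable h)
    (H : ∀ x y, f x * g y ≤ h ((2⁻¹ : ℝ) • (x + y)) ^ 2) :
    (∫⁻ x, f x) * ∫⁻ x, g x ≤ (∫⁻ x, h x) ^ 2 := by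
  have e := PiLp.volume_preserving_toLp (Fin n)
  rw [← e.lintegral_comp hf, ← e.lintegral_comp hg, ← e.lintegral_comp hh]
  refine prekopaLeindler_pi (hf.comp e.measurable) (hg.comp e.measurable) (hh.comp e.measurable)
    fun x y => ?_
  convert H (WithLp.toLp 2 x) (WithLp.toLp 2 y) using 3
  ext i
  simp; ring

end PrekopaLeindler

/-! ### Dini monotonicity and Taylor estimates. -/

section RealAnalysis

/-- A function with nonnegative lower left Dini derivatives that is lower semicontinuous from the
right is nondecreasing. -/
theorem le_of_left_dini_of_right_lsc {k : ℝ → ℝ} {a b : ℝ} (hab : a ≤ b)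
    (hleft : ∀ t ∈ Set.Ioc a b, ∀ e > 0, ∀ᶠ s in 𝓝[<] t, k s ≤ k t + e * (t - s))
    (hright : ∀ t ∈ Set.Ico a b, ∀ c < k t, ∀ᶠ s in 𝓝[>] t, c < k s) : k a ≤ k b := by
  suffices H : ∀ e > 0, k a ≤ k b + e * (b - a) by
    refine le_of_forall_pos_le_add fun d hd => ?_
    refine (H (d / (b - a + 1)) (by have : 0 < b - a + 1 := by linarith
                                    positivity)).trans ?_
    have : d / (b - a + 1) * (b - a) ≤ d := by
      rw [div_mul_eq_mul_div, div_le_iff₀ (by linarith)]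
      nlinarith
    linarith
  intro e he
  -- Points down to which the bound with slope `e` holds all the way from `b`. Right semicontinuity
  -- puts the infimum into `S`; if the infimum exceeded `a`, the left Dini bound there would extend
  -- the interval.
  set S : Set ℝ := {r | r ∈ Set.Icc a b ∧ ∀ r' ∈ Set.Icc r b, k r' ≤ k b + e * (b - r')} with hS
  have hbS : b ∈ S := by
    refine ⟨⟨hab, le_rfl⟩, fun r' hr' => ?_⟩
    have : r' = b := le_antisymm hr'.2 hr'.1
    simp [this]
  have hbdd : BddBelow S := ⟨a, fun r hr => hr.1.1⟩
  set r := sInf S with hr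
  have har : a ≤ r := le_csInf ⟨b, hbS⟩ fun x hx => hx.1.1
  have hrb : r ≤ b := csInf_le hbdd hbS
  have hgt : ∀ r' ∈ Set.Ioc r b, k r' ≤ k b + e * (b - r') := by
    intro r' hr'
    obtain ⟨x, hx, hxr⟩ := exists_lt_of_csInf_lt ⟨b, hbS⟩ hr'.1
    exact hx.2 r' ⟨hxr.le, hr'.2⟩
  have hkr : k r ≤ k b + e * (b - r) := by
    rcases hrb.eq_or_lt with h | h
    · rw [h]; simp
    by_contra hcon
    push Not at hcon
    have h1 := hright r ⟨har, h⟩ _ hcon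
    have h2 : ∀ᶠ s in 𝓝[>] r, s ∈ Set.Ioc r b := Ioc_mem_nhdsGT h
    obtain ⟨s, hs1, hs2⟩ := (h1.and h2).exists
    have h3 := hgt s hs2
    have : e * (b - s) ≤ e * (b - r) := by
      apply mul_le_mul_of_nonneg_left _ he.le; linarith [hs2.1]
    linarith
  rcases har.eq_or_lt with h | h
  · rw [h]; exact hkr
  exfalso
  have h1 := hleft r ⟨h, hrb⟩ e he
  rw [eventually_iff_exists_mem] at h1
  obtain ⟨V, hV, hVk⟩ := h1
  obtain ⟨l, hl, hlV⟩ := (mem_nhdsLT_iff_exists_Ioo_subset' h).1 hV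
  set s := (max a l + r) / 2 with hs
  have hmx : max a l < r := max_lt h hl
  have hsr : s < r := by rw [hs]; linarith
  have has : max a l < s := by rw [hs]; linarith
  have hsS : s ∈ S := by
    refine ⟨⟨(le_max_left a l).trans has.le, hsr.le.trans hrb⟩, fun r' hr' => ?_⟩
    rcases lt_trichotomy r' r with h3 | h3 | h3
    · have := hVk r' (hlV ⟨((le_max_right a l).trans_lt has).trans_le hr'.1, h3⟩)
      calc k r' ≤ k r + e * (r - r') := this
        _ ≤ k b + e * (b - r) + e * (r - r') := by linarith
        _ = _ := by ring
    · rw [h3]; exact hkr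
    · exact hgt r' ⟨h3, hr'.2⟩
  exact absurd (csInf_le hbdd hsS) (not_le.2 hsr)

/-- Bookkeeping of orders: `u` has order `η`, `w` order `η²`, and everything of order `η³` goes into
the error. As `1 ≤ C`, all powers of `C` are at most `C³`, and `32 = 27 + 1 + 4`. The logarithmic
counterpart has `59 = 54 + 1 + 4`. -/
theorem abs_exp_sub_quadratic_le {C η u w y : ℝ} (hC : 1 ≤ C) (hη : 0 ≤ η) (hηC : 6 * C * η ≤ 1)
    (hu : |u| ≤ C * η) (hw : |w| ≤ C * η ^ 2) (hy : |y - (u + w)| ≤ C * η ^ 3) :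
    |Real.exp y - (1 + u + w + u ^ 2 / 2)| ≤ 32 * C ^ 3 * η ^ 3 := by
  have hη1 : η ≤ 1 := by nlinarith
  have h2 : η ^ 2 ≤ η := by nlinarith
  have h3 : η ^ 3 ≤ η ^ 2 := by nlinarith [sq_nonneg η]
  have hyu : |y - u| ≤ 2 * C * η ^ 2 := by
    calc |y - u| = |(y - (u + w)) + w| := by ring_nf
      _ ≤ |y - (u + w)| + |w| := abs_add_le _ _
      _ ≤ _ := by nlinarith
  have hy3 : |y| ≤ 3 * C * η := by
    calc |y| = |(y - u) + u| := by ring_nf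
      _ ≤ |y - u| + |u| := abs_add_le _ _
      _ ≤ _ := by nlinarith
  have hy1 : |y| ≤ 1 := by nlinarith
  have he := Real.exp_bound hy1 (n := 3) (by norm_num)
  have he' : |Real.exp y - (1 + y + y ^ 2 / 2)| ≤ |y| ^ 3 := by
    have : ∑ m ∈ Finset.range 3, y ^ m / (m.factorial : ℝ) = 1 + y + y ^ 2 / 2 := by
      simp [Finset.sum_range_succ, Nat.factorial]
    rw [this] at he
    refine he.trans ?_
    have : (0:ℝ) ≤ |y| ^ 3 := by positivity
    norm_num [Nat.factorial]
    nlinarith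
  have hcube : |y| ^ 3 ≤ 27 * C ^ 3 * η ^ 3 := by
    calc |y| ^ 3 ≤ (3 * C * η) ^ 3 := pow_le_pow_left₀ (abs_nonneg _) hy3 3
      _ = _ := by ring
  have hsq : |y ^ 2 / 2 - u ^ 2 / 2| ≤ 4 * C ^ 2 * η ^ 3 := by
    have e : y ^ 2 / 2 - u ^ 2 / 2 = (y - u) * (y + u) / 2 := by ring
    have h4 : |y + u| ≤ 4 * C * η := (abs_add_le _ _).trans (by linarith)
    rw [e, abs_div, abs_mul, abs_two]
    have := mul_le_mul hyu h4 (abs_nonneg _) (by positivity)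
    nlinarith
  have hC3 : C ≤ C ^ 3 := by nlinarith [sq_nonneg C, mul_self_nonneg (C - 1)]
  have hC2 : C ^ 2 ≤ C ^ 3 := by nlinarith [sq_nonneg C]
  have hη3 : 0 ≤ η ^ 3 := by positivity
  calc |Real.exp y - (1 + u + w + u ^ 2 / 2)|
      = |(Real.exp y - (1 + y + y ^ 2 / 2)) + (y - (u + w)) + (y ^ 2 / 2 - u ^ 2 / 2)| := by ring_nf
    _ ≤ |Real.exp y - (1 + y + y ^ 2 / 2)| + |y - (u + w)| + |y ^ 2 / 2 - u ^ 2 / 2| :=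
        abs_add_three _ _ _
    _ ≤ 27 * C ^ 3 * η ^ 3 + C * η ^ 3 + 4 * C ^ 2 * η ^ 3 := by linarith
    _ ≤ _ := by
        have := mul_le_mul_of_nonneg_right hC3 hη3
        have := mul_le_mul_of_nonneg_right hC2 hη3
        linarith

theorem abs_log_sub_quadratic_le {C η u w D : ℝ} (hC : 1 ≤ C) (hη : 0 ≤ η) (hηC : 6 * C * η ≤ 1)
    (hu : |u| ≤ C * η) (hw : |w| ≤ C * η ^ 2) (hD : |D - (1 + u + w)| ≤ C * η ^ 3) :
    |Real.log D - (u + w - u ^ 2 / 2)| ≤ 59 * C ^ 3 * η ^ 3 := by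
  have hη1 : η ≤ 1 := by nlinarith
  have h2 : η ^ 2 ≤ η := by nlinarith
  have h3 : η ^ 3 ≤ η ^ 2 := by nlinarith [sq_nonneg η]
  set y := D - 1 with hy
  have hyw : |y - (u + w)| ≤ C * η ^ 3 := by
    rw [hy]; convert hD using 2; ring
  have hyu : |y - u| ≤ 2 * C * η ^ 2 := by
    calc |y - u| = |(y - (u + w)) + w| := by ring_nf
      _ ≤ |y - (u + w)| + |w| := abs_add_le _ _
      _ ≤ _ := by nlinarith
  have hy3 : |y| ≤ 3 * C * η := by
    calc |y| = |(y - u) + u| := by ring_nf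
      _ ≤ |y - u| + |u| := abs_add_le _ _
      _ ≤ _ := by nlinarith
  have hy1 : |y| ≤ 1 / 2 := by nlinarith
  have he := Real.abs_log_sub_add_sum_range_le (x := -y) (by rw [abs_neg]; linarith) 2
  have he' : |Real.log D - (y - y ^ 2 / 2)| ≤ 2 * |y| ^ 3 := by
    have e1 : ∑ i ∈ Finset.range 2, (-y) ^ (i + 1) / ((i : ℝ) + 1) + Real.log (1 - -y)
        = Real.log D - (y - y ^ 2 / 2) := by
      have : 1 - -y = D := by rw [hy]; ring
      rw [this]
      simp [Finset.sum_range_succ]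
      ring
    rw [e1, abs_neg] at he
    refine he.trans ?_
    have : (0:ℝ) ≤ |y| ^ 3 := by positivity
    rw [div_le_iff₀ (by linarith), show |y| ^ (2 + 1) = |y| ^ 3 from rfl]
    have := mul_nonneg this (by linarith : 0 ≤ 1 / 2 - |y|)
    linarith
  have hcube : |y| ^ 3 ≤ 27 * C ^ 3 * η ^ 3 := by
    calc |y| ^ 3 ≤ (3 * C * η) ^ 3 := pow_le_pow_left₀ (abs_nonneg _) hy3 3
      _ = _ := by ring
  have hsq : |u ^ 2 / 2 - y ^ 2 / 2| ≤ 4 * C ^ 2 * η ^ 3 := by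
    have e : u ^ 2 / 2 - y ^ 2 / 2 = -((y - u) * (y + u) / 2) := by ring
    have h4 : |y + u| ≤ 4 * C * η := (abs_add_le _ _).trans (by linarith)
    rw [e, abs_neg, abs_div, abs_mul, abs_two]
    have := mul_le_mul hyu h4 (abs_nonneg _) (by positivity)
    nlinarith
  have hC3 : C ≤ C ^ 3 := by nlinarith [sq_nonneg C, mul_self_nonneg (C - 1)]
  have hC2 : C ^ 2 ≤ C ^ 3 := by nlinarith [sq_nonneg C]
  have hη3 : 0 ≤ η ^ 3 := by positivity
  calc |Real.log D - (u + w - u ^ 2 / 2)|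
      = |(Real.log D - (y - y ^ 2 / 2)) + (y - (u + w)) + (u ^ 2 / 2 - y ^ 2 / 2)| := by ring_nf
    _ ≤ |Real.log D - (y - y ^ 2 / 2)| + |y - (u + w)| + |u ^ 2 / 2 - y ^ 2 / 2| :=
        abs_add_three _ _ _
    _ ≤ 54 * C ^ 3 * η ^ 3 + C * η ^ 3 + 4 * C ^ 2 * η ^ 3 := by linarith
    _ ≤ _ := by
        have := mul_le_mul_of_nonneg_right hC3 hη3
        have := mul_le_mul_of_nonneg_right hC2 hη3
        linarith

/-! ### Expansion of Gaussian densities and the two-point inequality. -/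

/-- The one-dimensional Gaussian density of variance `t`. -/
noncomputable def gaussKer (t w : ℝ) : ℝ := Real.exp (-w ^ 2 / (2 * t)) / Real.sqrt (2 * Real.pi * t)

theorem gaussKer_pos {t : ℝ} (ht : 0 < t) (w : ℝ) : 0 < gaussKer t w := by
  unfold gaussKer; positivity

/-- The exact quotient depends only on the dimensionless quantities `ε w / T` and `ε² / T`, which
reduces its expansion to a scalar estimate. -/
theorem gaussKer_div_eq_exp {T ε w j : ℝ} (hT : 0 < T) (hb : ε ^ 2 / T < 1) :
    gaussKer (T - ε ^ 2) (w + j * ε) / gaussKer T w =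
      Real.exp (-Real.log (1 - ε ^ 2 / T) / 2 - (j * (ε * w / T) + j ^ 2 * (ε ^ 2 / T) / 2
        + (ε * w / T) ^ 2 / 2) / (1 - ε ^ 2 / T)) := by
  set b := ε ^ 2 / T with hbb
  have h1b : 0 < 1 - b := by linarith
  have hne : 1 - b ≠ 0 := h1b.ne'
  have hε : ε ^ 2 = b * T := by rw [hbb]; field_simp
  have hTs : T - ε ^ 2 = T * (1 - b) := by rw [hε]; ring
  have e1 : Real.sqrt (2 * Real.pi * (T - ε ^ 2))
      = Real.sqrt (2 * Real.pi * T) * Real.exp (Real.log (1 - b) / 2) := by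
    rw [hTs, ← mul_assoc, Real.sqrt_mul (by positivity)]
    congr 1
    rw [Real.sqrt_eq_rpow, Real.rpow_def_of_pos h1b]; congr 1; ring
  have e2 : -(w + j * ε) ^ 2 / (2 * (T - ε ^ 2)) - (-w ^ 2 / (2 * T)) =
      - ((j * (ε * w / T) + j ^ 2 * b / 2 + (ε * w / T) ^ 2 / 2) / (1 - b)) := by
    have h2 : (ε * w / T) * T = ε * w := by field_simp
    set A := ε * w / T
    have h3 : A ^ 2 * T ^ 2 = b * T * w ^ 2 := by
      rw [← mul_pow, h2, mul_pow, hε]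
    rw [hTs, div_sub_div _ _ (by positivity) (by positivity), ← neg_div,
      div_eq_div_iff (by positivity) hne]
    linear_combination (-(2 * j ^ 2 * T * (1 - b))) * hε + (4 * j * T * (1 - b)) * h2
      + 2 * (1 - b) * h3
  unfold gaussKer
  rw [e1, sub_eq_add_neg (-Real.log (1 - b) / 2), ← e2, neg_div, Real.exp_add, Real.exp_sub,
    Real.exp_neg]
  have : Real.sqrt (2 * Real.pi * T) ≠ 0 := by positivity
  field_simp
  rw [← Real.exp_add, add_neg_cancel, Real.exp_zero]

/-- The coefficient `(j² - 1) / 2` is the heat equation: a shift by `jε` contributes `j² / 2` times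
the second derivative, and shortening the time by `ε²` removes half of it. The exponential estimate
is used with `C = 7`, hence `42 = 6 * 7`. -/
theorem abs_exp_log_sub_le {a b j η : ℝ} (hη : 42 * η ≤ 1) (hη0 : 0 ≤ η) (ha : |a| ≤ η)
    (hb0 : 0 ≤ b) (hb : b ≤ η ^ 2) (hj : |j| ≤ 2) :
    |Real.exp (-Real.log (1 - b) / 2 - (j * a + j ^ 2 * b / 2 + a ^ 2 / 2) / (1 - b)) -
      (1 + j * (-a) + (j ^ 2 - 1) / 2 * (a ^ 2 - b))| ≤ 32 * 7 ^ 3 * η ^ 3 := by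
  have hη2 : η ^ 2 ≤ η / 42 := by nlinarith
  have hη2' : 0 ≤ η ^ 2 := by positivity
  have hη3 : 0 ≤ η ^ 3 := by positivity
  have hb1 : b ≤ 1 / 42 := by linarith
  have h1b : 0 < 1 - b := by linarith
  have hj2 : j ^ 2 ≤ 4 := by nlinarith [abs_le.1 hj]
  have ha2 : a ^ 2 ≤ η ^ 2 := sq_le_sq' (abs_le.1 ha).1 (abs_le.1 ha).2
  have ha0 : 0 ≤ a ^ 2 := sq_nonneg a
  have hja : |j * a| ≤ 2 * η := by
    rw [abs_mul]; exact mul_le_mul hj ha (abs_nonneg _) (by norm_num)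
  have hjb : j ^ 2 * b ≤ 4 * η ^ 2 := mul_le_mul hj2 hb hb0 (by norm_num)
  have hjb0 : 0 ≤ j ^ 2 * b := by positivity
  have hja' := abs_le.1 hja
  have hu : |(-(j * a))| ≤ 7 * η := by
    rw [abs_neg]; linarith
  have hw : |b / 2 - j ^ 2 * b / 2 - a ^ 2 / 2| ≤ 7 * η ^ 2 := by
    rw [abs_le]; constructor <;> linarith
  set S := j * a + j ^ 2 * b / 2 + a ^ 2 / 2 with hS
  have hSb : |S| ≤ 3 * η := by
    rw [hS, abs_le]; constructor <;> linarith
  have hlog : |Real.log (1 - b) + b| ≤ η ^ 3 := by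
    have := Real.abs_log_sub_add_sum_range_le (x := b) (by rw [abs_of_nonneg hb0]; linarith) 1
    simp only [Finset.sum_range_one, zero_add, pow_one, Nat.cast_zero, div_one] at this
    rw [add_comm]
    refine this.trans ?_
    rw [abs_of_nonneg hb0, div_le_iff₀ h1b]
    norm_num
    have h7 : b ^ 2 ≤ η ^ 2 * (η / 42) := by
      rw [sq]; exact mul_le_mul hb (hb.trans hη2) hb0 (by positivity)
    have h8 : η ^ 3 * (1 / 2) ≤ η ^ 3 * (1 - b) := by gcongr; linarith
    linarith
  have hyy : |(-Real.log (1 - b) / 2 - S / (1 - b))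
      - (-(j * a) + (b / 2 - j ^ 2 * b / 2 - a ^ 2 / 2))| ≤ 7 * η ^ 3 := by
    have e : (-Real.log (1 - b) / 2 - S / (1 - b))
        - (-(j * a) + (b / 2 - j ^ 2 * b / 2 - a ^ 2 / 2))
        = -(Real.log (1 - b) + b) / 2 + -(S * (b / (1 - b))) := by
      have e3 : S / (1 - b) = S + S * (b / (1 - b)) := by field_simp; ring
      rw [e3, hS]; ring
    have h5 : b / (1 - b) ≤ 2 * η ^ 2 := by
      rw [div_le_iff₀ h1b]
      have : 2 * η ^ 2 * (1 / 2) ≤ 2 * η ^ 2 * (1 - b) := by gcongr; linarith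
      linarith
    have h6 : |S * (b / (1 - b))| ≤ 3 * η * (2 * η ^ 2) := by
      rw [abs_mul, abs_of_nonneg (div_nonneg hb0 h1b.le)]
      exact mul_le_mul hSb h5 (div_nonneg hb0 h1b.le) (by positivity)
    rw [e]
    refine (abs_add_le _ _).trans ?_
    rw [abs_neg, abs_div, abs_neg, abs_two]
    have : 3 * η * (2 * η ^ 2) = 6 * η ^ 3 := by ring
    linarith
  have := abs_exp_sub_quadratic_le (by norm_num) hη0 (by linarith) hu hw hyy
  convert this using 2
  ring

/-- Second order expansion of a quotient of Gaussian densities. -/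
theorem abs_gaussKer_div_sub_le {T ε w j η : ℝ} (hT : 0 < T) (hη : 42 * η ≤ 1)
    (hη0 : 0 ≤ η) (ha : |ε * w / T| ≤ η) (hb : ε ^ 2 / T ≤ η ^ 2) (hj : |j| ≤ 2) :
    |gaussKer (T - ε ^ 2) (w + j * ε) / gaussKer T w -
      (1 + j * (-(ε * w / T)) + (j ^ 2 - 1) / 2 * ((ε * w / T) ^ 2 - ε ^ 2 / T))|
      ≤ 32 * 7 ^ 3 * η ^ 3 := by
  rw [gaussKer_div_eq_exp hT (by nlinarith)]
  exact abs_exp_log_sub_le hη hη0 ha (by positivity) hb hj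

/-- The algebra behind the theorem. To second order, `log D j = j A + (j² - 1) B / 2 - j² A² / 2`.
Adding this at `κ + β` and `κ - β` eliminates `B` because `κ² + β² = 1` and leaves `2κA - A²`.
Multiplying by `1 / (2p)` and exponentiating, the quadratic terms cancel because `κ² = p`, leaving
`1 + κA / p`. The linear terms cancel in the average over the sign of `κ`. -/
theorem one_sub_le_two_point {p : ℝ} (hp0 : 0 < p) {C₀ : ℝ} (hC₀ : 1 ≤ C₀) :
    ∃ C > 0, ∃ c > 0, ∀ (η A B κ β : ℝ) (D : ℝ → ℝ), 0 ≤ η → η ≤ c → |A| ≤ C₀ * η →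
      |B| ≤ C₀ * η ^ 2 → κ ^ 2 = p → κ ^ 2 + β ^ 2 = 1 → (∀ j, 0 < D j) →
      (∀ j, |j| ≤ 2 → |D j - (1 + j * A + (j ^ 2 - 1) / 2 * B)| ≤ C₀ * η ^ 3) →
      1 - C * η ^ 3 ≤ ((D (κ + β) * D (κ - β)) ^ (1 / (2 * p))
        + (D (-κ + β) * D (-κ - β)) ^ (1 / (2 * p))) / 2 := by
  set C₁ := 2 * C₀ with hC₁
  have hC₁1 : 1 ≤ C₁ := by linarith
  set C₂ := 59 * C₁ ^ 3 with hC₂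
  set θ := 1 / (2 * p) with hθ
  have hθ0 : 0 < θ := by positivity
  set C₃ := max 1 (max (2 * θ * C₂) (2 * θ * C₀ ^ 2 + 2 * θ * C₀)) with hC₃
  have hC₃1 : 1 ≤ C₃ := le_max_left _ _
  have hC₃2 : 2 * θ * C₂ ≤ C₃ := (le_max_left _ _).trans (le_max_right _ _)
  have hC₃3 : 2 * θ * C₀ ^ 2 + 2 * θ * C₀ ≤ C₃ := (le_max_right _ _).trans (le_max_right _ _)
  refine ⟨32 * C₃ ^ 3, by positivity, min (1 / (6 * C₁)) (1 / (6 * C₃)), by positivity, ?_⟩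
  intro η A B κ β D hη hηc hA hB hκ hκβ hDpos hD
  have hc1 : 6 * C₁ * η ≤ 1 := by
    have := hηc.trans (min_le_left _ _)
    rw [le_div_iff₀ (by positivity)] at this; linarith
  have hc3 : 6 * C₃ * η ≤ 1 := by
    have := hηc.trans (min_le_right _ _)
    rw [le_div_iff₀ (by positivity)] at this; linarith
  have hL : ∀ j, |j| ≤ 2 →
      |Real.log (D j) - (j * A + (j ^ 2 - 1) / 2 * B - (j * A) ^ 2 / 2)| ≤ C₂ * η ^ 3 := by
    intro j hj
    have hj2 : j ^ 2 ≤ 4 := by nlinarith [abs_le.1 hj]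
    refine abs_log_sub_quadratic_le hC₁1 hη hc1 ?_ ?_ ?_
    · rw [abs_mul, hC₁]
      nlinarith [abs_nonneg j, abs_nonneg A, mul_nonneg (by linarith : (0:ℝ) ≤ C₀) hη]
    · rw [abs_mul, hC₁]
      have : |(j ^ 2 - 1) / 2| ≤ 2 := by
        rw [abs_le]; constructor <;> nlinarith [sq_nonneg j]
      nlinarith [abs_nonneg B, abs_nonneg ((j ^ 2 - 1) / 2), mul_nonneg (by linarith : (0:ℝ) ≤ C₀) (sq_nonneg η)]
    · refine (hD j hj).trans ?_
      have : 0 ≤ C₀ * η ^ 3 := by positivity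
      rw [hC₁]; linarith
  have hκ1 : |κ| ≤ 1 := by rw [abs_le]; constructor <;> nlinarith [sq_nonneg β]
  have hβ1 : |β| ≤ 1 := by rw [abs_le]; constructor <;> nlinarith [sq_nonneg κ]
  have hpθ : 2 * θ * p = 1 := by rw [hθ]; field_simp
  have main : ∀ σ : ℝ, σ ^ 2 = 1 →
      |(D (σ * κ + β) * D (σ * κ - β)) ^ θ - (1 + 2 * θ * σ * κ * A)| ≤ 32 * C₃ ^ 3 * η ^ 3 := by
    intro σ hσ
    have hσ1 : |σ| = 1 := by
      rw [← abs_one]; exact (sq_eq_sq_iff_abs_eq_abs _ _).1 (by rw [hσ]; norm_num)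
    have hσκ : |σ * κ| ≤ 1 := by rw [abs_mul, hσ1, one_mul]; exact hκ1
    have l1 := hL (σ * κ + β) ((abs_add_le _ _).trans (by linarith))
    have l2 := hL (σ * κ - β) ((abs_sub _ _).trans (by linarith))
    rw [Real.rpow_def_of_pos (mul_pos (hDpos _) (hDpos _)),
      Real.log_mul (hDpos _).ne' (hDpos _).ne']
    have hAA : A ^ 2 ≤ C₀ ^ 2 * η ^ 2 := by
      rw [← mul_pow]; exact sq_le_sq' (by linarith [(abs_le.1 hA).1]) (abs_le.1 hA).2
    have hη3 : 0 ≤ η ^ 3 := by positivity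
    have key := abs_exp_sub_quadratic_le (C := C₃) (η := η) (u := 2 * θ * (σ * κ) * A)
      (w := -(θ * A ^ 2)) (y := (Real.log (D (σ * κ + β)) + Real.log (D (σ * κ - β))) * θ)
      hC₃1 hη hc3 ?_ ?_ ?_
    · convert key using 2
      -- The square produced by the exponential cancels `w = -θ A²`, since `2 θ p = 1`.
      have : (2 * θ * (σ * κ) * A) ^ 2 / 2 = θ * A ^ 2 := by
        calc (2 * θ * (σ * κ) * A) ^ 2 / 2 = 2 * θ ^ 2 * (σ ^ 2 * κ ^ 2) * A ^ 2 := by ring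
          _ = θ * (2 * θ * p) * A ^ 2 := by rw [hσ, hκ]; ring
          _ = _ := by rw [hpθ]; ring
      rw [this]; ring
    · rw [abs_mul, abs_mul, abs_of_pos (by positivity : 0 < 2 * θ)]
      calc 2 * θ * |σ * κ| * |A| ≤ 2 * θ * 1 * (C₀ * η) := by gcongr
        _ = (2 * θ * C₀) * η := by ring
        _ ≤ C₃ * η := by
            gcongr
            have : 0 ≤ 2 * θ * C₀ ^ 2 := by positivity
            linarith
    · rw [abs_neg, abs_of_nonneg (by positivity)]
      calc θ * A ^ 2 ≤ θ * (C₀ ^ 2 * η ^ 2) := by gcongr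
        _ = (θ * C₀ ^ 2) * η ^ 2 := by ring
        _ ≤ C₃ * η ^ 2 := by
            gcongr
            have : 0 ≤ 2 * θ * C₀ := by positivity
            have : 0 ≤ θ * C₀ ^ 2 := by positivity
            linarith
    · have e : (Real.log (D (σ * κ + β)) + Real.log (D (σ * κ - β))) * θ
          - (2 * θ * (σ * κ) * A + -(θ * A ^ 2))
          = θ * ((Real.log (D (σ * κ + β)) - ((σ * κ + β) * A + ((σ * κ + β) ^ 2 - 1) / 2 * B - ((σ * κ + β) * A) ^ 2 / 2))
          + (Real.log (D (σ * κ - β)) - ((σ * κ - β) * A + ((σ * κ - β) ^ 2 - 1) / 2 * B - ((σ * κ - β) * A) ^ 2 / 2))) := by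
        have h1 : (σ * κ) ^ 2 + β ^ 2 = 1 := by rw [mul_pow, hσ, one_mul, hκβ]
        linear_combination (-θ * A ^ 2 + θ * B) * h1
      rw [e, abs_mul, abs_of_pos hθ0]
      calc θ * _ ≤ θ * (C₂ * η ^ 3 + C₂ * η ^ 3) := by
            gcongr
            exact (abs_add_le _ _).trans (add_le_add l1 l2)
        _ = (2 * θ * C₂) * η ^ 3 := by ring
        _ ≤ _ := by gcongr
  have m1 := main 1 (by norm_num)
  have m2 := main (-1) (by norm_num)
  simp only [one_mul, neg_one_mul] at m1 m2
  have m1' := (abs_le.1 m1).1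
  have m2' := (abs_le.1 m2).1
  linarith

/-- The exponent `u - u² / 2` agrees with `log (1 + u)` to second order, so no quadratic term is
lost. The bound has to hold for all real `u` because it is integrated over the whole space. -/
theorem one_add_sub_cube_le_exp (u : ℝ) : 1 + u - |u| ^ 3 ≤ Real.exp (u - u ^ 2 / 2) := by
  have hpos := Real.exp_pos (u - u ^ 2 / 2)
  by_cases hu : |u| ≤ 1
  · have h1 := Real.exp_bound (x := u - u ^ 2 / 2) (n := 5)
    have h2 : 1 + (u - u ^ 2 / 2) + (u - u ^ 2 / 2) ^ 2 / 2 + (u - u ^ 2 / 2) ^ 3 / 6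
        ≤ Real.exp (u - u ^ 2 / 2) := by
      set v := u - u ^ 2 / 2
      have := Real.sum_le_exp_of_nonneg (x := v)
      rcases le_total 0 v with hv | hv
      · have := Real.sum_le_exp_of_nonneg hv 4
        simp [Finset.sum_range_succ, Nat.factorial] at this
        linarith
      · have h3 : ∀ x : ℝ, 0 ≤ x → Real.exp (-x) ≥ 1 + -x + (-x) ^ 2 / 2 + (-x) ^ 3 / 6 := by
          intro x hx
          have d1 : ∀ y : ℝ, HasDerivAt (fun x => Real.exp (-x) - (1 + -x + (-x) ^ 2 / 2 + (-x) ^ 3 / 6))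
              (-Real.exp (-y) + 1 - y + y ^ 2 / 2) y := by
            intro y
            have := ((hasDerivAt_neg y).exp).sub (((((hasDerivAt_neg y).const_add 1)).add
              (((hasDerivAt_neg y).pow 2).div_const 2)).add (((hasDerivAt_neg y).pow 3).div_const 6))
            refine this.congr_deriv ?_
            push_cast
            ring
          have hm : MonotoneOn (fun x => Real.exp (-x) - (1 + -x + (-x) ^ 2 / 2 + (-x) ^ 3 / 6)) (Set.Ici 0) := by
            refine monotoneOn_of_deriv_nonneg (convex_Ici 0) (fun y _ => (d1 y).continuousAt.continuousWithinAt)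
              (fun y _ => (d1 y).differentiableAt.differentiableWithinAt) fun y hy => ?_
            rw [interior_Ici] at hy
            rw [(d1 y).deriv]
            have hy0 : 0 < y := hy
            have h4 : Real.exp (-y) ≤ 1 / (1 + y + y ^ 2 / 2) := by
              rw [Real.exp_neg, ← one_div]
              exact one_div_le_one_div_of_le (by positivity) (Real.quadratic_le_exp_of_nonneg hy0.le)
            have h5 : 1 / (1 + y + y ^ 2 / 2) ≤ 1 - y + y ^ 2 / 2 := by
              rw [div_le_iff₀ (by positivity)]; nlinarith [sq_nonneg (y ^ 2)]
            linarith
          have := hm (Set.mem_Ici.2 le_rfl) hx hx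
          simp at this
          linarith
        have := h3 (-v) (by linarith)
        simpa using this
    refine le_trans ?_ h2
    rcases le_total 0 u with h0 | h0
    · rw [abs_of_nonneg h0] at hu ⊢
      have : 0 ≤ u ^ 3 * (1/2 + u/8 + (1 - u/2)^3/6) := by
        have : 0 ≤ 1 - u / 2 := by linarith
        positivity
      nlinarith
    · rw [abs_of_nonpos h0] at hu ⊢
      have hx : 0 ≤ (-u) ^ 3 := by have : 0 ≤ -u := by linarith
                                   positivity
      have h6 : 0 ≤ (-u) ^ 3 * (3/2 - u/8 - (1 - u/2)^3/6) := by
        apply mul_nonneg hx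
        have : (1 - u/2) ^ 3 ≤ (3/2) ^ 3 := by
          apply pow_le_pow_left₀ <;> linarith
        norm_num at this; linarith
      nlinarith
  · push Not at hu
    rcases le_total 0 u with h0 | h0
    · rw [abs_of_nonneg h0] at hu ⊢
      by_cases h2 : 1 + u - u ^ 3 ≤ 0
      · linarith
      · have h3 : u ≤ 3/2 := by by_contra h; push Not at h; nlinarith [sq_nonneg u, sq_nonneg (u-1)]
        have h4 := Real.add_one_le_exp (u - u ^ 2 / 2)
        nlinarith [mul_nonneg (sq_nonneg u) (by linarith : 0 ≤ u - 1)]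
    · rw [abs_of_nonpos h0] at hu ⊢
      have : 1 ≤ (-u) ^ 3 := one_le_pow₀ hu.le
      linarith

/-- Carries a relative error through the power `-Q`. The constant `Q + 1` serves both Bernoulli's
inequality for `1 ≤ Q` and the trivial bound `1 - r ≤ (1 - r)^Q` for `Q ≤ 1`. -/
theorem one_sub_mul_le_rpow {Q r : ℝ} (hQ : 0 < Q) (hr0 : 0 ≤ r) (hr1 : r ≤ 1) :
    1 - (Q + 1) * r ≤ (1 - r) ^ Q := by
  rcases le_total 1 Q with h | h
  · have := one_add_mul_self_le_rpow_one_add (s := -r) (by linarith) h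
    rw [← sub_eq_add_neg] at this
    nlinarith
  · have : (1 - r) ^ (1 : ℝ) ≤ (1 - r) ^ Q :=
      Real.rpow_le_rpow_of_exponent_ge_of_imp (by linarith) (by linarith) h (fun _ => by
        intro h0; linarith)
    rw [Real.rpow_one] at this
    nlinarith

end RealAnalysis

namespace LpVolume

variable {n : ℕ}

/-! ### Tilted Laplace integrals and the volume product -/

/-- The Laplace transform at `z` of the power `X ^ (-Q)`. -/
noncomputable def tilted (Q : ℝ) (X : EuclideanSpace ℝ (Fin n) → ℝ≥0∞)
    (z : EuclideanSpace ℝ (Fin n)) : ℝ≥0∞ :=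
  ∫⁻ x, X x ^ (-Q) * ENNReal.ofReal (Real.exp (inner ℝ z x))

/-- The infimum over translates in `M_p` becomes this infimum over exponential tilts: translation by
`z` corresponds to the tilt `q z`. -/
noncomputable def minTilted (Q : ℝ) (X : EuclideanSpace ℝ (Fin n) → ℝ≥0∞) : ℝ≥0∞ :=
  ⨅ z, tilted Q X z

/-- The Laplace transform of `f ^ (1 / p)`. -/
noncomputable def laplaceRoot (p : ℝ) (f : EuclideanSpace ℝ (Fin n) → ℝ≥0∞)
    (x : EuclideanSpace ℝ (Fin n)) : ℝ≥0∞ :=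
  laplace (fun y => f y ^ (1 / p)) x

theorem mul_rpow_of_left {a : ℝ≥0∞} (ha : a ≠ 0) (ha' : a ≠ ⊤) (b : ℝ≥0∞) (y : ℝ) :
    (a * b) ^ y = a ^ y * b ^ y := by
  rw [ENNReal.mul_rpow_eq_ite, if_neg]
  tauto

theorem ofReal_exp_ne_zero (r : ℝ) : ENNReal.ofReal (Real.exp r) ≠ 0 := by
  simp [Real.exp_pos]

theorem ofReal_exp_rpow (r s : ℝ) :
    ENNReal.ofReal (Real.exp r) ^ s = ENNReal.ofReal (Real.exp (s * r)) := by
  rw [ENNReal.ofReal_rpow_of_pos (Real.exp_pos _), ← Real.exp_mul, mul_comm]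

theorem ofReal_exp_mul_exp (r s : ℝ) :
    ENNReal.ofReal (Real.exp r) * ENNReal.ofReal (Real.exp s)
      = ENNReal.ofReal (Real.exp (r + s)) := by
  rw [Real.exp_add, ENNReal.ofReal_mul (Real.exp_pos _).le]

theorem lintegral_smul_eq (G : EuclideanSpace ℝ (Fin n) → ℝ≥0∞) {r : ℝ} (hr : 0 < r) :
    ∫⁻ x, G (r • x) = ENNReal.ofReal (r⁻¹ ^ n) * ∫⁻ x, G x := by
  have e := lintegral_map_equiv (μ := (volume : Measure (EuclideanSpace ℝ (Fin n)))) G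
    (Homeomorph.smulOfNeZero r hr.ne').toMeasurableEquiv
  have e2 : ⇑(Homeomorph.smulOfNeZero (α := EuclideanSpace ℝ (Fin n)) r hr.ne').toMeasurableEquiv
      = fun x => r • x := rfl
  rw [e2, Measure.map_addHaar_smul _ hr.ne', lintegral_smul_measure] at e
  rw [← e, finrank_euclideanSpace_fin, abs_of_pos (by positivity), inv_pow]
  rfl

theorem laplaceRoot_translate (p : ℝ) (f : EuclideanSpace ℝ (Fin n) → ℝ≥0∞)
    (z x : EuclideanSpace ℝ (Fin n)) :
    laplaceRoot p (translate z f) x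
      = ENNReal.ofReal (Real.exp (inner ℝ x z)) * laplaceRoot p f x := by
  unfold laplaceRoot laplace translate
  rw [← lintegral_const_mul' _ _ ENNReal.ofReal_ne_top,
    ← lintegral_sub_right_eq_self (fun y => ENNReal.ofReal (Real.exp (inner ℝ x z)) *
      (f y ^ (1 / p) * ENNReal.ofReal (Real.exp (inner ℝ x y)))) z]
  refine lintegral_congr fun y => ?_
  rw [mul_left_comm, ofReal_exp_mul_exp, inner_sub_right]
  congr 4
  ring

/-- Here `-q = p / (1 - p)` and `-p / q = 1 - p`. The dilation by `1 / p` contributes `p ^ n`, and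
since `q ≠ 0` the tilts `q z` run over all vectors. -/
theorem volumeProduct_eq {p : ℝ} (hp0 : 0 < p) (hp1 : p < 1)
    (f : EuclideanSpace ℝ (Fin n) → ℝ≥0∞) :
    volumeProduct p f = (∫⁻ x, f x) *
      (ENNReal.ofReal (p ^ n) * minTilted (p / (1 - p)) (laplaceRoot p f)) ^ (1 - p) := by
  have hp1' : p - 1 ≠ 0 := by linarith
  have hp2 : 0 < 1 - p := by linarith
  have hq : conjExp p = -(p / (1 - p)) := by
    unfold conjExp; rw [← div_neg]; congr 1; ring
  have hq0 : conjExp p ≠ 0 := by rw [hq]; apply neg_ne_zero.2; positivity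
  have hexp : -p / conjExp p = 1 - p := by
    unfold conjExp; field_simp; ring
  unfold volumeProduct
  rw [hexp]
  congr 1
  have h1 : ∀ z, ∫⁻ x, pLaplace p (translate z f) (p⁻¹ • x)
      = ENNReal.ofReal (p ^ n) * tilted (p / (1 - p)) (laplaceRoot p f) (conjExp p • z) := by
    intro z
    rw [lintegral_smul_eq (fun x => pLaplace p (translate z f) x) (inv_pos.2 hp0), inv_inv]
    congr 1
    refine lintegral_congr fun x => ?_
    have : pLaplace p (translate z f) x = laplaceRoot p (translate z f) x ^ conjExp p := rfl
    rw [this, laplaceRoot_translate, mul_rpow_of_left (ofReal_exp_ne_zero _) ENNReal.ofReal_ne_top,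
      ofReal_exp_rpow, mul_comm, hq, inner_smul_left, real_inner_comm]
    simp
  simp_rw [h1]
  have hsurj : Function.Surjective fun z : EuclideanSpace ℝ (Fin n) => conjExp p • z :=
    fun z => ⟨(conjExp p)⁻¹ • z, by simp [hq0]⟩
  rw [hsurj.iInf_comp fun z =>
    (ENNReal.ofReal (p ^ n) * tilted (p / (1 - p)) (laplaceRoot p f) z) ^ (1 - p)]
  have := (ENNReal.orderIsoRpow (1 - p) hp2).map_iInf
    fun z => ENNReal.ofReal (p ^ n) * tilted (p / (1 - p)) (laplaceRoot p f) z
  simp only [ENNReal.orderIsoRpow_apply] at this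
  rw [← this, ← ENNReal.mul_iInf_of_ne (by simp; positivity) ENNReal.ofReal_ne_top]
  rfl

/-! ### Order, measurability and monotone limits. -/

theorem laplaceRoot_mono {p : ℝ} (hp : 0 < p) {f g : EuclideanSpace ℝ (Fin n) → ℝ≥0∞}
    (h : ∀ x, f x ≤ g x) (x : EuclideanSpace ℝ (Fin n)) : laplaceRoot p f x ≤ laplaceRoot p g x :=
  lintegral_mono fun y => by
    dsimp only
    gcongr
    exact h y

theorem tilted_anti {Q : ℝ} (hQ : 0 < Q) {X Y : EuclideanSpace ℝ (Fin n) → ℝ≥0∞}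
    (h : ∀ x, X x ≤ Y x) (z : EuclideanSpace ℝ (Fin n)) : tilted Q Y z ≤ tilted Q X z :=
  lintegral_mono fun x => by
    dsimp only
    rw [ENNReal.rpow_neg, ENNReal.rpow_neg]
    gcongr
    exact h x

theorem measurable_laplaceRoot {p : ℝ} {f : EuclideanSpace ℝ (Fin n) → ℝ≥0∞} (hf : Measurable f) :
    Measurable (laplaceRoot p f) := by
  have : Measurable fun q : EuclideanSpace ℝ (Fin n) × EuclideanSpace ℝ (Fin n) =>
      f q.2 ^ (1 / p) * ENNReal.ofReal (Real.exp (inner ℝ q.1 q.2)) := by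
    refine ((hf.comp measurable_snd).pow_const _).mul ?_
    exact ENNReal.measurable_ofReal.comp (Real.measurable_exp.comp
      (measurable_fst.inner measurable_snd))
  exact this.lintegral_prod_right'

theorem measurable_tilt {Q : ℝ} {X : EuclideanSpace ℝ (Fin n) → ℝ≥0∞} (hX : Measurable X)
    (z : EuclideanSpace ℝ (Fin n)) :
    Measurable fun x => X x ^ (-Q) * ENNReal.ofReal (Real.exp (inner ℝ z x)) :=
  (hX.pow_const _).mul (ENNReal.measurable_ofReal.comp (Real.measurable_exp.comp
      (measurable_const.inner measurable_id)))

theorem laplaceRoot_iSup {p : ℝ} (hp : 0 < p) {f : ℕ → EuclideanSpace ℝ (Fin n) → ℝ≥0∞}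
    (hf : ∀ k, Measurable (f k)) (hmono : Monotone f) (x : EuclideanSpace ℝ (Fin n)) :
    laplaceRoot p (fun y => ⨆ k, f k y) x = ⨆ k, laplaceRoot p (f k) x := by
  unfold laplaceRoot laplace
  rw [← lintegral_iSup]
  · refine lintegral_congr fun y => ?_
    have := (ENNReal.orderIsoRpow (1 / p) (by positivity)).map_iSup fun k => f k y
    simp only [ENNReal.orderIsoRpow_apply] at this
    dsimp only
    rw [this, ENNReal.iSup_mul]
  · intro k
    exact ((hf k).pow_const _).mul (ENNReal.measurable_ofReal.comp (Real.measurable_exp.comp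
      (measurable_const.inner measurable_id)))
  · intro k l hkl y
    dsimp only
    gcongr
    exact hmono hkl y

/-- The negative power makes the integrands decrease, so monotone convergence needs a finite
integral at the first index. -/
theorem tilted_iSup {Q : ℝ} (hQ : 0 < Q) {X : ℕ → EuclideanSpace ℝ (Fin n) → ℝ≥0∞}
    (hX : ∀ k, Measurable (X k)) (hmono : Monotone X) (z : EuclideanSpace ℝ (Fin n))
    (hfin : tilted Q (X 0) z ≠ ⊤) :
    tilted Q (fun x => ⨆ k, X k x) z = ⨅ k, tilted Q (X k) z := by
  unfold tilted
  rw [← lintegral_iInf (fun k => measurable_tilt (hX k) z) _ hfin]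
  · refine lintegral_congr fun y => ?_
    have := (ENNReal.orderIsoRpow Q hQ).map_iSup fun k => X k y
    simp only [ENNReal.orderIsoRpow_apply] at this
    rw [ENNReal.rpow_neg, this, ENNReal.inv_iSup,
      ENNReal.iInf_mul_of_ne (ofReal_exp_ne_zero _) ENNReal.ofReal_ne_top]
    simp_rw [ENNReal.rpow_neg]
  · intro k l hkl y
    dsimp only
    rw [ENNReal.rpow_neg, ENNReal.rpow_neg]
    gcongr
    exact hmono hkl y

theorem tilted_laplaceRoot_iSup {p Q : ℝ} (hp : 0 < p) (hQ : 0 < Q)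
    {f : ℕ → EuclideanSpace ℝ (Fin n) → ℝ≥0∞}
    (hf : ∀ k, Measurable (f k)) (hmono : Monotone f) (z : EuclideanSpace ℝ (Fin n))
    (hfin : tilted Q (laplaceRoot p (f 0)) z ≠ ⊤) :
    tilted Q (laplaceRoot p (fun y => ⨆ k, f k y)) z = ⨅ k, tilted Q (laplaceRoot p (f k)) z := by
  have := tilted_iSup hQ (fun k => measurable_laplaceRoot (p := p) (hf k))
    (fun k l hkl => laplaceRoot_mono hp (hmono hkl)) z hfin
  rw [← this]
  congr 1
  ext x
  exact laplaceRoot_iSup hp hf hmono x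

/-! ### Coercivity and existence of minimizing tilts. -/

/-- Coercivity of `tilted`. -/
theorem le_tilted_of_le_on_ball {Q : ℝ} (hQ : 0 < Q) {X : EuclideanSpace ℝ (Fin n) → ℝ≥0∞} {C : ℝ≥0∞}
    (hX : ∀ x, ‖x‖ ≤ 1 → X x ≤ C) (z : EuclideanSpace ℝ (Fin n)) :
    C ^ (-Q) * (ENNReal.ofReal (Real.exp (‖z‖ / 4)) *
      volume (Metric.closedBall (0 : EuclideanSpace ℝ (Fin n)) (1 / 4))) ≤ tilted Q X z := by
  -- The ball of radius `1 / 4` about `w` lies in the unit ball, and `z·x ≥ ‖z‖ / 4` there. For `z =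
  -- 0` the inverse is 0 and `w = 0`, which also works.
  set w : EuclideanSpace ℝ (Fin n) := (2 * ‖z‖)⁻¹ • z with hw
  have hwn : ‖w‖ ≤ 1 / 2 := by
    rw [hw, norm_smul, norm_inv, norm_mul, norm_norm, Real.norm_two]
    rcases eq_or_ne ‖z‖ 0 with h | h
    · simp [h]
    · field_simp; norm_num
  have hzw : inner ℝ z w = ‖z‖ / 2 := by
    rw [hw, inner_smul_right, real_inner_self_eq_norm_sq]
    rcases eq_or_ne ‖z‖ 0 with h | h
    · simp [h]
    · field_simp
  have e : volume (Metric.closedBall (0 : EuclideanSpace ℝ (Fin n)) (1 / 4))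
      = volume (Metric.closedBall w (1 / 4)) :=
    (Measure.addHaar_closedBall_center _ w _).symm
  rw [e, ← mul_assoc, ← setLIntegral_const]
  refine le_trans ?_ (setLIntegral_le_lintegral (Metric.closedBall w (1 / 4)) _)
  refine setLIntegral_mono' measurableSet_closedBall fun x hx => ?_
  have hxw : ‖x - w‖ ≤ 1 / 4 := by simpa [dist_eq_norm] using hx
  have hx1 : ‖x‖ ≤ 1 := by
    calc ‖x‖ = ‖(x - w) + w‖ := by simp
      _ ≤ _ := (norm_add_le _ _).trans (by linarith)
  have hzx : ‖z‖ / 4 ≤ inner ℝ z x := by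
    have h1 : inner ℝ z x = inner ℝ z w + inner ℝ z (x - w) := by
      rw [← inner_add_right]; simp
    have h2 := abs_le.1 (abs_real_inner_le_norm z (x - w))
    have h3 : ‖z‖ * ‖x - w‖ ≤ ‖z‖ * (1 / 4) := by gcongr
    rw [h1, hzw]; linarith [h2.1]
  rw [ENNReal.rpow_neg, ENNReal.rpow_neg]
  gcongr
  exact hX x hx1

/-- The direct method: the uniform bound on the unit ball makes the tilts `z m` eventually bounded
by coercivity, a subsequence converges, and Fatou passes to the limit. An upper bound on the limsup
of `X m` suffices because `-Q` is negative. It gives existence of minimizers, semicontinuity in the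
variance, and the passage to time zero. -/
theorem exists_tilted_le_of_tendsto {Q : ℝ} (hQ : 0 < Q) {X : ℕ → EuclideanSpace ℝ (Fin n) → ℝ≥0∞}
    {Y : EuclideanSpace ℝ (Fin n) → ℝ≥0∞} (hX : ∀ m, Measurable (X m))
    (hlim : ∀ x, limsup (fun m => X m x) atTop ≤ Y x) {C : ℝ≥0∞} (hC : C ≠ ⊤)
    (hbd : ∀ m x, ‖x‖ ≤ 1 → X m x ≤ C) {z : ℕ → EuclideanSpace ℝ (Fin n)} {c : ℕ → ℝ≥0∞} {c' : ℝ≥0∞}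
    (hc' : c' ≠ ⊤) (hc : Tendsto c atTop (𝓝 c')) (hz : ∀ m, tilted Q (X m) (z m) ≤ c m) :
    ∃ w, tilted Q Y w ≤ c' := by
  have hvol : volume (Metric.closedBall (0 : EuclideanSpace ℝ (Fin n)) (1 / 4)) ≠ 0 :=
    (Metric.measure_closedBall_pos _ _ (by norm_num)).ne'
  set V := volume (Metric.closedBall (0 : EuclideanSpace ℝ (Fin n)) (1 / 4)) with hV
  have hCQ : C ^ (-Q) ≠ 0 := by
    rw [ENNReal.rpow_neg]; apply ENNReal.inv_ne_zero.2
    exact ENNReal.rpow_ne_top_of_nonneg hQ.le hC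
  have hbdd : ∃ ρ : ℝ, ∀ᶠ m in atTop, ‖z m‖ ≤ ρ := by
    have h1 : ∀ᶠ m in atTop, c m < c' + 1 := by
      refine hc.eventually (gt_mem_nhds (ENNReal.lt_add_right hc' one_ne_zero))
    set ρ' := ((c' + 1) / (C ^ (-Q) * V)).toReal with hρ'
    have hfin : (c' + 1) / (C ^ (-Q) * V) ≠ ⊤ :=
      ENNReal.div_ne_top (by simp [hc']) (mul_ne_zero hCQ hvol)
    refine ⟨4 * ρ', ?_⟩
    filter_upwards [h1] with m hm
    have h2 := (le_tilted_of_le_on_ball hQ (hbd m) (z m)).trans ((hz m).trans hm.le)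
    rw [mul_left_comm] at h2
    have h3 : ENNReal.ofReal (Real.exp (‖z m‖ / 4)) ≤ (c' + 1) / (C ^ (-Q) * V) := by
      refine (ENNReal.le_div_iff_mul_le (Or.inl (mul_ne_zero hCQ hvol)) (Or.inr ?_)).2 h2
      simp [hc']
    have h4 := (ENNReal.ofReal_le_iff_le_toReal hfin).1 h3
    have := Real.add_one_le_exp (‖z m‖ / 4)
    rw [← hρ'] at h4
    linarith
  obtain ⟨ρ, hρ⟩ := hbdd
  obtain ⟨w, -, φ, hφ, hw⟩ := tendsto_subseq_of_frequently_bounded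
    (Metric.isBounded_closedBall (x := (0 : EuclideanSpace ℝ (Fin n))) (r := ρ))
    (x := z) (hρ.mono fun m hm => by simpa using hm).frequently
  refine ⟨w, ?_⟩
  have hF := lintegral_liminf_le (μ := (volume : Measure (EuclideanSpace ℝ (Fin n)))) (u := atTop)
    (fun m => measurable_tilt (Q := Q) (hX (φ m)) (z (φ m)))
  have hR : liminf (fun m => tilted Q (X (φ m)) (z (φ m))) atTop ≤ c' := by
    refine (liminf_le_liminf (Eventually.of_forall fun m => hz (φ m))).trans ?_
    exact (hc.comp hφ.tendsto_atTop).liminf_eq.le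
  refine le_trans (lintegral_mono fun x => ?_) (hF.trans hR)
  have hanti : Antitone fun a : ℝ≥0∞ => a ^ (-Q) := by
    intro a b hab
    dsimp only
    rw [ENNReal.rpow_neg, ENNReal.rpow_neg]; gcongr
  have e1 : Y x ^ (-Q) ≤ liminf (fun m => X (φ m) x ^ (-Q)) atTop := by
    have h1 : limsup (fun m => X (φ m) x) atTop ≤ Y x := by
      refine le_trans ?_ (hlim x)
      exact limsup_le_limsup_of_le (f := map φ atTop) (u := fun m => X m x) hφ.tendsto_atTop
    refine (hanti h1).trans ?_
    have := hanti.map_limsup_of_continuousAt (F := atTop) (fun m => X (φ m) x)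
      ENNReal.continuous_rpow_const.continuousAt
    exact this.le
  have e2 : liminf (fun m => ENNReal.ofReal (Real.exp (inner ℝ (z (φ m)) x))) atTop
      = ENNReal.ofReal (Real.exp (inner ℝ w x)) := by
    apply Tendsto.liminf_eq
    refine ENNReal.tendsto_ofReal ((Real.continuous_exp.tendsto _).comp ?_)
    exact hw.inner tendsto_const_nhds
  calc Y x ^ (-Q) * ENNReal.ofReal (Real.exp (inner ℝ w x))
      ≤ liminf (fun m => X (φ m) x ^ (-Q)) atTop *
        liminf (fun m => ENNReal.ofReal (Real.exp (inner ℝ (z (φ m)) x))) atTop := by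
        rw [e2]; gcongr
    _ ≤ _ := ENNReal.le_liminf_mul

theorem exists_tilted_eq_minTilted {Q : ℝ} (hQ : 0 < Q) {X : EuclideanSpace ℝ (Fin n) → ℝ≥0∞}
    (hX : Measurable X) {C : ℝ≥0∞} (hC : C ≠ ⊤) (hbd : ∀ x, ‖x‖ ≤ 1 → X x ≤ C)
    (hfin : minTilted Q X ≠ ⊤) : ∃ z, tilted Q X z = minTilted Q X := by
  have hex : ∀ m : ℕ, ∃ z, tilted Q X z ≤ minTilted Q X + (m + 1 : ℝ≥0∞)⁻¹ := by
    intro m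
    have : minTilted Q X < minTilted Q X + (m + 1 : ℝ≥0∞)⁻¹ :=
      ENNReal.lt_add_right hfin (by simp [ENNReal.inv_eq_zero])
    obtain ⟨z, hz⟩ := iInf_lt_iff.1 this
    exact ⟨z, hz.le⟩
  choose z hz using hex
  have hlim : Tendsto (fun m : ℕ => minTilted Q X + (m + 1 : ℝ≥0∞)⁻¹) atTop
      (𝓝 (minTilted Q X)) := by
    have h1 : Tendsto (fun m : ℕ => ((m : ℝ≥0∞) + 1)⁻¹) atTop (𝓝 0) := by
      have := (tendsto_add_atTop_iff_nat 1).2 ENNReal.tendsto_inv_nat_nhds_zero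
      simpa using this
    simpa using tendsto_const_nhds.add h1
  obtain ⟨w, hw⟩ := exists_tilted_le_of_tendsto hQ (X := fun _ => X) (Y := X) (fun _ => hX)
    (fun x => by simp) hC (fun _ => hbd) hfin hlim hz
  exact ⟨w, le_antisymm hw (iInf_le _ _)⟩

/-! ### Gaussian growth and finiteness of tilted integrals. -/

theorem lintegral_exp_neg_sq_add_lt_top {c : ℝ} (hc : 0 < c) (K : ℝ) :
    ∫⁻ x : EuclideanSpace ℝ (Fin n), ENNReal.ofReal (Real.exp (-c * ‖x‖ ^ 2 + K * ‖x‖)) < ⊤ := by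
  have hint : Integrable fun x : EuclideanSpace ℝ (Fin n) =>
      Real.exp (K ^ 2 / (2 * c)) * Real.exp (-(c / 2) * ‖x‖ ^ 2) := by
    have := (GaussianFourier.integrable_cexp_neg_mul_sq_norm_add (V := EuclideanSpace ℝ (Fin n))
      (b := ((c / 2 : ℝ) : ℂ)) (by rw [Complex.ofReal_re]; positivity) 0 0).norm
    refine (this.congr (Eventually.of_forall fun x => ?_)).const_mul _
    simp only [zero_mul, add_zero, Complex.norm_exp]
    congr 1
    have : (-((c / 2 : ℝ) : ℂ) * (‖x‖ : ℂ) ^ 2) = ((-(c / 2) * ‖x‖ ^ 2 : ℝ) : ℂ) := by push_cast; ring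
    rw [this, Complex.ofReal_re]
  refine lt_of_le_of_lt (lintegral_mono fun x => ?_) hint.lintegral_lt_top
  refine ENNReal.ofReal_le_ofReal ?_
  rw [← Real.exp_add]
  apply Real.exp_le_exp.2
  have : K * ‖x‖ ≤ K ^ 2 / (2 * c) + c / 2 * ‖x‖ ^ 2 := by
    have h := sq_nonneg (K - c * ‖x‖)
    have : K * ‖x‖ = (2 * c * (K * ‖x‖)) / (2 * c) := by field_simp
    rw [this, ← sub_nonneg]
    have e : K ^ 2 / (2 * c) + c / 2 * ‖x‖ ^ 2 - 2 * c * (K * ‖x‖) / (2 * c)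
      = (K - c * ‖x‖) ^ 2 / (2 * c) := by field_simp; ring
    rw [e]; positivity
  linarith

/-- Integrate only over the unit ball about `x / (4C)`: there `x·y` exceeds `C‖y‖²` by a multiple of
`‖x‖²`, with room to absorb the errors linear in `‖x‖`. -/
theorem exists_le_laplace {F : EuclideanSpace ℝ (Fin n) → ℝ≥0∞} {c C : ℝ} (hc : 0 < c) (hC : 0 < C)
    (hF : ∀ y, ENNReal.ofReal (c * Real.exp (-C * ‖y‖ ^ 2)) ≤ F y) (x : EuclideanSpace ℝ (Fin n)) :
    ENNReal.ofReal (c * Real.exp (-6 * C) *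
      (volume (Metric.closedBall (0 : EuclideanSpace ℝ (Fin n)) 1)).toReal *
        Real.exp (1 / (16 * C) * ‖x‖ ^ 2)) ≤ laplace F x := by
  set w := (1 / (4 * C)) • x with hw
  have e : volume (Metric.closedBall (0 : EuclideanSpace ℝ (Fin n)) 1)
      = volume (Metric.closedBall w 1) := (Measure.addHaar_closedBall_center _ w _).symm
  have hfin : volume (Metric.closedBall w 1) ≠ ⊤ := measure_closedBall_lt_top.ne
  rw [e, mul_right_comm, ENNReal.ofReal_mul (by positivity), ENNReal.ofReal_toReal hfin,
    ← setLIntegral_const]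
  refine le_trans ?_ (setLIntegral_le_lintegral (Metric.closedBall w 1) _)
  refine setLIntegral_mono' measurableSet_closedBall fun y hy => ?_
  refine le_trans ?_ (mul_le_mul_left (hF y) _)
  rw [← ENNReal.ofReal_mul (by positivity), mul_assoc, mul_assoc, ← Real.exp_add, ← Real.exp_add]
  refine ENNReal.ofReal_le_ofReal ?_
  refine mul_le_mul_of_nonneg_left (Real.exp_le_exp.2 ?_) hc.le
  have hyw : ‖y - w‖ ≤ 1 := by simpa [dist_eq_norm] using hy
  have hwx : ‖w‖ = 1 / (4 * C) * ‖x‖ := by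
    rw [hw, norm_smul, Real.norm_of_nonneg (by positivity)]
  have hxw : inner ℝ x w = 1 / (4 * C) * ‖x‖ ^ 2 := by
    rw [hw, inner_smul_right, real_inner_self_eq_norm_sq]
  have h1 : 1 / (4 * C) * ‖x‖ ^ 2 - ‖x‖ ≤ inner ℝ x y := by
    have h1 : inner ℝ x y = inner ℝ x w + inner ℝ x (y - w) := by
      rw [← inner_add_right]; simp
    have h2 := abs_le.1 (abs_real_inner_le_norm x (y - w))
    have h3 : ‖x‖ * ‖y - w‖ ≤ ‖x‖ * 1 := by gcongr
    rw [h1, hxw]; linarith [h2.1]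
  have h2 : ‖y‖ ^ 2 ≤ 2 * (1 / (4 * C) * ‖x‖) ^ 2 + 2 := by
    have h3 : ‖y‖ ≤ 1 / (4 * C) * ‖x‖ + 1 := by
      calc ‖y‖ = ‖(y - w) + w‖ := by simp
        _ ≤ _ := (norm_add_le _ _).trans (by linarith)
    have h4 : ‖y‖ ^ 2 ≤ (1 / (4 * C) * ‖x‖ + 1) ^ 2 := pow_le_pow_left₀ (norm_nonneg _) h3 2
    nlinarith [sq_nonneg (1 / (4 * C) * ‖x‖ - 1)]
  have h5 : ‖x‖ ≤ 1 / (16 * C) * ‖x‖ ^ 2 + 4 * C := by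
    have : 1 / (16 * C) * ‖x‖ ^ 2 + 4 * C - ‖x‖ = (‖x‖ - 8 * C) ^ 2 / (16 * C) := by
      field_simp; ring
    have h6 : 0 ≤ (‖x‖ - 8 * C) ^ 2 / (16 * C) := by positivity
    linarith
  have h7 : C * ‖y‖ ^ 2 ≤ C * (2 * (1 / (4 * C) * ‖x‖) ^ 2 + 2) := by gcongr
  have h8 : C * (2 * (1 / (4 * C) * ‖x‖) ^ 2 + 2) = 2 * (1 / (16 * C) * ‖x‖ ^ 2) + 2 * C := by
    field_simp; ring
  have h9 : 1 / (4 * C) * ‖x‖ ^ 2 = 4 * (1 / (16 * C) * ‖x‖ ^ 2) := by field_simp; ring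
  linarith

theorem rpow_neg_le_of_le {Q : ℝ} (hQ : 0 < Q) {X : ℝ≥0∞} {a r : ℝ} (ha : 0 < a)
    (hX : ENNReal.ofReal (a * Real.exp r) ≤ X) :
    X ^ (-Q) ≤ ENNReal.ofReal (a ^ (-Q) * Real.exp (-Q * r)) := by
  have h1 : X ^ (-Q) ≤ ENNReal.ofReal (a * Real.exp r) ^ (-Q) := by
    rw [ENNReal.rpow_neg, ENNReal.rpow_neg]; gcongr
  refine h1.trans (le_of_eq ?_)
  rw [ENNReal.ofReal_rpow_of_pos (by positivity), Real.mul_rpow ha.le (Real.exp_pos _).le,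
    ← Real.exp_mul, mul_comm r]

theorem tilted_lt_top {Q : ℝ} (hQ : 0 < Q) {X : EuclideanSpace ℝ (Fin n) → ℝ≥0∞} {a b : ℝ}
    (ha : 0 < a) (hb : 0 < b) (hX : ∀ x, ENNReal.ofReal (a * Real.exp (b * ‖x‖ ^ 2)) ≤ X x)
    (z : EuclideanSpace ℝ (Fin n)) : tilted Q X z < ⊤ := by
  have h1 : tilted Q X z ≤ ∫⁻ x : EuclideanSpace ℝ (Fin n), ENNReal.ofReal (a ^ (-Q)) *
      ENNReal.ofReal (Real.exp (-(Q * b) * ‖x‖ ^ 2 + ‖z‖ * ‖x‖)) := by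
    refine lintegral_mono fun x => ?_
    refine (mul_le_mul_left (rpow_neg_le_of_le hQ ha (hX x)) _).trans ?_
    rw [ENNReal.ofReal_mul (by positivity), mul_assoc, ofReal_exp_mul_exp]
    gcongr ENNReal.ofReal _ * ENNReal.ofReal (Real.exp ?_)
    have := real_inner_le_norm z x
    linarith
  refine h1.trans_lt ?_
  rw [lintegral_const_mul' _ _ ENNReal.ofReal_ne_top]
  exact ENNReal.mul_lt_top ENNReal.ofReal_lt_top
    (lintegral_exp_neg_sq_add_lt_top (mul_pos hQ hb) _)

theorem exists_le_laplaceRoot {p : ℝ} (hp : 0 < p) {f : EuclideanSpace ℝ (Fin n) → ℝ≥0∞} {c C : ℝ}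
    (hc : 0 < c) (hC : 0 < C) (hf : ∀ y, ENNReal.ofReal (c * Real.exp (-C * ‖y‖ ^ 2)) ≤ f y) :
    ∃ a > 0, ∃ b > 0, ∀ x, ENNReal.ofReal (a * Real.exp (b * ‖x‖ ^ 2)) ≤ laplaceRoot p f x := by
  refine ⟨c ^ (1 / p) * Real.exp (-6 * (C / p)) *
      (volume (Metric.closedBall (0 : EuclideanSpace ℝ (Fin n)) 1)).toReal, ?_,
      1 / (16 * (C / p)), by positivity, ?_⟩
  · have : 0 < (volume (Metric.closedBall (0 : EuclideanSpace ℝ (Fin n)) 1)).toReal :=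
      ENNReal.toReal_pos (Metric.measure_closedBall_pos _ _ one_pos).ne' measure_closedBall_lt_top.ne
    positivity
  · intro x
    refine exists_le_laplace (by positivity) (by positivity) (fun y => ?_) x
    have h1 : ENNReal.ofReal (c * Real.exp (-C * ‖y‖ ^ 2)) ^ (1 / p) ≤ f y ^ (1 / p) := by
      gcongr; exact hf y
    refine le_trans (le_of_eq ?_) h1
    rw [ENNReal.ofReal_rpow_of_pos (by positivity), Real.mul_rpow hc.le (Real.exp_pos _).le,
      ← Real.exp_mul]
    congr 3
    ring

theorem tilted_laplaceRoot_lt_top {p Q : ℝ} (hp : 0 < p) (hQ : 0 < Q)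
    {f : EuclideanSpace ℝ (Fin n) → ℝ≥0∞} {c C : ℝ}
    (hc : 0 < c) (hC : 0 < C) (hf : ∀ y, ENNReal.ofReal (c * Real.exp (-C * ‖y‖ ^ 2)) ≤ f y)
    (z : EuclideanSpace ℝ (Fin n)) : tilted Q (laplaceRoot p f) z < ⊤ := by
  obtain ⟨a, ha, b, hb, h⟩ := exists_le_laplaceRoot hp hc hC hf
  exact tilted_lt_top hQ ha hb h z

/-! ### Gaussian smoothing of a compactly supported finite measure -/

/-- The Gaussian density with diagonal covariance `v`. -/
noncomputable def prodKer (v : Fin n → ℝ) (w : EuclideanSpace ℝ (Fin n)) : ℝ :=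
  ∏ i, gaussKer (v i) (w i)

/-- The convolution of the measure `m` with the Gaussian density of diagonal covariance `v`. -/
noncomputable def smooth (m : Measure (EuclideanSpace ℝ (Fin n))) (v : Fin n → ℝ)
    (y : EuclideanSpace ℝ (Fin n)) : ℝ :=
  ∫ u, prodKer v (y - u) ∂m

theorem prodKer_pos {v : Fin n → ℝ} (hv : ∀ i, 0 < v i) (w : EuclideanSpace ℝ (Fin n)) :
    0 < prodKer v w :=
  Finset.prod_pos fun i _ => gaussKer_pos (hv i) _

theorem continuous_gaussKer (t : ℝ) : Continuous (gaussKer t) := by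
  unfold gaussKer; fun_prop

theorem continuous_prodKer (v : Fin n → ℝ) : Continuous (prodKer v) := by
  unfold prodKer
  refine continuous_finsetProd _ fun i _ => (continuous_gaussKer _).comp ?_
  fun_prop

theorem gaussKer_le {lo hi t : ℝ} (hlo : 0 < lo) (h1 : lo ≤ t) (h2 : t ≤ hi) (w : ℝ) :
    gaussKer t w ≤ (Real.sqrt (2 * Real.pi * lo))⁻¹ * Real.exp (-w ^ 2 / (2 * hi)) := by
  unfold gaussKer
  rw [div_eq_inv_mul (Real.exp (-w ^ 2 / (2 * t)))]
  have ht : 0 < t := by linarith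
  gcongr ?_ * Real.exp ?_
  · gcongr
  · rw [neg_div, neg_div]; gcongr

theorem le_gaussKer {lo hi t : ℝ} (hlo : 0 < lo) (h1 : lo ≤ t) (h2 : t ≤ hi) (w : ℝ) :
    (Real.sqrt (2 * Real.pi * hi))⁻¹ * Real.exp (-w ^ 2 / (2 * lo)) ≤ gaussKer t w := by
  unfold gaussKer
  rw [div_eq_inv_mul (Real.exp (-w ^ 2 / (2 * t)))]
  have ht : 0 < t := by linarith
  gcongr ?_ * Real.exp ?_
  · gcongr
  · rw [neg_div, neg_div]; gcongr

theorem prod_exp_eq (c : ℝ) (w : EuclideanSpace ℝ (Fin n)) :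
    ∏ i, Real.exp (-(w i) ^ 2 / (2 * c)) = Real.exp (-‖w‖ ^ 2 / (2 * c)) := by
  rw [← Real.exp_sum, EuclideanSpace.real_norm_sq_eq, ← Finset.sum_div, Finset.sum_neg_distrib]

theorem prodKer_le {lo hi : ℝ} (hlo : 0 < lo) {v : Fin n → ℝ} (h1 : ∀ i, lo ≤ v i)
    (h2 : ∀ i, v i ≤ hi) (w : EuclideanSpace ℝ (Fin n)) :
    prodKer v w ≤ (Real.sqrt (2 * Real.pi * lo))⁻¹ ^ n * Real.exp (-‖w‖ ^ 2 / (2 * hi)) := by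
  rw [← prod_exp_eq]
  have := Finset.prod_le_prod (s := Finset.univ) (fun i _ => (gaussKer_pos (hlo.trans_le (h1 i)) (w i)).le)
    (fun i _ => gaussKer_le hlo (h1 i) (h2 i) (w i))
  rw [Finset.prod_mul_distrib, Finset.prod_const, Finset.card_univ, Fintype.card_fin] at this
  exact this

theorem le_prodKer {lo hi : ℝ} (hlo : 0 < lo) {v : Fin n → ℝ} (h1 : ∀ i, lo ≤ v i)
    (h2 : ∀ i, v i ≤ hi) (w : EuclideanSpace ℝ (Fin n)) :
    (Real.sqrt (2 * Real.pi * hi))⁻¹ ^ n * Real.exp (-‖w‖ ^ 2 / (2 * lo)) ≤ prodKer v w := by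
  rw [← prod_exp_eq]
  have := Finset.prod_le_prod (s := Finset.univ) (fun i _ => by positivity)
    (fun i _ => le_gaussKer hlo (h1 i) (h2 i) (w i))
  rw [Finset.prod_mul_distrib, Finset.prod_const, Finset.card_univ, Fintype.card_fin] at this
  exact this

theorem exists_bounds (v : Fin n → ℝ) (hv : ∀ i, 0 < v i) :
    ∃ lo > 0, ∃ hi > 0, (∀ i, lo ≤ v i) ∧ ∀ i, v i ≤ hi := by
  rcases isEmpty_or_nonempty (Fin n) with h | h
  · exact ⟨1, one_pos, 1, one_pos, fun i => h.elim i, fun i => h.elim i⟩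
  · obtain ⟨i, hi⟩ := Finite.exists_min v
    obtain ⟨j, hj⟩ := Finite.exists_max v
    exact ⟨v i, hv i, v j, hv j, hi, hj⟩

theorem prodKer_le_const {lo : ℝ} (hlo : 0 < lo) {v : Fin n → ℝ} (h1 : ∀ i, lo ≤ v i)
    (w : EuclideanSpace ℝ (Fin n)) :
    prodKer v w ≤ (Real.sqrt (2 * Real.pi * lo))⁻¹ ^ n := by
  have hpos : ∀ i, 0 < v i := fun i => hlo.trans_le (h1 i)
  obtain ⟨-, -, hi, hhi, -, h2⟩ := exists_bounds v hpos
  refine (prodKer_le hlo h1 h2 w).trans ?_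
  refine mul_le_of_le_one_right (by positivity) (Real.exp_le_one_iff.2 ?_)
  rw [neg_div]; apply neg_nonpos.2; positivity

section

variable {m : Measure (EuclideanSpace ℝ (Fin n))} [IsFiniteMeasure m]

theorem integrable_prodKer {v : Fin n → ℝ} (hv : ∀ i, 0 < v i) (y : EuclideanSpace ℝ (Fin n)) :
    Integrable (fun u => prodKer v (y - u)) m := by
  obtain ⟨lo, hlo, hi, hhi, h1, h2⟩ := exists_bounds v hv
  refine Integrable.of_bound ?_ ((Real.sqrt (2 * Real.pi * lo))⁻¹ ^ n) (Eventually.of_forall fun u => ?_)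
  · exact ((continuous_prodKer v).comp (continuous_const.sub continuous_id)).aestronglyMeasurable
  · rw [Real.norm_of_nonneg (prodKer_pos hv _).le]
    exact prodKer_le_const hlo h1 _

theorem continuous_smooth {v : Fin n → ℝ} (hv : ∀ i, 0 < v i) : Continuous (smooth m v) := by
  obtain ⟨lo, hlo, hi, hhi, h1, h2⟩ := exists_bounds v hv
  refine continuous_of_dominated (bound := fun _ => (Real.sqrt (2 * Real.pi * lo))⁻¹ ^ n)
    (fun y => (integrable_prodKer hv y).aestronglyMeasurable) (fun y => Eventually.of_forall fun u => ?_)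
    (integrable_const _) (Eventually.of_forall fun u => ?_)
  · rw [Real.norm_of_nonneg (prodKer_pos hv _).le]
    exact prodKer_le_const hlo h1 _
  · exact (continuous_prodKer v).comp (continuous_id.sub continuous_const)

theorem continuousAt_gaussKer_left {t : ℝ} (ht : 0 < t) (w : ℝ) :
    ContinuousAt (fun t => gaussKer t w) t := by
  unfold gaussKer
  have h1 : (2 * t) ≠ 0 := by positivity
  have h2 : Real.sqrt (2 * Real.pi * t) ≠ 0 := by positivity
  refine ContinuousAt.div ?_ ?_ h2
  · refine Real.continuous_exp.continuousAt.comp ?_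
    exact ContinuousAt.div continuousAt_const (by fun_prop) h1
  · fun_prop

theorem tendsto_smooth {ι : Type*} {l : Filter ι} [l.IsCountablyGenerated] [l.NeBot]
    {v : ι → Fin n → ℝ} {v' : Fin n → ℝ} {lo : ℝ} (hlo : 0 < lo)
    (h1 : ∀ᶠ k in l, ∀ i, lo ≤ v k i) (hlim : Tendsto v l (𝓝 v')) (y : EuclideanSpace ℝ (Fin n)) :
    Tendsto (fun k => smooth m (v k) y) l (𝓝 (smooth m v' y)) := by
  have h1' : ∀ i, lo ≤ v' i := fun i =>
    ge_of_tendsto (tendsto_pi_nhds.1 hlim i) (h1.mono fun k h => h i)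
  refine tendsto_integral_filter_of_dominated_convergence
    (fun _ => (Real.sqrt (2 * Real.pi * lo))⁻¹ ^ n) ?_ ?_ (integrable_const _)
    (Eventually.of_forall fun u => ?_)
  · filter_upwards [h1] with k hk
    exact (integrable_prodKer (fun i => hlo.trans_le (hk i)) y).aestronglyMeasurable
  · filter_upwards [h1] with k hk
    refine Eventually.of_forall fun u => ?_
    rw [Real.norm_of_nonneg (prodKer_pos (fun i => hlo.trans_le (hk i)) _).le]
    exact prodKer_le_const hlo hk _
  · refine tendsto_finsetProd _ fun i _ => ?_
    exact (continuousAt_gaussKer_left (hlo.trans_le (h1' i)) ((y - u) i)).tendsto.comp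
      (tendsto_pi_nhds.1 hlim i)

theorem smooth_pos [NeZero m] {v : Fin n → ℝ} (hv : ∀ i, 0 < v i) (y : EuclideanSpace ℝ (Fin n)) :
    0 < smooth m v y := by
  refine (integral_pos_iff_support_of_nonneg (fun u => (prodKer_pos hv _).le)
    (integrable_prodKer hv y)).2 ?_
  have : (Function.support fun u => prodKer v (y - u)) = Set.univ := by
    ext u; simp [(prodKer_pos hv (y - u)).ne']
  rw [this]
  exact pos_iff_ne_zero.2 (Measure.measure_univ_ne_zero.2 (NeZero.ne m))

theorem exists_smooth_le {R lo hi : ℝ} (hm : ∀ᵐ u ∂m, ‖u‖ ≤ R) (hlo : 0 < lo) (hhi : 0 < hi) :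
    ∃ C ≥ 0, ∃ c > 0, ∀ v : Fin n → ℝ, (∀ i, lo ≤ v i) → (∀ i, v i ≤ hi) → ∀ y,
      smooth m v y ≤ C * Real.exp (-c * ‖y‖ ^ 2) := by
  refine ⟨(m Set.univ).toReal * ((Real.sqrt (2 * Real.pi * lo))⁻¹ ^ n * Real.exp (R ^ 2 / (2 * hi))),
    by positivity, 1 / (4 * hi), by positivity, fun v h1 h2 y => ?_⟩
  have hv : ∀ i, 0 < v i := fun i => hlo.trans_le (h1 i)
  have h3 : smooth m v y ≤ ∫ _, (Real.sqrt (2 * Real.pi * lo))⁻¹ ^ n *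
      (Real.exp (R ^ 2 / (2 * hi)) * Real.exp (-(1 / (4 * hi)) * ‖y‖ ^ 2)) ∂m := by
    refine integral_mono_ae (integrable_prodKer hv y) (integrable_const _) ?_
    filter_upwards [hm] with u hu
    refine (prodKer_le hlo h1 h2 _).trans ?_
    rw [← Real.exp_add]
    gcongr
    have h4 : ‖y‖ ^ 2 ≤ 2 * ‖y - u‖ ^ 2 + 2 * R ^ 2 := by
      have h5 : ‖y‖ ≤ ‖y - u‖ + R := by
        calc ‖y‖ = ‖(y - u) + u‖ := by simp
          _ ≤ _ := (norm_add_le _ _).trans (by linarith)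
      have h6 := pow_le_pow_left₀ (norm_nonneg _) h5 2
      nlinarith [sq_nonneg (‖y - u‖ - R)]
    rw [div_add' _ _ _ (by positivity), div_le_div_iff_of_pos_right (by positivity)]
    field_simp
    linarith
  refine h3.trans (le_of_eq ?_)
  rw [integral_const, smul_eq_mul, Measure.real]
  ring

theorem exists_le_smooth [NeZero m] {R lo hi : ℝ} (hm : ∀ᵐ u ∂m, ‖u‖ ≤ R) (hlo : 0 < lo)
    (hhi : 0 < hi) :
    ∃ c > 0, ∃ C > 0, ∀ v : Fin n → ℝ, (∀ i, lo ≤ v i) → (∀ i, v i ≤ hi) → ∀ y,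
      c * Real.exp (-C * ‖y‖ ^ 2) ≤ smooth m v y := by
  have hm0 : 0 < (m Set.univ).toReal :=
    ENNReal.toReal_pos (Measure.measure_univ_ne_zero.2 (NeZero.ne m)) (measure_ne_top _ _)
  refine ⟨(m Set.univ).toReal * ((Real.sqrt (2 * Real.pi * hi))⁻¹ ^ n * Real.exp (-R ^ 2 / lo)),
    by positivity, 1 / lo, by positivity, fun v h1 h2 y => ?_⟩
  have hv : ∀ i, 0 < v i := fun i => hlo.trans_le (h1 i)
  have h3 : ∫ _, (Real.sqrt (2 * Real.pi * hi))⁻¹ ^ n *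
      (Real.exp (-R ^ 2 / lo) * Real.exp (-(1 / lo) * ‖y‖ ^ 2)) ∂m ≤ smooth m v y := by
    refine integral_mono_ae (integrable_const _) (integrable_prodKer hv y) ?_
    filter_upwards [hm] with u hu
    refine le_trans ?_ (le_prodKer hlo h1 h2 _)
    rw [← Real.exp_add]
    gcongr
    have h4 : ‖y - u‖ ^ 2 ≤ 2 * ‖y‖ ^ 2 + 2 * R ^ 2 := by
      have h5 : ‖y - u‖ ≤ ‖y‖ + R := (norm_sub_le _ _).trans (by linarith)
      have h6 := pow_le_pow_left₀ (norm_nonneg _) h5 2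
      nlinarith [sq_nonneg (‖y‖ - R)]
    have e : -R ^ 2 / lo + -(1 / lo) * ‖y‖ ^ 2 = -(2 * ‖y‖ ^ 2 + 2 * R ^ 2) / (2 * lo) := by
      field_simp; ring
    rw [e, neg_div, neg_div]
    gcongr
  refine le_trans (le_of_eq ?_) h3
  rw [integral_const, smul_eq_mul, Measure.real]
  ring

end

/-! ### One step of the flow in a single variance -/

theorem prodKer_update_add_single (v : Fin n → ℝ) (i : Fin n) (t c : ℝ)
    (w : EuclideanSpace ℝ (Fin n)) :
    prodKer (Function.update v i t) (w + EuclideanSpace.single i c)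
      = gaussKer t (w i + c) * ∏ j ∈ Finset.univ.erase i, gaussKer (v j) (w j) := by
  unfold prodKer
  rw [← Finset.mul_prod_erase _ _ (Finset.mem_univ i)]
  congr 1
  · simp
  · refine Finset.prod_congr rfl fun j hj => ?_
    have : j ≠ i := (Finset.mem_erase.1 hj).1
    simp [this]

theorem prodKer_eq_mul (v : Fin n → ℝ) (i : Fin n) (w : EuclideanSpace ℝ (Fin n)) :
    prodKer v w = gaussKer (v i) (w i) * ∏ j ∈ Finset.univ.erase i, gaussKer (v j) (w j) := by
  unfold prodKer
  rw [← Finset.mul_prod_erase _ _ (Finset.mem_univ i)]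

theorem prodKer_update_div {v : Fin n → ℝ} (hv : ∀ i, 0 < v i) (i : Fin n) (t c : ℝ)
    (w : EuclideanSpace ℝ (Fin n)) :
    prodKer (Function.update v i t) (w + EuclideanSpace.single i c)
      = prodKer v w * (gaussKer t (w i + c) / gaussKer (v i) (w i)) := by
  rw [prodKer_update_add_single, prodKer_eq_mul v i]
  have := (gaussKer_pos (hv i) (w i)).ne'
  field_simp

theorem gaussKer_mul_exp {t : ℝ} (ht : 0 < t) (w K : ℝ) :
    gaussKer t w * Real.exp (K * w) = gaussKer t (w - K * t) * Real.exp (K ^ 2 * t / 2) := by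
  unfold gaussKer
  rw [div_mul_eq_mul_div, div_mul_eq_mul_div, ← Real.exp_add, ← Real.exp_add]
  congr 2
  field_simp
  ring

theorem update_pos {v : Fin n → ℝ} (hv : ∀ i, 0 < v i) (i : Fin n) {t : ℝ} (ht : 0 < t) (j : Fin n) :
    0 < Function.update v i t j := by
  rcases eq_or_ne j i with rfl | h
  · simpa
  · simpa [h] using hv j

variable {m : Measure (EuclideanSpace ℝ (Fin n))} [IsFiniteMeasure m]

theorem abs_integral_prodKer_mul_le {v : Fin n → ℝ} (hv : ∀ i, 0 < v i)
    (y : EuclideanSpace ℝ (Fin n)) {g : EuclideanSpace ℝ (Fin n) → ℝ} {c : ℝ}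
    (hg : ∀ᵐ u ∂m, |g u| ≤ c) : |∫ u, prodKer v (y - u) * g u ∂m| ≤ smooth m v y * c := by
  unfold smooth
  rw [← integral_mul_const, ← Real.norm_eq_abs]
  refine norm_integral_le_of_norm_le ((integrable_prodKer hv y).mul_const c) ?_
  filter_upwards [hg] with u hu
  rw [norm_mul, Real.norm_of_nonneg (prodKer_pos hv _).le]
  exact mul_le_mul_of_nonneg_left hu (prodKer_pos hv _).le

/-- The expansion of a single Gaussian is averaged over `u` with the probability weights `prodKer v
(y - u) dm(u) / smooth m v y`; `A` and `B` are the averages of its first and second order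
coefficients and do not depend on `j`. The bounded support of `m` makes the pointwise error uniform
in `u`. -/
theorem smooth_update_expansion [NeZero m] {R : ℝ} (hR : ∀ᵐ u ∂m, ‖u‖ ≤ R) {v : Fin n → ℝ}
    (hv : ∀ i, 0 < v i) (i : Fin n) (y : EuclideanSpace ℝ (Fin n)) {ε η : ℝ} (hε : 0 < ε)
    (hεT : ε ^ 2 ≤ v i / 2)
    (hη0 : 0 ≤ η) (hη : 42 * η ≤ 1) (hη1 : ε * (R + |y i|) / v i ≤ η) (hη2 : ε ^ 2 / v i ≤ η ^ 2) :
    ∃ A B : ℝ, |A| ≤ η ∧ |B| ≤ 2 * η ^ 2 ∧ ∀ j : ℝ, |j| ≤ 2 →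
      |smooth m (Function.update v i (v i - ε ^ 2)) (y + EuclideanSpace.single i (j * ε)) /
        smooth m v y - (1 + j * A + (j ^ 2 - 1) / 2 * B)| ≤ 32 * 7 ^ 3 * η ^ 3 := by
  set T := v i with hT
  have hT0 : 0 < T := hv i
  have hS := smooth_pos (m := m) hv y
  set S := smooth m v y with hSdef
  set a : EuclideanSpace ℝ (Fin n) → ℝ := fun u => ε * (y - u) i / T with ha
  have hac : Continuous a := by rw [ha]; fun_prop
  have hab : ∀ᵐ u ∂m, |a u| ≤ η := by
    filter_upwards [hR] with u hu
    refine le_trans ?_ hη1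
    rw [ha]; dsimp only
    rw [abs_div, abs_of_pos hT0, abs_mul, abs_of_pos hε]
    gcongr
    have h1 : |u i| ≤ ‖u‖ := PiLp.norm_apply_le u i
    calc |(y - u) i| = |y i - u i| := by simp
      _ ≤ |y i| + |u i| := abs_sub _ _
      _ ≤ _ := by linarith
  have hab2 : ∀ᵐ u ∂m, |a u ^ 2 - ε ^ 2 / T| ≤ 2 * η ^ 2 := by
    filter_upwards [hab] with u hu
    have h1 : a u ^ 2 ≤ η ^ 2 := sq_le_sq' (abs_le.1 hu).1 (abs_le.1 hu).2
    have h2 : 0 ≤ ε ^ 2 / T := by positivity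
    rw [abs_le]; constructor <;> nlinarith [sq_nonneg (a u)]
  have hi0 := integrable_prodKer (m := m) hv y
  have hi1 : Integrable (fun u => prodKer v (y - u) * -(a u)) m :=
    hi0.mul_bdd (c := η) hac.neg.aestronglyMeasurable (by filter_upwards [hab] with u hu; simpa using hu)
  have hi2 : Integrable (fun u => prodKer v (y - u) * (a u ^ 2 - ε ^ 2 / T)) m :=
    hi0.mul_bdd (c := 2 * η ^ 2) ((hac.pow 2).sub continuous_const).aestronglyMeasurable
      (by filter_upwards [hab2] with u hu; simpa using hu)
  refine ⟨(∫ u, prodKer v (y - u) * -(a u) ∂m) / S,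
    (∫ u, prodKer v (y - u) * (a u ^ 2 - ε ^ 2 / T) ∂m) / S, ?_, ?_, fun j hj => ?_⟩
  · rw [abs_div, abs_of_pos hS, div_le_iff₀ hS, mul_comm]
    exact abs_integral_prodKer_mul_le hv y (by simpa using hab)
  · rw [abs_div, abs_of_pos hS, div_le_iff₀ hS, mul_comm]
    exact abs_integral_prodKer_mul_le hv y hab2
  · have hv' := update_pos hv i (by linarith : 0 < T - ε ^ 2)
    have hi3 := integrable_prodKer (m := m) hv' (y + EuclideanSpace.single i (j * ε))
    have hi4 : Integrable (fun u => prodKer v (y - u) + j * (prodKer v (y - u) * -(a u))) m :=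
      hi0.add (hi1.const_mul j)
    have hi5 : Integrable (fun u => prodKer v (y - u) + j * (prodKer v (y - u) * -(a u)) +
        (j ^ 2 - 1) / 2 * (prodKer v (y - u) * (a u ^ 2 - ε ^ 2 / T))) m :=
      hi4.add (hi2.const_mul _)
    have hshift : ∀ u, prodKer (Function.update v i (T - ε ^ 2)) (y + EuclideanSpace.single i (j * ε) - u)
        = prodKer v (y - u) * (gaussKer (T - ε ^ 2) ((y - u) i + j * ε) / gaussKer T ((y - u) i)) := by
      intro u
      rw [add_sub_right_comm, prodKer_update_div hv]
    have e : smooth m (Function.update v i (T - ε ^ 2)) (y + EuclideanSpace.single i (j * ε)) / S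
        - (1 + j * ((∫ u, prodKer v (y - u) * -(a u) ∂m) / S)
          + (j ^ 2 - 1) / 2 * ((∫ u, prodKer v (y - u) * (a u ^ 2 - ε ^ 2 / T) ∂m) / S))
        = (∫ u, prodKer v (y - u) * (gaussKer (T - ε ^ 2) ((y - u) i + j * ε) / gaussKer T ((y - u) i)
          - (1 + j * -(a u) + (j ^ 2 - 1) / 2 * (a u ^ 2 - ε ^ 2 / T))) ∂m) / S := by
      have e2 : ∫ u, prodKer v (y - u) * (gaussKer (T - ε ^ 2) ((y - u) i + j * ε) / gaussKer T ((y - u) i)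
          - (1 + j * -(a u) + (j ^ 2 - 1) / 2 * (a u ^ 2 - ε ^ 2 / T))) ∂m
          = smooth m (Function.update v i (T - ε ^ 2)) (y + EuclideanSpace.single i (j * ε))
          - (S + j * (∫ u, prodKer v (y - u) * -(a u) ∂m)
          + (j ^ 2 - 1) / 2 * (∫ u, prodKer v (y - u) * (a u ^ 2 - ε ^ 2 / T) ∂m)) := by
        rw [hSdef]
        unfold smooth
        rw [← integral_const_mul, ← integral_const_mul, ← integral_add hi0 (hi1.const_mul j),
          ← integral_add hi4 (hi2.const_mul _), ← integral_sub hi3 hi5]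
        refine integral_congr_ae (Eventually.of_forall fun u => ?_)
        dsimp only
        rw [hshift]; ring
      rw [e2]; field_simp
    rw [e, abs_div, abs_of_pos hS, div_le_iff₀ hS, mul_comm _ S]
    refine abs_integral_prodKer_mul_le hv y ?_
    filter_upwards [hab] with u hu
    exact abs_gaussKer_div_sub_le hT0 hη hη0 hu hη2 hj

theorem cube_le_exp {N : ℝ} (hN : 0 ≤ N) : N ^ 3 ≤ 6 * Real.exp N := by
  have := Real.sum_le_exp_of_nonneg hN 4
  simp [Finset.sum_range_succ, Nat.factorial] at this
  nlinarith [sq_nonneg N]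

/-- The two-point inequality with `η` of order `ε (1 + R + |y_i|)`. The cubic growth of the error in
`y_i` is replaced by `e^{y_i} + e^{-y_i}`, which the Laplace transform turns into shifts of its
argument. -/
theorem smooth_rpow_le [NeZero m] {R : ℝ} (hR0 : 0 ≤ R) (hR : ∀ᵐ u ∂m, ‖u‖ ≤ R) {v : Fin n → ℝ}
    (hv : ∀ i, 0 < v i) (i : Fin n) {p : ℝ} (hp0 : 0 < p) (hp1 : p < 1) :
    ∃ C > 0, ∀ ε > 0, ε ^ 2 ≤ v i / 2 → ∀ y,
      smooth m v y ^ (1 / p) ≤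
        ((smooth m (Function.update v i (v i - ε ^ 2))
              (y + EuclideanSpace.single i ((√p + √(1 - p)) * ε)) *
            smooth m (Function.update v i (v i - ε ^ 2))
              (y + EuclideanSpace.single i ((√p - √(1 - p)) * ε))) ^ (1 / (2 * p)) +
          (smooth m (Function.update v i (v i - ε ^ 2))
              (y + EuclideanSpace.single i ((-√p + √(1 - p)) * ε)) *
            smooth m (Function.update v i (v i - ε ^ 2))
              (y + EuclideanSpace.single i ((-√p - √(1 - p)) * ε))) ^ (1 / (2 * p))) / 2
        + C * ε ^ 3 * (Real.exp (y i) + Real.exp (-y i)) * smooth m v y ^ (1 / p) := by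
  obtain ⟨C, hC, c, hc, H⟩ := one_sub_le_two_point hp0 (C₀ := 32 * 7 ^ 3) (by norm_num)
  set T := v i with hT
  have hT0 : 0 < T := hv i
  set c' := min c (1 / 42) with hc'
  have hc'0 : 0 < c' := by positivity
  -- When `η > c'` the expansion is unavailable, but then `C' η³ ≥ 1` and the lower bound is
  -- trivial.
  set C' := max C (1 / c' ^ 3) with hC'
  have hC'0 : 0 < C' := lt_max_of_lt_left hC
  refine ⟨C' * ((1 + 1 / T) ^ 3 * (6 * Real.exp (1 + R))), by positivity, fun ε hε hεT y => ?_⟩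
  have hv' := update_pos hv i (by linarith : 0 < T - ε ^ 2)
  set N := 1 + R + |y i| with hN
  have hN1 : 1 ≤ N := by rw [hN]; linarith [abs_nonneg (y i)]
  -- The factor `1 + 1 / T` makes `η` dominate both `ε (R + |y_i|) / T` and `ε / √T`.
  set η := (1 + 1 / T) * (ε * N) with hη
  have hη0 : 0 ≤ η := by positivity
  have hS := smooth_pos (m := m) hv y
  set S := smooth m v y with hSdef
  set D : ℝ → ℝ := fun j => smooth m (Function.update v i (T - ε ^ 2))
    (y + EuclideanSpace.single i (j * ε)) / S with hD
  have hDpos : ∀ j, 0 < D j := fun j => div_pos (smooth_pos hv' _) hS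
  have hDS : ∀ j, smooth m (Function.update v i (T - ε ^ 2))
    (y + EuclideanSpace.single i (j * ε)) = D j * S := fun j => by rw [hD]; field_simp
  have hmul : ∀ j k, (smooth m (Function.update v i (T - ε ^ 2))
      (y + EuclideanSpace.single i (j * ε)) * smooth m (Function.update v i (T - ε ^ 2))
      (y + EuclideanSpace.single i (k * ε))) ^ (1 / (2 * p))
      = (D j * D k) ^ (1 / (2 * p)) * S ^ (1 / p) := by
    intro j k
    rw [hDS, hDS, mul_mul_mul_comm, Real.mul_rpow (mul_pos (hDpos _) (hDpos _)).le (by positivity),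
      ← sq, ← Real.rpow_natCast S, ← Real.rpow_mul hS.le]
    congr 2
    push_cast; field_simp
  rw [hmul, hmul]
  have hη3 : η ^ 3 ≤ ((1 + 1 / T) ^ 3 * (6 * Real.exp (1 + R))) * ε ^ 3 *
      (Real.exp (y i) + Real.exp (-y i)) := by
    have h1 : N ^ 3 ≤ 6 * Real.exp N := cube_le_exp (by linarith)
    have h2 : Real.exp N ≤ Real.exp (1 + R) * (Real.exp (y i) + Real.exp (-y i)) := by
      rw [hN, Real.exp_add]
      gcongr
      rcases abs_cases (y i) with h | h
      · rw [h.1]; linarith [Real.exp_pos (-y i)]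
      · rw [h.1]; linarith [Real.exp_pos (y i)]
    calc η ^ 3 = (1 + 1 / T) ^ 3 * ε ^ 3 * N ^ 3 := by rw [hη]; ring
      _ ≤ (1 + 1 / T) ^ 3 * ε ^ 3 * (6 * (Real.exp (1 + R) * (Real.exp (y i) + Real.exp (-y i)))) := by
          gcongr; linarith
      _ = _ := by ring
  have key : 1 - C' * η ^ 3 ≤ ((D (√p + √(1 - p)) * D (√p - √(1 - p))) ^ (1 / (2 * p))
        + (D (-√p + √(1 - p)) * D (-√p - √(1 - p))) ^ (1 / (2 * p))) / 2 := by
    by_cases hcase : η ≤ c'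
    · have hη42 : 42 * η ≤ 1 := by
        have := hcase.trans (min_le_right _ _); linarith
      obtain ⟨A, B, hA, hB, hAB⟩ := smooth_update_expansion hR hv i y hε hεT hη0 hη42
        (by rw [hη, div_le_iff₀ hT0]
            have : (1 + 1 / T) * (ε * N) * T = ε * N * T + ε * N := by field_simp
            rw [this]
            have h3 : 0 ≤ ε * N * T := by positivity
            have h4 : ε * (R + |y i|) ≤ ε * N := by gcongr; rw [hN]; linarith
            linarith)
        (by have h3 : (ε : ℝ) ^ 2 ≤ (ε * N) ^ 2 := by
              gcongr; nlinarith
            have h4 : 1 / T ≤ (1 + 1 / T) ^ 2 := by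
              have : 0 < 1 / T := by positivity
              nlinarith
            calc ε ^ 2 / T = 1 / T * ε ^ 2 := by ring
              _ ≤ (1 + 1 / T) ^ 2 * (ε * N) ^ 2 := by gcongr
              _ = _ := by rw [hη]; ring)
      have := H η A B (√p) (√(1 - p)) D hη0 (hcase.trans (min_le_left _ _))
        (by nlinarith) (by nlinarith [sq_nonneg η]) (Real.sq_sqrt hp0.le)
        (by rw [Real.sq_sqrt hp0.le, Real.sq_sqrt (by linarith)]; ring) hDpos hAB
      have h5 : C * η ^ 3 ≤ C' * η ^ 3 := by gcongr; exact le_max_left _ _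
      linarith
    · push Not at hcase
      have h1 : 1 ≤ C' * η ^ 3 := by
        calc 1 = 1 / c' ^ 3 * c' ^ 3 := by field_simp
          _ ≤ C' * η ^ 3 := by gcongr; exact le_max_right _ _
      have h2 : 0 ≤ (D (√p + √(1 - p)) * D (√p - √(1 - p))) ^ (1 / (2 * p)) :=
        Real.rpow_nonneg (mul_pos (hDpos _) (hDpos _)).le _
      have h3 : 0 ≤ (D (-√p + √(1 - p)) * D (-√p - √(1 - p))) ^ (1 / (2 * p)) :=
        Real.rpow_nonneg (mul_pos (hDpos _) (hDpos _)).le _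
      linarith
  have hSp : 0 < S ^ (1 / p) := Real.rpow_pos_of_pos hS _
  have h6 := mul_le_mul_of_nonneg_right key hSp.le
  have h7 := mul_le_mul_of_nonneg_right (mul_le_mul_of_nonneg_left hη3 hC'0.le) hSp.le
  linarith

/-! ### The Laplace transform of the smoothed density -/

theorem laplace_shift (g : EuclideanSpace ℝ (Fin n) → ℝ≥0∞) (i : Fin n) (c : ℝ)
    (x : EuclideanSpace ℝ (Fin n)) :
    laplace (fun y => g (y + EuclideanSpace.single i c)) x
      = ENNReal.ofReal (Real.exp (-(c * x i))) * laplace g x := by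
  unfold laplace
  rw [← lintegral_const_mul' _ _ ENNReal.ofReal_ne_top,
    ← lintegral_add_right_eq_self (fun y => ENNReal.ofReal (Real.exp (-(c * x i))) *
      (g y * ENNReal.ofReal (Real.exp (inner ℝ x y)))) (EuclideanSpace.single i c)]
  refine lintegral_congr fun y => ?_
  rw [mul_left_comm, ofReal_exp_mul_exp, inner_add_right, EuclideanSpace.inner_single_right]
  congr 4
  simp

theorem laplace_mul_exp (g : EuclideanSpace ℝ (Fin n) → ℝ≥0∞) (i : Fin n) (c : ℝ)
    (x : EuclideanSpace ℝ (Fin n)) :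
    laplace (fun y => g y * ENNReal.ofReal (Real.exp (c * y i))) x
      = laplace g (x + EuclideanSpace.single i c) := by
  unfold laplace
  refine lintegral_congr fun y => ?_
  rw [mul_assoc, ofReal_exp_mul_exp, inner_add_left, EuclideanSpace.inner_single_left]
  congr 3
  simp [add_comm]

theorem laplace_mono {f g : EuclideanSpace ℝ (Fin n) → ℝ≥0∞} (h : ∀ y, f y ≤ g y)
    (x : EuclideanSpace ℝ (Fin n)) : laplace f x ≤ laplace g x :=
  lintegral_mono fun y => mul_le_mul_left (h y) _

theorem laplace_const_mul (f : EuclideanSpace ℝ (Fin n) → ℝ≥0∞) {c : ℝ≥0∞} (hc : c ≠ ⊤)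
    (x : EuclideanSpace ℝ (Fin n)) : laplace (fun y => c * f y) x = c * laplace f x := by
  unfold laplace
  rw [← lintegral_const_mul' _ _ hc]
  simp_rw [mul_assoc]

theorem measurable_exp_inner (x : EuclideanSpace ℝ (Fin n)) :
    Measurable fun y : EuclideanSpace ℝ (Fin n) => ENNReal.ofReal (Real.exp (inner ℝ x y)) :=
  ENNReal.measurable_ofReal.comp (Real.measurable_exp.comp (measurable_const.inner measurable_id))

theorem laplace_add {f : EuclideanSpace ℝ (Fin n) → ℝ≥0∞} (hf : Measurable f)
    (g : EuclideanSpace ℝ (Fin n) → ℝ≥0∞)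
    (x : EuclideanSpace ℝ (Fin n)) : laplace (fun y => f y + g y) x = laplace f x + laplace g x := by
  unfold laplace
  simp_rw [add_mul]
  exact lintegral_add_left (hf.mul (measurable_exp_inner x)) _

/-- Cauchy–Schwarz for the Laplace transform of a geometric mean of translates. -/
theorem laplace_geom_mean_le {f : EuclideanSpace ℝ (Fin n) → ℝ≥0∞} (hf : Measurable f) (i : Fin n)
    (b : ℝ) (x₁ x₂ : EuclideanSpace ℝ (Fin n)) :
    laplace (fun y => f (y + EuclideanSpace.single i b) ^ (1 / 2 : ℝ) *
        f (y + EuclideanSpace.single i (-b)) ^ (1 / 2 : ℝ)) ((2⁻¹ : ℝ) • (x₁ + x₂))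
      ≤ ENNReal.ofReal (Real.exp (-(b * (x₁ i - x₂ i) / 2))) *
        (laplace f x₁ ^ (1 / 2 : ℝ) * laplace f x₂ ^ (1 / 2 : ℝ)) := by
  have hm : ∀ c x, Measurable fun y : EuclideanSpace ℝ (Fin n) =>
      (f (y + EuclideanSpace.single i c) * ENNReal.ofReal (Real.exp (inner ℝ x y))) ^ (1 / 2 : ℝ) :=
    fun c x => ((hf.comp (measurable_id.add_const _)).mul (measurable_exp_inner x)).pow_const _
  have hsq : ∀ a : ℝ≥0∞, (a ^ (1 / 2 : ℝ)) ^ (2 : ℝ) = a := fun a => by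
    rw [← ENNReal.rpow_mul]; norm_num
  have h := ENNReal.lintegral_mul_le_Lp_mul_Lq (volume : Measure (EuclideanSpace ℝ (Fin n)))
    Real.HolderConjugate.two_two (hm b x₁).aemeasurable (hm (-b) x₂).aemeasurable
  simp only [Pi.mul_apply, hsq] at h
  have e1 := laplace_shift f i b x₁
  have e2 := laplace_shift f i (-b) x₂
  unfold laplace at e1 e2
  rw [e1, e2, mul_rpow_of_left (ofReal_exp_ne_zero _) ENNReal.ofReal_ne_top,
    mul_rpow_of_left (ofReal_exp_ne_zero _) ENNReal.ofReal_ne_top, ofReal_exp_rpow, ofReal_exp_rpow,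
    mul_mul_mul_comm, ofReal_exp_mul_exp] at h
  refine le_trans (le_of_eq ?_) (h.trans (le_of_eq ?_))
  · unfold laplace
    refine lintegral_congr fun y => ?_
    rw [ENNReal.mul_rpow_of_nonneg _ _ (by norm_num), ENNReal.mul_rpow_of_nonneg _ _ (by norm_num),
      ofReal_exp_rpow, ofReal_exp_rpow, mul_mul_mul_comm, ofReal_exp_mul_exp, inner_smul_left,
      inner_add_left]
    congr 3
    simp
    ring
  · unfold laplace
    congr 3
    ring

variable {m : Measure (EuclideanSpace ℝ (Fin n))} [IsFiniteMeasure m]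

/-- The Laplace transform of the `1 / p`-th power of the smoothed measure. -/
noncomputable def smoothLaplace (p : ℝ) (m : Measure (EuclideanSpace ℝ (Fin n))) (v : Fin n → ℝ) :
    EuclideanSpace ℝ (Fin n) → ℝ≥0∞ :=
  laplaceRoot p fun y => ENNReal.ofReal (smooth m v y)

theorem smooth_mul_exp_le {R : ℝ} (hR : ∀ᵐ u ∂m, ‖u‖ ≤ R) {v : Fin n → ℝ}
    (hv : ∀ i, 0 < v i) (i : Fin n) (K : ℝ) (y : EuclideanSpace ℝ (Fin n)) :
    smooth m v y * Real.exp (K * y i) ≤ Real.exp (K ^ 2 * v i / 2 + |K| * R) *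
      smooth m v (y + EuclideanSpace.single i (-(K * v i))) := by
  unfold smooth
  rw [← integral_mul_const, ← integral_const_mul]
  refine integral_mono_ae ((integrable_prodKer hv y).mul_const _)
    ((integrable_prodKer hv _).const_mul _) ?_
  filter_upwards [hR] with u hu
  have h0 := prodKer_update_add_single v i (v i) (-(K * v i)) (y - u)
  rw [Function.update_eq_self, ← sub_eq_add_neg] at h0
  rw [add_sub_right_comm, h0, prodKer_eq_mul v i]
  have h1 := gaussKer_mul_exp (hv i) ((y - u) i) K
  have h2 : Real.exp (K * y i) = Real.exp (K * (y - u) i) * Real.exp (K * u i) := by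
    rw [← Real.exp_add]; congr 1; simp; ring
  have hrest : 0 ≤ ∏ j ∈ Finset.univ.erase i, gaussKer (v j) ((y - u) j) :=
    Finset.prod_nonneg fun j _ => (gaussKer_pos (hv j) _).le
  have h3 : Real.exp (K * u i) ≤ Real.exp (|K| * R) := by
    apply Real.exp_le_exp.2
    calc K * u i ≤ |K * u i| := le_abs_self _
      _ = |K| * |u i| := abs_mul _ _
      _ ≤ |K| * R := by
        gcongr
        exact (PiLp.norm_apply_le u i).trans hu
  have hg := gaussKer_pos (hv i) ((y - u) i - K * v i)
  calc gaussKer (v i) ((y - u) i) * (∏ j ∈ Finset.univ.erase i, gaussKer (v j) ((y - u) j)) *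
        Real.exp (K * y i)
      = (gaussKer (v i) ((y - u) i) * Real.exp (K * (y - u) i)) * Real.exp (K * u i) *
        ∏ j ∈ Finset.univ.erase i, gaussKer (v j) ((y - u) j) := by rw [h2]; ring
    _ = gaussKer (v i) ((y - u) i - K * v i) * Real.exp (K ^ 2 * v i / 2) * Real.exp (K * u i) *
        ∏ j ∈ Finset.univ.erase i, gaussKer (v j) ((y - u) j) := by rw [h1]
    _ ≤ gaussKer (v i) ((y - u) i - K * v i) * Real.exp (K ^ 2 * v i / 2) * Real.exp (|K| * R) *
        ∏ j ∈ Finset.univ.erase i, gaussKer (v j) ((y - u) j) := by gcongr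
    _ = _ := by rw [Real.exp_add]; ring

/-- Shifting the argument weights the density by an exponential. Completing the square in the
Gaussian kernel turns this weight into a translation, at a bounded cost since `m` has bounded
support, and a translation multiplies the Laplace transform by an exponential in `x_i`. This keeps
the error in the step proportional to `smoothLaplace` at the same point. -/
theorem smoothLaplace_add_single_le {R : ℝ} (hR : ∀ᵐ u ∂m, ‖u‖ ≤ R) {v : Fin n → ℝ}
    (hv : ∀ i, 0 < v i) (i : Fin n) {p : ℝ} (hp : 0 < p) (c : ℝ) :
    ∃ C > 0, ∀ x, smoothLaplace p m v (x + EuclideanSpace.single i c) ≤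
      ENNReal.ofReal C * ENNReal.ofReal (Real.exp (c * p * v i * x i)) * smoothLaplace p m v x := by
  refine ⟨Real.exp ((c * p) ^ 2 * v i / 2 + |c * p| * R) ^ (1 / p), by positivity, fun x => ?_⟩
  set g : EuclideanSpace ℝ (Fin n) → ℝ≥0∞ := fun y => ENNReal.ofReal (smooth m v y) ^ (1 / p) with hg
  have hX : ∀ x, smoothLaplace p m v x = laplace g x := fun x => rfl
  have e := laplace_shift g i (-(c * p * v i)) x
  rw [neg_mul, neg_neg] at e
  rw [hX, hX, ← laplace_mul_exp, mul_assoc, ← e,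
    ← laplace_const_mul _ ENNReal.ofReal_ne_top]
  refine laplace_mono (fun y => ?_) x
  have h1 := smooth_mul_exp_le hR hv i (c * p) y
  have h2 := ENNReal.rpow_le_rpow (ENNReal.ofReal_le_ofReal h1) (by positivity : 0 ≤ 1 / p)
  rw [ENNReal.ofReal_mul' (Real.exp_pos _).le, ENNReal.ofReal_mul (Real.exp_pos _).le,
    ENNReal.mul_rpow_of_nonneg _ _ (by positivity), ENNReal.mul_rpow_of_nonneg _ _ (by positivity),
    ofReal_exp_rpow] at h2
  rw [← ENNReal.ofReal_rpow_of_pos (Real.exp_pos _)]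
  refine le_trans (le_of_eq ?_) h2
  rw [hg]; dsimp only
  congr 3
  field_simp

/-- The Laplace transform of `smooth_rpow_le`. The two `κ`-shifts average to `cosh (κ ε x_i) ≤ exp
(p ε² x_i² / 2)`. The `β`-shifted geometric mean is split by Cauchy–Schwarz between `x₁` and `x₂`,
which produces the term in `x₁ i - x₂ i`. -/
theorem smoothLaplace_step_le [NeZero m] {R : ℝ} (hR0 : 0 ≤ R) (hR : ∀ᵐ u ∂m, ‖u‖ ≤ R)
    {v : Fin n → ℝ} (hv : ∀ i, 0 < v i) (i : Fin n) {p : ℝ} (hp0 : 0 < p) (hp1 : p < 1) :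
    ∃ C > 0, ∀ ε > 0, ε ^ 2 ≤ v i / 2 → ∀ x₁ x₂ x : EuclideanSpace ℝ (Fin n),
      x = (2⁻¹ : ℝ) • (x₁ + x₂) →
      smoothLaplace p m v x ≤
        ENNReal.ofReal (Real.exp (p * ε ^ 2 * x i ^ 2 / 2 - √(1 - p) * ε * (x₁ i - x₂ i) / 2)) *
        (smoothLaplace p m (Function.update v i (v i - ε ^ 2)) x₁ ^ (1 / 2 : ℝ) *
          smoothLaplace p m (Function.update v i (v i - ε ^ 2)) x₂ ^ (1 / 2 : ℝ)) +
        ENNReal.ofReal (C * ε ^ 3 * Real.cosh (p * v i * x i)) * smoothLaplace p m v x := by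
  obtain ⟨C, hC, H⟩ := smooth_rpow_le hR0 hR hv i hp0 hp1
  obtain ⟨C₁, hC₁, H₁⟩ := smoothLaplace_add_single_le hR hv i hp0 1
  obtain ⟨C₂, hC₂, H₂⟩ := smoothLaplace_add_single_le hR hv i hp0 (-1)
  refine ⟨2 * (C * (C₁ + C₂)), by positivity, fun ε hε hεT x₁ x₂ x hx => ?_⟩
  set v' := Function.update v i (v i - ε ^ 2) with hv'
  have hv'0 := update_pos hv i (by linarith [hv i] : 0 < v i - ε ^ 2)
  set s := smooth m v' with hs
  have hspos : ∀ y, 0 < s y := smooth_pos hv'0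
  have hscont : Continuous s := continuous_smooth hv'0
  set β := √(1 - p) with hβ
  set κ := √p with hκ
  set f : EuclideanSpace ℝ (Fin n) → ℝ≥0∞ := fun y => ENNReal.ofReal (s y) ^ (1 / p) with hf
  have hfm : Measurable f := (ENNReal.measurable_ofReal.comp hscont.measurable).pow_const _
  set g : EuclideanSpace ℝ (Fin n) → ℝ≥0∞ := fun y => ENNReal.ofReal (smooth m v y) ^ (1 / p) with hg
  have hgm : Measurable g :=
    (ENNReal.measurable_ofReal.comp (continuous_smooth hv).measurable).pow_const _
  set G : EuclideanSpace ℝ (Fin n) → ℝ≥0∞ := fun y =>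
    f (y + EuclideanSpace.single i (β * ε)) ^ (1 / 2 : ℝ) *
        f (y + EuclideanSpace.single i (-(β * ε))) ^ (1 / 2 : ℝ) with hG
  have hGm : Measurable G := ((hfm.comp (measurable_id.add_const _)).pow_const _).mul
    ((hfm.comp (measurable_id.add_const _)).pow_const _)
  have hGs : ∀ y a b d, a = d + β * ε → b = d + -(β * ε) →
      ENNReal.ofReal ((s (y + EuclideanSpace.single i a) * s (y + EuclideanSpace.single i b))
        ^ (1 / (2 * p))) = G (y + EuclideanSpace.single i d) := by
    intro y a b d ha hb
    have e : ∀ c, y + EuclideanSpace.single i d + EuclideanSpace.single i c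
        = y + EuclideanSpace.single i (d + c) := by
      intro c
      ext j
      by_cases hj : j = i
      · subst hj; simp; ring
      · simp [hj]
    rw [hG]; dsimp only
    rw [e, e, ← ha, ← hb, hf]; dsimp only
    rw [← ENNReal.rpow_mul, ← ENNReal.rpow_mul, ← ENNReal.mul_rpow_of_nonneg _ _ (by positivity),
      ← ENNReal.ofReal_mul (hspos _).le, ENNReal.ofReal_rpow_of_pos (mul_pos (hspos _) (hspos _))]
    congr 2
    field_simp
  have hpt : ∀ y, g y ≤ ENNReal.ofReal (1 / 2) * (G (y + EuclideanSpace.single i (κ * ε)) +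
      G (y + EuclideanSpace.single i (-(κ * ε)))) + ENNReal.ofReal (C * ε ^ 3) *
      (g y * ENNReal.ofReal (Real.exp (1 * y i)) + g y * ENNReal.ofReal (Real.exp (-1 * y i))) := by
    intro y
    have h := ENNReal.ofReal_le_ofReal (H ε hε hεT y)
    have hS := smooth_pos (m := m) hv y
    simp only [← hv', ← hs] at h
    rw [← ENNReal.ofReal_rpow_of_pos hS] at h
    refine h.trans (le_of_eq ?_)
    rw [← hGs y ((κ + β) * ε) ((κ - β) * ε) (κ * ε) (by ring) (by ring),
      ← hGs y ((-κ + β) * ε) ((-κ - β) * ε) (-(κ * ε)) (by ring) (by ring)]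
    have hr : ∀ a b, 0 ≤ (s (y + EuclideanSpace.single i a) * s (y + EuclideanSpace.single i b))
        ^ (1 / (2 * p)) := fun a b => Real.rpow_nonneg (mul_pos (hspos _) (hspos _)).le _
    rw [hg]; dsimp only
    rw [ENNReal.ofReal_rpow_of_pos hS, ← ENNReal.ofReal_mul (by positivity),
      ← ENNReal.ofReal_mul (by positivity), ← ENNReal.ofReal_add (hr _ _) (hr _ _),
      ← ENNReal.ofReal_add (by positivity) (by positivity), ← ENNReal.ofReal_mul (by positivity),
      ← ENNReal.ofReal_mul (by positivity), ← ENNReal.ofReal_add]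
    · congr 1; ring_nf
    · exact mul_nonneg (by norm_num) (add_nonneg (hr _ _) (hr _ _))
    · positivity
  have hgX : ∀ x, smoothLaplace p m v x = laplace g x := fun x => rfl
  have hfX : ∀ x, smoothLaplace p m v' x = laplace f x := fun x => rfl
  have hGsm : ∀ c, Measurable fun y => G (y + EuclideanSpace.single i c) := fun c =>
    hGm.comp (measurable_id.add_const _)
  have h1 := laplace_mono hpt x
  have hexpm : ∀ c : ℝ, Measurable fun y : EuclideanSpace ℝ (Fin n) =>
      ENNReal.ofReal (Real.exp (c * y i)) := fun c => by fun_prop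
  have hm1 : Measurable fun y => ENNReal.ofReal (1 / 2) *
      (G (y + EuclideanSpace.single i (κ * ε)) + G (y + EuclideanSpace.single i (-(κ * ε)))) :=
    ((hGsm _).add (hGsm _)).const_mul _
  have hm2 : Measurable fun y => g y * ENNReal.ofReal (Real.exp (1 * y i)) := hgm.mul (hexpm 1)
  rw [laplace_add hm1, laplace_const_mul _ ENNReal.ofReal_ne_top,
    laplace_add (hGsm _), laplace_const_mul _ ENNReal.ofReal_ne_top,
    laplace_add hm2, laplace_mul_exp, laplace_mul_exp, laplace_shift, laplace_shift,
    ← add_mul, ← ENNReal.ofReal_add (Real.exp_pos _).le (Real.exp_pos _).le, ← mul_assoc,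
    ← ENNReal.ofReal_mul (by norm_num)] at h1
  have hcosh : 1 / 2 * (Real.exp (-(κ * ε * x i)) + Real.exp (-(-(κ * ε) * x i)))
      ≤ Real.exp (p * ε ^ 2 * x i ^ 2 / 2) := by
    have := Real.cosh_le_exp_half_sq (κ * ε * x i)
    rw [Real.cosh_eq] at this
    have e : (κ * ε * x i) ^ 2 / 2 = p * ε ^ 2 * x i ^ 2 / 2 := by
      rw [mul_pow, mul_pow, hκ, Real.sq_sqrt hp0.le]
    rw [e] at this
    rw [show -(-(κ * ε) * x i) = κ * ε * x i by ring]
    linarith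
  have h2 : laplace G x ≤ _ := hx ▸ laplace_geom_mean_le hfm i (β * ε) x₁ x₂
  rw [hgX]
  refine h1.trans (add_le_add ?_ ?_)
  · calc _ ≤ ENNReal.ofReal (Real.exp (p * ε ^ 2 * x i ^ 2 / 2)) *
          (ENNReal.ofReal (Real.exp (-(β * ε * (x₁ i - x₂ i) / 2))) *
        (laplace f x₁ ^ (1 / 2 : ℝ) * laplace f x₂ ^ (1 / 2 : ℝ))) := by gcongr
      _ = _ := by
        rw [← mul_assoc, ofReal_exp_mul_exp, ← sub_eq_add_neg, ← hfX, ← hfX]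
  · have h3 := H₁ x
    have h4 := H₂ x
    rw [hgX, hgX] at h3 h4
    have h5 : ENNReal.ofReal C₁ * ENNReal.ofReal (Real.exp (1 * p * v i * x i)) * laplace g x +
        ENNReal.ofReal C₂ * ENNReal.ofReal (Real.exp (-1 * p * v i * x i)) * laplace g x
        ≤ ENNReal.ofReal (2 * (C₁ + C₂) * Real.cosh (p * v i * x i)) * laplace g x := by
      rw [← add_mul, ← ENNReal.ofReal_mul hC₁.le, ← ENNReal.ofReal_mul hC₂.le,
        ← ENNReal.ofReal_add (by positivity) (by positivity)]
      gcongr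
      rw [Real.cosh_eq]
      have e1 : -1 * p * v i * x i = -(p * v i * x i) := by ring
      have e2 : 1 * p * v i * x i = p * v i * x i := by ring
      rw [e1, e2]
      have := Real.exp_pos (p * v i * x i)
      have := Real.exp_pos (-(p * v i * x i))
      nlinarith
    calc _ ≤ ENNReal.ofReal (C * ε ^ 3) *
          (ENNReal.ofReal (2 * (C₁ + C₂) * Real.cosh (p * v i * x i)) * laplace g x) := by
          gcongr
          exact (add_le_add h3 h4).trans h5
      _ = _ := by
        rw [← mul_assoc, ← ENNReal.ofReal_mul (by positivity)]
        congr 2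
        ring

section

variable {m : Measure (EuclideanSpace ℝ (Fin n))} [IsFiniteMeasure m]

/-! ### Monotonicity of the tilted minimum in the variances -/

theorem exists_le_smoothLaplace [NeZero m] {R lo hi p : ℝ} (hm : ∀ᵐ u ∂m, ‖u‖ ≤ R) (hlo : 0 < lo)
    (hhi : 0 < hi) (hp : 0 < p) :
    ∃ a > 0, ∃ b > 0, ∀ v : Fin n → ℝ, (∀ i, lo ≤ v i) → (∀ i, v i ≤ hi) → ∀ x,
      ENNReal.ofReal (a * Real.exp (b * ‖x‖ ^ 2)) ≤ smoothLaplace p m v x := by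
  obtain ⟨c, hc, C, hC, h⟩ := exists_le_smooth (m := m) hm hlo hhi
  obtain ⟨a, ha, b, hb, H⟩ := exists_le_laplaceRoot (n := n) (p := p) hp hc hC
    (f := fun y => ENNReal.ofReal (c * Real.exp (-C * ‖y‖ ^ 2))) (fun y => le_rfl)
  exact ⟨a, ha, b, hb, fun v h1 h2 x => (H x).trans
    (laplaceRoot_mono hp (fun y => ENNReal.ofReal_le_ofReal (h v h1 h2 y)) x)⟩

theorem exists_smooth_rpow_mul_exp_le {R lo hi p : ℝ} (hm : ∀ᵐ u ∂m, ‖u‖ ≤ R)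
    (hlo : 0 < lo) (hhi : 0 < hi) (hp : 0 < p) :
    ∃ C ≥ 0, ∃ c > 0, ∀ v : Fin n → ℝ, (∀ i, lo ≤ v i) → (∀ i, v i ≤ hi) →
      ∀ r x, ‖x‖ ≤ r → ∀ y,
      ENNReal.ofReal (smooth m v y) ^ (1 / p) * ENNReal.ofReal (Real.exp (inner ℝ x y)) ≤
        ENNReal.ofReal C * ENNReal.ofReal (Real.exp (-c * ‖y‖ ^ 2 + r * ‖y‖)) := by
  obtain ⟨C, hC, c, hc, h⟩ := exists_smooth_le (m := m) hm hlo hhi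
  refine ⟨C ^ (1 / p), by positivity, c * (1 / p), by positivity, fun v h1 h2 r x hx y => ?_⟩
  have e1 : ENNReal.ofReal (smooth m v y) ^ (1 / p) ≤
      ENNReal.ofReal (C ^ (1 / p)) * ENNReal.ofReal (Real.exp (-(c * (1 / p)) * ‖y‖ ^ 2)) := by
    refine (ENNReal.rpow_le_rpow (ENNReal.ofReal_le_ofReal (h v h1 h2 y))
      (by positivity : 0 ≤ 1 / p)).trans (le_of_eq ?_)
    rw [ENNReal.ofReal_mul hC, ENNReal.mul_rpow_of_nonneg _ _ (by positivity),
      ENNReal.ofReal_rpow_of_nonneg hC (by positivity), ofReal_exp_rpow]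
    congr 3; ring
  have e2 : inner ℝ x y ≤ r * ‖y‖ :=
    (real_inner_le_norm _ _).trans (mul_le_mul_of_nonneg_right hx (norm_nonneg _))
  calc _ ≤ ENNReal.ofReal (C ^ (1 / p)) * ENNReal.ofReal (Real.exp (-(c * (1 / p)) * ‖y‖ ^ 2)) *
        ENNReal.ofReal (Real.exp (r * ‖y‖)) := by gcongr
    _ = _ := by rw [mul_assoc, ofReal_exp_mul_exp]

theorem exists_smoothLaplace_le {R lo hi p : ℝ} (hm : ∀ᵐ u ∂m, ‖u‖ ≤ R)
    (hlo : 0 < lo) (hhi : 0 < hi) (hp : 0 < p) (r : ℝ) :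
    ∃ C : ℝ≥0∞, C ≠ ⊤ ∧ ∀ v : Fin n → ℝ, (∀ i, lo ≤ v i) → (∀ i, v i ≤ hi) → ∀ x, ‖x‖ ≤ r →
      smoothLaplace p m v x ≤ C := by
  obtain ⟨C, hC, c, hc, h⟩ := exists_smooth_rpow_mul_exp_le (m := m) hm hlo hhi hp
  refine ⟨_, ?_, fun v h1 h2 x hx => lintegral_mono (h v h1 h2 r x hx)⟩
  rw [lintegral_const_mul' _ _ ENNReal.ofReal_ne_top]
  exact (ENNReal.mul_lt_top ENNReal.ofReal_lt_top (lintegral_exp_neg_sq_add_lt_top hc r)).ne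

theorem smoothLaplace_ne_top {R p : ℝ} (hm : ∀ᵐ u ∂m, ‖u‖ ≤ R) (hp : 0 < p) {v : Fin n → ℝ}
    (hv : ∀ i, 0 < v i) (x : EuclideanSpace ℝ (Fin n)) : smoothLaplace p m v x ≠ ⊤ := by
  obtain ⟨lo, hlo, hi, hhi, h1, h2⟩ := exists_bounds v hv
  obtain ⟨C, hC, h⟩ := exists_smoothLaplace_le (m := m) hm hlo hhi hp ‖x‖
  exact ne_top_of_le_ne_top hC (h v h1 h2 x le_rfl)

theorem smoothLaplace_ne_zero [NeZero m] {R p : ℝ} (hm : ∀ᵐ u ∂m, ‖u‖ ≤ R) (hp : 0 < p)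
    {v : Fin n → ℝ} (hv : ∀ i, 0 < v i) (x : EuclideanSpace ℝ (Fin n)) :
    smoothLaplace p m v x ≠ 0 := by
  obtain ⟨lo, hlo, hi, hhi, h1, h2⟩ := exists_bounds v hv
  obtain ⟨a, ha, b, hb, h⟩ := exists_le_smoothLaplace (m := m) hm hlo hhi hp
  intro h0
  have := h v h1 h2 x
  rw [h0] at this
  simp only [nonpos_iff_eq_zero, ENNReal.ofReal_eq_zero] at this
  exact absurd this (not_le.2 (by positivity))

theorem measurable_smoothLaplace {p : ℝ} {v : Fin n → ℝ} (hv : ∀ i, 0 < v i) :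
    Measurable (smoothLaplace p m v) :=
  measurable_laplaceRoot (ENNReal.measurable_ofReal.comp (continuous_smooth hv).measurable)

theorem tendsto_smoothLaplace {ι : Type*} {l : Filter ι} [l.IsCountablyGenerated] [l.NeBot]
    {v : ι → Fin n → ℝ} {v' : Fin n → ℝ} {R lo hi p : ℝ} (hm : ∀ᵐ u ∂m, ‖u‖ ≤ R) (hp : 0 < p)
    (hlo : 0 < lo) (hhi : 0 < hi) (h1 : ∀ᶠ k in l, ∀ i, lo ≤ v k i) (h2 : ∀ᶠ k in l, ∀ i, v k i ≤ hi)
    (hlim : Tendsto v l (𝓝 v')) (x : EuclideanSpace ℝ (Fin n)) :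
    Tendsto (fun k => smoothLaplace p m (v k) x) l (𝓝 (smoothLaplace p m v' x)) := by
  obtain ⟨C, hC, c, hc, h⟩ := exists_smooth_rpow_mul_exp_le (m := m) hm hlo hhi hp
  refine tendsto_lintegral_filter_of_dominated_convergence
    (fun y => ENNReal.ofReal C * ENNReal.ofReal (Real.exp (-c * ‖y‖ ^ 2 + ‖x‖ * ‖y‖))) ?_ ?_ ?_ ?_
  · filter_upwards [h1] with k hk
    have hv : ∀ i, 0 < v k i := fun i => hlo.trans_le (hk i)
    exact ((ENNReal.measurable_ofReal.comp (continuous_smooth hv).measurable).pow_const _).mul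
      (measurable_exp_inner x)
  · filter_upwards [h1, h2] with k hk1 hk2
    exact Eventually.of_forall fun y => h (v k) hk1 hk2 ‖x‖ x le_rfl y
  · rw [lintegral_const_mul' _ _ ENNReal.ofReal_ne_top]
    exact (ENNReal.mul_lt_top ENNReal.ofReal_lt_top (lintegral_exp_neg_sq_add_lt_top hc _)).ne
  · refine Eventually.of_forall fun y => ?_
    refine ENNReal.Tendsto.mul_const ?_ (Or.inr ENNReal.ofReal_ne_top)
    exact (ENNReal.continuous_rpow_const.tendsto _).comp
      (ENNReal.tendsto_ofReal (tendsto_smooth hlo h1 hlim y))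

/-- The density whose integral is `tilted`, as a real function. -/
noncomputable def tiltDens (p : ℝ) (m : Measure (EuclideanSpace ℝ (Fin n))) (v : Fin n → ℝ)
    (z x : EuclideanSpace ℝ (Fin n)) : ℝ :=
  (smoothLaplace p m v x).toReal ^ (-(p / (1 - p))) * Real.exp (inner ℝ z x)

theorem tiltDens_nonneg {m : Measure (EuclideanSpace ℝ (Fin n))} (p : ℝ) (v : Fin n → ℝ) (z x : EuclideanSpace ℝ (Fin n)) :
    0 ≤ tiltDens p m v z x := by unfold tiltDens; positivity

theorem measurable_tiltDens {p : ℝ} {v : Fin n → ℝ} (hv : ∀ i, 0 < v i)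
    (z : EuclideanSpace ℝ (Fin n)) : Measurable (tiltDens p m v z) := by
  unfold tiltDens
  exact ((measurable_smoothLaplace hv).ennreal_toReal.pow_const _).mul
    (Real.measurable_exp.comp (measurable_const.inner measurable_id))

theorem exists_tiltDens_le [NeZero m] {R lo hi p : ℝ} (hm : ∀ᵐ u ∂m, ‖u‖ ≤ R) (hlo : 0 < lo)
    (hhi : 0 < hi) (hp0 : 0 < p) (hp1 : p < 1) :
    ∃ K ≥ 0, ∃ c > 0, ∀ v : Fin n → ℝ, (∀ i, lo ≤ v i) → (∀ i, v i ≤ hi) → ∀ z x,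
      tiltDens p m v z x ≤ K * Real.exp (-c * ‖x‖ ^ 2 + ‖z‖ * ‖x‖) := by
  have hQ : 0 < p / (1 - p) := div_pos hp0 (by linarith)
  obtain ⟨a, ha, b, hb, h⟩ := exists_le_smoothLaplace (m := m) hm hlo hhi hp0
  refine ⟨a ^ (-(p / (1 - p))), by positivity, p / (1 - p) * b, by positivity, fun v h1 h2 z x => ?_⟩
  have hv : ∀ i, 0 < v i := fun i => hlo.trans_le (h1 i)
  have h3 := (ENNReal.ofReal_le_iff_le_toReal (smoothLaplace_ne_top hm hp0 hv x)).1 (h v h1 h2 x)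
  have h4 : (smoothLaplace p m v x).toReal ^ (-(p / (1 - p))) ≤
      a ^ (-(p / (1 - p))) * Real.exp (-(p / (1 - p) * b) * ‖x‖ ^ 2) := by
    refine (Real.rpow_le_rpow_of_nonpos (by positivity) h3 (by linarith)).trans (le_of_eq ?_)
    rw [Real.mul_rpow ha.le (Real.exp_pos _).le, ← Real.exp_mul]
    congr 2; ring
  unfold tiltDens
  rw [Real.exp_add, ← mul_assoc]
  gcongr
  exact real_inner_le_norm _ _

theorem integrable_exp_neg_sq_add {c : ℝ} (hc : 0 < c) (K : ℝ) :
    Integrable fun x : EuclideanSpace ℝ (Fin n) => Real.exp (-c * ‖x‖ ^ 2 + K * ‖x‖) := by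
  refine ⟨by fun_prop, ?_⟩
  rw [hasFiniteIntegral_iff_ofReal (Eventually.of_forall fun x => (Real.exp_pos _).le)]
  exact lintegral_exp_neg_sq_add_lt_top hc K

theorem integrable_mul_of_le {w G : EuclideanSpace ℝ (Fin n) → ℝ} (hw : Measurable w)
    (hG : Measurable G) (hw0 : ∀ x, 0 ≤ w x) {K c L N k : ℝ} (hc : 0 < c)
    (hwK : ∀ x, w x ≤ K * Real.exp (-c * ‖x‖ ^ 2 + L * ‖x‖)) (hGN : ∀ x, |G x| ≤ N * Real.exp (k * ‖x‖)) :
    Integrable fun x => G x * w x := by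
  refine Integrable.mono' ((integrable_exp_neg_sq_add (n := n) hc (L + k)).const_mul (N * K))
    (hG.mul hw).aestronglyMeasurable (Eventually.of_forall fun x => ?_)
  rw [norm_mul, Real.norm_eq_abs, Real.norm_of_nonneg (hw0 x)]
  refine (mul_le_mul (hGN x) (hwK x) (hw0 x) ((abs_nonneg _).trans (hGN x))).trans (le_of_eq ?_)
  rw [add_mul, ← add_assoc, Real.exp_add _ (k * ‖x‖)]; ring

theorem tilted_smoothLaplace [NeZero m] {R p : ℝ} (hm : ∀ᵐ u ∂m, ‖u‖ ≤ R) (hp0 : 0 < p)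
    (hp1 : p < 1) {v : Fin n → ℝ} (hv : ∀ i, 0 < v i) (z : EuclideanSpace ℝ (Fin n)) :
    Integrable (tiltDens p m v z) ∧
      tilted (p / (1 - p)) (smoothLaplace p m v) z = ENNReal.ofReal (∫ x, tiltDens p m v z x) := by
  obtain ⟨lo, hlo, hi, hhi, h1, h2⟩ := exists_bounds v hv
  obtain ⟨K, hK, c, hc, h⟩ := exists_tiltDens_le (m := m) hm hlo hhi hp0 hp1
  have hint : Integrable (tiltDens p m v z) := by
    have := integrable_mul_of_le (measurable_tiltDens (m := m) (p := p) hv z) (measurable_const (a := (1:ℝ)))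
      (tiltDens_nonneg p v z) (N := 1) (k := 0) hc (h v h1 h2 z) (fun x => by simp)
    simpa using this
  refine ⟨hint, ?_⟩
  rw [ofReal_integral_eq_lintegral_ofReal hint (Eventually.of_forall (tiltDens_nonneg p v z))]
  refine lintegral_congr fun x => ?_
  unfold tiltDens
  rw [ENNReal.ofReal_mul (by positivity), ← ENNReal.ofReal_rpow_of_pos, ENNReal.ofReal_toReal]
  · exact smoothLaplace_ne_top hm hp0 hv x
  · exact ENNReal.toReal_pos (smoothLaplace_ne_zero hm hp0 hv x) (smoothLaplace_ne_top hm hp0 hv x)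

/-! ### One step of the flow through Prékopa–Leindler. -/

theorem cosh_midpoint_le (a b : ℝ) : Real.cosh ((a + b) / 2) ≤ (Real.cosh a + Real.cosh b) / 2 := by
  have e : Real.cosh a + Real.cosh b = 2 * Real.cosh ((a + b) / 2) * Real.cosh ((a - b) / 2) := by
    have h1 := Real.cosh_add ((a + b) / 2) ((a - b) / 2)
    have h2 := Real.cosh_sub ((a + b) / 2) ((a - b) / 2)
    rw [show (a + b) / 2 + (a - b) / 2 = a by ring] at h1
    rw [show (a + b) / 2 - (a - b) / 2 = b by ring] at h2
    rw [h1, h2]; ring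
  rw [e]
  have h1 := Real.one_le_cosh ((a - b) / 2)
  have h2 := Real.cosh_pos ((a + b) / 2)
  nlinarith

/-- `1 - C cosh` is concave, so its positive part is midpoint log-concave. The error can therefore
be carried as a cutoff factor without spoiling the Prékopa–Leindler hypothesis. -/
theorem max_mul_max_le_sq {C k a b : ℝ} (hC : 0 ≤ C) :
    max 0 (1 - C * Real.cosh (k * a)) * max 0 (1 - C * Real.cosh (k * b)) ≤
      max 0 (1 - C * Real.cosh (k * ((a + b) / 2))) ^ 2 := by
  set s := max 0 (1 - C * Real.cosh (k * a)) with hs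
  set t := max 0 (1 - C * Real.cosh (k * b)) with ht
  have hs0 : 0 ≤ s := le_max_left _ _
  have ht0 : 0 ≤ t := le_max_left _ _
  have hcosh := cosh_midpoint_le (k * a) (k * b)
  rw [show (k * a + k * b) / 2 = k * ((a + b) / 2) by ring] at hcosh
  by_cases h1 : 1 - C * Real.cosh (k * a) ≤ 0
  · rw [hs, max_eq_left h1, zero_mul]; positivity
  by_cases h2 : 1 - C * Real.cosh (k * b) ≤ 0
  · rw [ht, max_eq_left h2, mul_zero]; positivity
  push Not at h1 h2
  have e1 : s = 1 - C * Real.cosh (k * a) := max_eq_right h1.le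
  have e2 : t = 1 - C * Real.cosh (k * b) := max_eq_right h2.le
  have h3 : (s + t) / 2 ≤ max 0 (1 - C * Real.cosh (k * ((a + b) / 2))) := by
    refine le_trans ?_ (le_max_right _ _)
    rw [e1, e2]
    have := mul_le_mul_of_nonneg_left hcosh hC
    linarith
  calc s * t ≤ ((s + t) / 2) ^ 2 := by nlinarith [sq_nonneg (s - t)]
    _ ≤ _ := pow_le_pow_left₀ (by linarith) h3 2

/-- The hypothesis of the Prékopa–Leindler inequality for one step of the heat flow. -/
theorem tiltDens_mul_le_sq [NeZero m] {R : ℝ} (hR0 : 0 ≤ R) (hR : ∀ᵐ u ∂m, ‖u‖ ≤ R)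
    {v : Fin n → ℝ} (hv : ∀ i, 0 < v i) (i : Fin n) {p : ℝ} (hp0 : 0 < p) (hp1 : p < 1)
    (z : EuclideanSpace ℝ (Fin n)) :
    ∃ C > 0, ∀ ε > 0, ε ^ 2 ≤ v i / 2 → ∀ σ : ℝ, σ = p / (1 - p) * √(1 - p) * ε →
      ∀ x₁ x₂ : EuclideanSpace ℝ (Fin n),
      (max 0 (1 - C * ε ^ 3 * Real.cosh (p * v i * x₁ i)) *
          Real.exp (σ * x₁ i - (σ * x₁ i) ^ 2 / 2) *
          tiltDens p m (Function.update v i (v i - ε ^ 2)) z x₁) *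
        (max 0 (1 - C * ε ^ 3 * Real.cosh (p * v i * x₂ i)) *
          Real.exp ((-σ) * x₂ i - ((-σ) * x₂ i) ^ 2 / 2) *
          tiltDens p m (Function.update v i (v i - ε ^ 2)) z x₂) ≤
        tiltDens p m v z ((2⁻¹ : ℝ) • (x₁ + x₂)) ^ 2 := by
  obtain ⟨C, hC, H⟩ := smoothLaplace_step_le (m := m) hR0 hR hv i hp0 hp1
  have hp2 : 0 < 1 - p := by linarith
  set Q := p / (1 - p) with hQdef
  have hQ : 0 < Q := by positivity
  refine ⟨(Q + 1) * C, by positivity, fun ε hε hεT σ hσ x₁ x₂ => ?_⟩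
  set v' := Function.update v i (v i - ε ^ 2) with hv'
  have hv'0 : ∀ j, 0 < v' j := update_pos hv i (by linarith [hv i] : 0 < v i - ε ^ 2)
  set x := (2⁻¹ : ℝ) • (x₁ + x₂) with hx
  have hxi : x i = (x₁ i + x₂ i) / 2 := by rw [hx]; simp; ring
  have hst := H ε hε hεT x₁ x₂ x hx
  set β := √(1 - p) with hβ
  have hpos : ∀ {u : Fin n → ℝ} (_ : ∀ j, 0 < u j) (y), 0 < (smoothLaplace p m u y).toReal :=
    fun hu y => ENNReal.toReal_pos (smoothLaplace_ne_zero hR hp0 hu y) (smoothLaplace_ne_top hR hp0 hu y)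
  set X := (smoothLaplace p m v x).toReal with hX
  set Y₁ := (smoothLaplace p m v' x₁).toReal with hY₁
  set Y₂ := (smoothLaplace p m v' x₂).toReal with hY₂
  have hX0 : 0 < X := hpos hv x
  have hY₁0 : 0 < Y₁ := hpos hv'0 x₁
  have hY₂0 : 0 < Y₂ := hpos hv'0 x₂
  set E := p * ε ^ 2 * x i ^ 2 / 2 - β * ε * (x₁ i - x₂ i) / 2 with hE
  set r := C * ε ^ 3 * Real.cosh (p * v i * x i) with hr
  have hr0 : 0 ≤ r := by have := Real.cosh_pos (p * v i * x i); positivity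
  have hreal : X ≤ Real.exp E * (Y₁ ^ (1 / 2 : ℝ) * Y₂ ^ (1 / 2 : ℝ)) + r * X := by
    rw [← ENNReal.ofReal_toReal (smoothLaplace_ne_top hR hp0 hv x),
      ← ENNReal.ofReal_toReal (smoothLaplace_ne_top hR hp0 hv'0 x₁),
      ← ENNReal.ofReal_toReal (smoothLaplace_ne_top hR hp0 hv'0 x₂), ← hX, ← hY₁, ← hY₂,
      ENNReal.ofReal_rpow_of_pos hY₁0, ENNReal.ofReal_rpow_of_pos hY₂0,
      ← ENNReal.ofReal_mul (by positivity), ← ENNReal.ofReal_mul (by positivity),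
      ← ENNReal.ofReal_mul (by positivity), ← ENNReal.ofReal_add (by positivity) (by positivity),
      ENNReal.ofReal_le_ofReal_iff (by positivity)] at hst
    exact hst
  set Y := Real.exp E * (Y₁ ^ (1 / 2 : ℝ) * Y₂ ^ (1 / 2 : ℝ)) with hY
  have hY0 : 0 < Y := by positivity
  -- For `r < 1` the step says `(1 - r) X ≤ Y`, and Bernoulli gives the factor; for `r ≥ 1` the
  -- cutoff vanishes.
  have hρ : max 0 (1 - (Q + 1) * C * ε ^ 3 * Real.cosh (p * v i * x i)) * Y ^ (-Q) ≤ X ^ (-Q) := by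
    have er : (Q + 1) * C * ε ^ 3 * Real.cosh (p * v i * x i) = (Q + 1) * r := by rw [hr]; ring
    rw [er]
    rcases le_or_gt 1 r with h | h
    · rw [max_eq_left (by nlinarith), zero_mul]; positivity
    · have h1 : (1 - r) * X ≤ Y := by linarith
      have h1r : 0 < 1 - r := by linarith
      have h2 : Y ^ (-Q) ≤ ((1 - r) * X) ^ (-Q) :=
        Real.rpow_le_rpow_of_nonpos (by positivity) h1 (by linarith)
      have h3 : max 0 (1 - (Q + 1) * r) ≤ (1 - r) ^ Q :=
        max_le (by positivity) (one_sub_mul_le_rpow hQ hr0 h.le)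
      calc _ ≤ (1 - r) ^ Q * ((1 - r) * X) ^ (-Q) := by gcongr
        _ = X ^ (-Q) := by
          rw [Real.mul_rpow h1r.le hX0.le, ← mul_assoc, ← Real.rpow_add h1r]; simp
  have hρ2 := pow_le_pow_left₀ (by positivity) hρ 2
  have hYsq : (Y ^ (-Q)) ^ 2 = Real.exp (-2 * Q * E) * (Y₁ ^ (-Q) * Y₂ ^ (-Q)) := by
    rw [hY, Real.mul_rpow (Real.exp_pos _).le (by positivity),
      Real.mul_rpow (by positivity) (by positivity), ← Real.exp_mul, ← Real.rpow_mul hY₁0.le,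
      ← Real.rpow_mul hY₂0.le, mul_pow, mul_pow, ← Real.exp_nat_mul, ← Real.rpow_natCast (Y₁ ^ _),
      ← Real.rpow_natCast (Y₂ ^ _), ← Real.rpow_mul hY₁0.le, ← Real.rpow_mul hY₂0.le]
    congr 2
    · push_cast; ring
    · congr 1; push_cast; ring
    · congr 1; push_cast; ring
  rw [mul_pow, hYsq] at hρ2
  have hmm := max_mul_max_le_sq (C := (Q + 1) * C * ε ^ 3) (k := p * v i) (a := x₁ i) (b := x₂ i)
    (by positivity)
  rw [← hxi] at hmm
  -- The coefficient from the cosh matches the square of the one from Cauchy–Schwarz because `Q (1 -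
  -- p) = p`.
  have hσ2 : σ ^ 2 = Q * p * ε ^ 2 := by
    rw [hσ, mul_pow, mul_pow, hβ, Real.sq_sqrt hp2.le, hQdef]; field_simp
  have hexp : (σ * x₁ i - (σ * x₁ i) ^ 2 / 2) + ((-σ) * x₂ i - ((-σ) * x₂ i) ^ 2 / 2) ≤ -2 * Q * E := by
    have e1 : -2 * Q * E = σ * (x₁ i - x₂ i) - σ ^ 2 * x i ^ 2 := by
      rw [hσ2, hE, hσ]; ring
    -- Convexity of the square separates the variables `x₁` and `x₂`.
    have e2 : x i ^ 2 ≤ (x₁ i ^ 2 + x₂ i ^ 2) / 2 := by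
      rw [hxi]; nlinarith [sq_nonneg (x₁ i - x₂ i)]
    have e3 := mul_le_mul_of_nonneg_left e2 (sq_nonneg σ)
    rw [e1]; linarith
  have hexp' := Real.exp_le_exp.2 hexp
  rw [Real.exp_add] at hexp'
  have hz : Real.exp (inner ℝ z x₁) * Real.exp (inner ℝ z x₂) = Real.exp (inner ℝ z x) ^ 2 := by
    rw [← Real.exp_add, ← Real.exp_nat_mul, hx, inner_smul_right, inner_add_right]
    congr 1; push_cast; ring
  unfold tiltDens
  rw [← hX, ← hY₁, ← hY₂, ← hQdef]
  set M₁ := max 0 (1 - (Q + 1) * C * ε ^ 3 * Real.cosh (p * v i * x₁ i))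
  set M₂ := max 0 (1 - (Q + 1) * C * ε ^ 3 * Real.cosh (p * v i * x₂ i))
  set M := max 0 (1 - (Q + 1) * C * ε ^ 3 * Real.cosh (p * v i * x i))
  have hM₁ : 0 ≤ M₁ := le_max_left _ _
  have hM₂ : 0 ≤ M₂ := le_max_left _ _
  calc _ = (M₁ * M₂) * (Real.exp (σ * x₁ i - (σ * x₁ i) ^ 2 / 2) *
        Real.exp ((-σ) * x₂ i - ((-σ) * x₂ i) ^ 2 / 2)) * (Y₁ ^ (-Q) * Y₂ ^ (-Q)) *
        (Real.exp (inner ℝ z x₁) * Real.exp (inner ℝ z x₂)) := by ring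
    _ ≤ M ^ 2 * Real.exp (-2 * Q * E) * (Y₁ ^ (-Q) * Y₂ ^ (-Q)) *
        (Real.exp (inner ℝ z x₁) * Real.exp (inner ℝ z x₂)) := by gcongr
    _ ≤ (X ^ (-Q)) ^ 2 * Real.exp (inner ℝ z x) ^ 2 := by
      rw [hz]
      gcongr
      linarith
    _ = _ := by ring

/-- Multiplying the two lower bounds gives `(A - δ)² - s² ≤ B²`, and `√(B² + s²) ≤ B + s² / (2B)`.
The first order terms `±s` cancel. -/
theorem le_add_of_mul_le_sq {A B s δ P N : ℝ} (hB : 0 < B) (hP0 : 0 ≤ P)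
    (hP : A + s - δ ≤ P) (hN : A - s - δ ≤ N) (h : P * N ≤ B ^ 2) :
    A ≤ B + δ + s ^ 2 / (2 * B) := by
  by_contra hcon
  push Not at hcon
  have h0 : 0 ≤ s ^ 2 / (2 * B) := by positivity
  set L := A - δ with hL
  have hLB : B + s ^ 2 / (2 * B) < L := by linarith
  have h1 : (B + s ^ 2 / (2 * B)) ^ 2 < L ^ 2 := by
    apply pow_lt_pow_left₀ hLB (by linarith) (by norm_num)
  have h2 : B ^ 2 + s ^ 2 ≤ (B + s ^ 2 / (2 * B)) ^ 2 := by
    have e : (B + s ^ 2 / (2 * B)) ^ 2 = B ^ 2 + s ^ 2 + (s ^ 2 / (2 * B)) ^ 2 := by field_simp; ring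
    rw [e]; nlinarith [sq_nonneg (s ^ 2 / (2 * B))]
  have h3 : L ^ 2 ≤ B ^ 2 + s ^ 2 := by
    rcases le_total (|s|) L with hs | hs
    · have hs' := abs_le.1 hs
      have : (L + s) * (L - s) ≤ P * N :=
        mul_le_mul (by linarith) (by linarith) (by linarith) hP0
      nlinarith
    · have hL0 : 0 ≤ L := by linarith
      have : L ^ 2 ≤ |s| ^ 2 := pow_le_pow_left₀ hL0 hs 2
      rw [sq_abs] at this
      nlinarith
  linarith

theorem abs_apply_le_norm (x : EuclideanSpace ℝ (Fin n)) (i : Fin n) : |x i| ≤ ‖x‖ :=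
  PiLp.norm_apply_le x i

theorem abs_cube_add_cosh_le (x : EuclideanSpace ℝ (Fin n)) (i : Fin n) (k : ℝ) :
    |(|x i| ^ 3 + Real.cosh (k * x i))| ≤ 7 * Real.exp ((1 + |k|) * ‖x‖) := by
  have h1 := cube_le_exp (abs_nonneg (x i))
  have h2 : Real.cosh (k * x i) ≤ Real.exp (|k| * ‖x‖) := by
    rw [← Real.cosh_abs, abs_mul]
    have h3 : Real.cosh (|k| * |x i|) ≤ Real.cosh (|k| * ‖x‖) := by
      rw [Real.cosh_le_cosh, abs_of_nonneg (show 0 ≤ |k| * |x i| by positivity),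
        abs_of_nonneg (show 0 ≤ |k| * ‖x‖ by positivity)]
      gcongr
      exact abs_apply_le_norm x i
    refine h3.trans ?_
    rw [Real.cosh_eq]
    have : Real.exp (-(|k| * ‖x‖)) ≤ Real.exp (|k| * ‖x‖) := by
      apply Real.exp_le_exp.2; have : 0 ≤ |k| * ‖x‖ := by positivity
      linarith
    linarith
  have h3 : Real.exp (|x i|) ≤ Real.exp ((1 + |k|) * ‖x‖) := by
    apply Real.exp_le_exp.2
    have := abs_apply_le_norm x i
    have h4 : 0 ≤ |k| * ‖x‖ := by positivity
    linarith
  have h4 : Real.exp (|k| * ‖x‖) ≤ Real.exp ((1 + |k|) * ‖x‖) := by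
    apply Real.exp_le_exp.2; linarith [norm_nonneg x]
  rw [abs_of_nonneg (by have := Real.cosh_pos (k * x i); positivity)]
  linarith

/-- Prékopa–Leindler for the tilts `σ` and `-σ`: each tilted integral is the untilted one plus or
minus `σ` times the first moment, up to `O(ε³)`, and the product of the two leaves only the squared
moment at order `ε²`. -/
theorem integral_tiltDens_step [NeZero m] {R : ℝ} (hR0 : 0 ≤ R) (hR : ∀ᵐ u ∂m, ‖u‖ ≤ R)
    {v : Fin n → ℝ} (hv : ∀ i, 0 < v i) (i : Fin n) {p : ℝ} (hp0 : 0 < p) (hp1 : p < 1)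
    (z : EuclideanSpace ℝ (Fin n)) (hB : 0 < ∫ x, tiltDens p m v z x) :
    ∃ C₁ ≥ 0, ∃ C₂ ≥ 0, ∀ ε > 0, ε ^ 2 ≤ v i / 2 →
      ∫ x, tiltDens p m (Function.update v i (v i - ε ^ 2)) z x ≤
        (∫ x, tiltDens p m v z x) + C₁ * ε ^ 3 +
        C₂ * ε ^ 2 * (∫ x, x i * tiltDens p m (Function.update v i (v i - ε ^ 2)) z x) ^ 2 := by
  obtain ⟨C, hC, H⟩ := tiltDens_mul_le_sq (m := m) hR0 hR hv i hp0 hp1 z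
  obtain ⟨lo, hlo, hi, hhi, h1, h2⟩ := exists_bounds v hv
  -- The constraint `ε² ≤ v i / 2` keeps all variances above `lo / 2`, so the constants do not
  -- depend on `ε`.
  obtain ⟨K, hK, c, hc, hbd⟩ := exists_tiltDens_le (m := m) hR (half_pos hlo) hhi hp0 hp1
  have hp2 : 0 < 1 - p := by linarith
  set k := p * v i with hk
  set s₀ := p / (1 - p) * √(1 - p) with hs₀
  have hs₀0 : 0 ≤ s₀ := by positivity
  set J := ∫ x : EuclideanSpace ℝ (Fin n),
    (7 * K) * Real.exp (-c * ‖x‖ ^ 2 + (‖z‖ + (1 + |k|)) * ‖x‖) with hJ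
  have hJ0 : 0 ≤ J := integral_nonneg fun x => by positivity
  set B := ∫ x, tiltDens p m v z x with hBdef
  refine ⟨(s₀ ^ 3 + 2 * C) * J, by positivity, s₀ ^ 2 / (2 * B), by positivity,
    fun ε hε hεT => ?_⟩
  set v' := Function.update v i (v i - ε ^ 2) with hv'
  have hv'0 : ∀ j, 0 < v' j := update_pos hv i (by linarith [hv i] : 0 < v i - ε ^ 2)
  have h1' : ∀ j, lo / 2 ≤ v' j := by
    intro j
    rcases eq_or_ne j i with rfl | hj
    · rw [hv']; simp; linarith [h1 j]
    · rw [hv']; simp [hj]; linarith [h1 j]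
  have h2' : ∀ j, v' j ≤ hi := by
    intro j
    rcases eq_or_ne j i with rfl | hj
    · rw [hv']; simp; nlinarith [h2 j]
    · rw [hv']; simp [hj]; exact h2 j
  set w := tiltDens p m v' z with hw
  have hw0 : ∀ x, 0 ≤ w x := tiltDens_nonneg p v' z
  have hwm : Measurable w := measurable_tiltDens hv'0 z
  have hwK := hbd v' h1' h2' z
  set σ := s₀ * ε with hσ
  have hσ0 : 0 ≤ σ := by positivity
  have hPL := H ε hε hεT σ rfl
  set f : ℝ → EuclideanSpace ℝ (Fin n) → ℝ := fun σ x =>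
    max 0 (1 - C * ε ^ 3 * Real.cosh (k * x i)) * Real.exp (σ * x i - (σ * x i) ^ 2 / 2) * w x with hf
  have hf0 : ∀ σ x, 0 ≤ f σ x := fun σ x => by
    have := hw0 x
    have : 0 ≤ max 0 (1 - C * ε ^ 3 * Real.cosh (k * x i)) := le_max_left _ _
    rw [hf]; positivity
  have hgm : ∀ σ : ℝ, Measurable fun x : EuclideanSpace ℝ (Fin n) =>
      max 0 (1 - C * ε ^ 3 * Real.cosh (k * x i)) * Real.exp (σ * x i - (σ * x i) ^ 2 / 2) :=
    fun σ => by
      have h1 : Continuous fun x : EuclideanSpace ℝ (Fin n) =>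
        max 0 (1 - C * ε ^ 3 * Real.cosh (k * x i)) * Real.exp (σ * x i - (σ * x i) ^ 2 / 2) := by
        have := Real.continuous_cosh
        fun_prop
      exact h1.measurable
  have hexp2 : ∀ u : ℝ, Real.exp (u - u ^ 2 / 2) ≤ 2 := by
    intro u
    have h1 : u - u ^ 2 / 2 ≤ 1 / 2 := by nlinarith [sq_nonneg (u - 1)]
    refine (Real.exp_le_exp.2 h1).trans ?_
    have := Real.exp_one_lt_d9
    have h3 : Real.exp (1 / 2) ^ 2 = Real.exp 1 := by
      rw [← Real.exp_nat_mul]; norm_num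
    nlinarith [Real.exp_pos (1 / 2)]
  have hmax1 : ∀ x : EuclideanSpace ℝ (Fin n), max 0 (1 - C * ε ^ 3 * Real.cosh (k * x i)) ≤ 1 := by
    intro x
    refine max_le zero_le_one ?_
    have : 0 ≤ C * ε ^ 3 * Real.cosh (k * x i) := by
      have := Real.cosh_pos (k * x i); positivity
    linarith
  have hfi : ∀ σ, Integrable (f σ) := fun σ =>
    integrable_mul_of_le hwm (hgm σ) hw0 (N := 2) (k := 0) hc hwK fun x => by
      rw [abs_of_nonneg (mul_nonneg (le_max_left _ _) (Real.exp_pos _).le)]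
      calc _ ≤ 1 * 2 := mul_le_mul (hmax1 x) (hexp2 _) (Real.exp_pos _).le zero_le_one
        _ = _ := by simp
  have hwi : Integrable w := (tilted_smoothLaplace hR hp0 hp1 hv'0 z).1
  have hwxi : Integrable fun x => x i * w x :=
    integrable_mul_of_le hwm (by fun_prop) hw0 (N := 1) (k := 1) hc hwK fun x => by
      have h3 := abs_apply_le_norm x i
      have h4 := Real.add_one_le_exp (1 * ‖x‖)
      linarith
  have hGm : Measurable fun x : EuclideanSpace ℝ (Fin n) => |x i| ^ 3 + Real.cosh (k * x i) := by
    have h1 : Continuous fun x : EuclideanSpace ℝ (Fin n) => |x i| ^ 3 + Real.cosh (k * x i) := by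
      have := Real.continuous_cosh
      fun_prop
    exact h1.measurable
  have hGi : Integrable fun x => (|x i| ^ 3 + Real.cosh (k * x i)) * w x :=
    integrable_mul_of_le hwm hGm hw0 hc hwK fun x => abs_cube_add_cosh_le x i k
  have hGJ : ∫ x, (|x i| ^ 3 + Real.cosh (k * x i)) * w x ≤ J := by
    refine integral_mono hGi ((integrable_exp_neg_sq_add hc _).const_mul _) fun x => ?_
    dsimp only
    have hG0 : 0 ≤ |x i| ^ 3 + Real.cosh (k * x i) := by
      have := Real.cosh_pos (k * x i); positivity
    have h3 := abs_cube_add_cosh_le x i k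
    rw [abs_of_nonneg hG0] at h3
    refine (mul_le_mul h3 (hwK x) (hw0 x) (by positivity)).trans (le_of_eq ?_)
    rw [show -c * ‖x‖ ^ 2 + (‖z‖ + (1 + |k|)) * ‖x‖
      = (-c * ‖x‖ ^ 2 + ‖z‖ * ‖x‖) + (1 + |k|) * ‖x‖ by ring, Real.exp_add _ ((1 + |k|) * ‖x‖)]; ring
  have hlower : ∀ σ' : ℝ, |σ'| = σ →
      (∫ x, w x) + σ' * (∫ x, x i * w x) - (s₀ ^ 3 + 2 * C) * J * ε ^ 3 ≤ ∫ x, f σ' x := by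
    intro σ' hσ'
    have hint : Integrable fun x => w x + σ' * (x i * w x) - ((s₀ ^ 3 + 2 * C) * ε ^ 3) *
        ((|x i| ^ 3 + Real.cosh (k * x i)) * w x) :=
      (hwi.add (hwxi.const_mul σ')).sub (hGi.const_mul _)
    have hle : ∫ x, (w x + σ' * (x i * w x) - ((s₀ ^ 3 + 2 * C) * ε ^ 3) *
        ((|x i| ^ 3 + Real.cosh (k * x i)) * w x)) ≤ ∫ x, f σ' x := by
      refine integral_mono hint (hfi σ') fun x => ?_
      dsimp only
      have h3 := one_add_sub_cube_le_exp (σ' * x i)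
      have h4 := hexp2 (σ' * x i)
      set e := Real.exp (σ' * x i - (σ' * x i) ^ 2 / 2) with he
      have he0 : 0 < e := Real.exp_pos _
      have hcosh := Real.cosh_pos (k * x i)
      have h5 : |σ' * x i| ^ 3 = s₀ ^ 3 * ε ^ 3 * |x i| ^ 3 := by
        rw [abs_mul, hσ', hσ]; ring
      have h6 : (1 - C * ε ^ 3 * Real.cosh (k * x i)) * e ≤
          max 0 (1 - C * ε ^ 3 * Real.cosh (k * x i)) * e := by
        gcongr; exact le_max_right _ _
      have h7 : C * ε ^ 3 * Real.cosh (k * x i) * e ≤ C * ε ^ 3 * Real.cosh (k * x i) * 2 := by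
        gcongr
      have h8 : 0 ≤ C * ε ^ 3 * |x i| ^ 3 := by positivity
      have h9 : 0 ≤ s₀ ^ 3 * ε ^ 3 * Real.cosh (k * x i) := by positivity
      have h10 : 1 + σ' * x i - ((s₀ ^ 3 + 2 * C) * ε ^ 3) * (|x i| ^ 3 + Real.cosh (k * x i))
          ≤ max 0 (1 - C * ε ^ 3 * Real.cosh (k * x i)) * e := by
        linarith
      have h11 := mul_le_mul_of_nonneg_right h10 (hw0 x)
      rw [hf]; dsimp only
      linarith
    refine le_trans ?_ hle
    have hi1 : Integrable fun x => w x + σ' * (x i * w x) := hwi.add (hwxi.const_mul σ')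
    rw [integral_sub hi1 (hGi.const_mul _), integral_add hwi (hwxi.const_mul σ'),
      integral_const_mul, integral_const_mul]
    have := mul_le_mul_of_nonneg_left hGJ (by positivity : 0 ≤ (s₀ ^ 3 + 2 * C) * ε ^ 3)
    linarith
  have hPL2 : (∫ x, f σ x) * (∫ x, f (-σ) x) ≤ B ^ 2 := by
    have hTi := (tilted_smoothLaplace hR hp0 hp1 hv z).1
    have hm' : ∀ σ, Measurable fun x => ENNReal.ofReal (f σ x) := fun σ =>
      ENNReal.measurable_ofReal.comp ((hgm σ).mul hwm)
    have := prekopaLeindler (hm' σ) (hm' (-σ))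
      (ENNReal.measurable_ofReal.comp (measurable_tiltDens (m := m) (p := p) hv z)) (fun x₁ x₂ => by
        rw [← ENNReal.ofReal_mul (hf0 _ _)]
        simp only [Function.comp]
        rw [← ENNReal.ofReal_pow (tiltDens_nonneg _ _ _ _)]
        exact ENNReal.ofReal_le_ofReal (hPL x₁ x₂))
    simp only [Function.comp] at this
    rw [← ofReal_integral_eq_lintegral_ofReal (hfi σ) (Eventually.of_forall (hf0 σ)),
      ← ofReal_integral_eq_lintegral_ofReal (hfi (-σ)) (Eventually.of_forall (hf0 (-σ))),
      ← ofReal_integral_eq_lintegral_ofReal hTi (Eventually.of_forall (tiltDens_nonneg p v z)),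
      ← ENNReal.ofReal_mul (integral_nonneg (hf0 σ)), ← ENNReal.ofReal_pow hB.le,
      ENNReal.ofReal_le_ofReal_iff (by positivity)] at this
    exact this
  have hfin := le_add_of_mul_le_sq (A := ∫ x, w x) (s := σ * ∫ x, x i * w x)
    (δ := (s₀ ^ 3 + 2 * C) * J * ε ^ 3) hB
    (integral_nonneg (hf0 σ))
    (hlower σ (abs_of_nonneg hσ0))
    (by have := hlower (-σ) (by rw [abs_neg, abs_of_nonneg hσ0]); linarith) hPL2
  refine hfin.trans (le_of_eq ?_)
  rw [hσ]; ring

theorem integral_tiltDens_pos [NeZero m] {R : ℝ} (hR : ∀ᵐ u ∂m, ‖u‖ ≤ R)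
    {v : Fin n → ℝ} (hv : ∀ i, 0 < v i) {p : ℝ} (hp0 : 0 < p) (hp1 : p < 1)
    (z : EuclideanSpace ℝ (Fin n)) : 0 < ∫ x, tiltDens p m v z x := by
  refine (integral_pos_iff_support_of_nonneg (tiltDens_nonneg p v z)
    (tilted_smoothLaplace hR hp0 hp1 hv z).1).2 ?_
  have : Function.support (tiltDens p m v z) = Set.univ := by
    ext x
    simp only [Function.mem_support, Set.mem_univ, iff_true]
    unfold tiltDens
    have := ENNReal.toReal_pos (smoothLaplace_ne_zero hR hp0 hv x) (smoothLaplace_ne_top hR hp0 hv x)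
    positivity
  rw [this]
  exact isOpen_univ.measure_pos volume Set.univ_nonempty

/-! ### First order condition, Dini inequality and semicontinuity in the variance. -/

/-- First order condition at a minimizer of the tilted integral. -/
theorem integral_mul_tiltDens_eq_zero [NeZero m] {R : ℝ} (hR : ∀ᵐ u ∂m, ‖u‖ ≤ R)
    {v : Fin n → ℝ} (hv : ∀ i, 0 < v i) (i : Fin n) {p : ℝ} (hp0 : 0 < p) (hp1 : p < 1)
    {z : EuclideanSpace ℝ (Fin n)}
    (hz : ∀ z', ∫ x, tiltDens p m v z x ≤ ∫ x, tiltDens p m v z' x) :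
    ∫ x, x i * tiltDens p m v z x = 0 := by
  obtain ⟨lo, hlo, hi, hhi, h1, h2⟩ := exists_bounds v hv
  obtain ⟨K, hK, c, hc, hbd⟩ := exists_tiltDens_le (m := m) hR hlo hhi hp0 hp1
  set w := tiltDens p m v z with hw
  have hw0 : ∀ x, 0 ≤ w x := tiltDens_nonneg p v z
  have hwm : Measurable w := measurable_tiltDens hv z
  have hwK := hbd v h1 h2 z
  have hder := hasDerivAt_integral_of_dominated_loc_of_deriv_le (μ := volume) (𝕜 := ℝ) (x₀ := (0:ℝ))
    (s := Metric.ball 0 1) (F := fun τ x => w x * Real.exp (τ * x i))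
    (F' := fun τ x => w x * (Real.exp (τ * x i) * x i))
    (bound := fun x => Real.exp (2 * ‖x‖) * w x) (Metric.ball_mem_nhds _ one_pos)
    (Eventually.of_forall fun τ => (hwm.mul (by fun_prop)).aestronglyMeasurable)
    (by simpa using (tilted_smoothLaplace hR hp0 hp1 hv z).1)
    (hwm.mul (by fun_prop)).aestronglyMeasurable
    (Eventually.of_forall fun x τ hτ => by
      have hτ1 : |τ| ≤ 1 := by simpa using (Metric.mem_ball.1 hτ).le
      rw [norm_mul, norm_mul, Real.norm_of_nonneg (hw0 x), Real.norm_of_nonneg (Real.exp_pos _).le,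
        mul_comm]
      gcongr
      · exact hw0 x
      rw [two_mul, Real.exp_add]
      have h3 := abs_apply_le_norm x i
      have h4 : Real.exp (τ * x i) ≤ Real.exp ‖x‖ := by
        apply Real.exp_le_exp.2
        calc τ * x i ≤ |τ * x i| := le_abs_self _
          _ = |τ| * |x i| := abs_mul _ _
          _ ≤ 1 * ‖x‖ := by gcongr
          _ = _ := one_mul _
      have h5 : ‖x i‖ ≤ Real.exp ‖x‖ := by
        rw [Real.norm_eq_abs]; linarith [Real.add_one_le_exp ‖x‖]
      gcongr)
    (integrable_mul_of_le hwm (by fun_prop) hw0 (N := 1) (k := 2) hc hwK fun x => by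
      rw [abs_of_pos (Real.exp_pos _), one_mul])
    (Eventually.of_forall fun x τ _ => by
      have := ((hasDerivAt_id τ).mul_const (x i)).exp.const_mul (w x)
      simpa using this)
  have hF : ∀ τ : ℝ, (∫ x, w x * Real.exp (τ * x i))
      = ∫ x, tiltDens p m v (z + EuclideanSpace.single i τ) x := by
    intro τ
    refine integral_congr_ae (Eventually.of_forall fun x => ?_)
    dsimp only
    rw [hw]
    unfold tiltDens
    rw [inner_add_left, EuclideanSpace.inner_single_left, Real.exp_add]
    simp [mul_assoc]
  have hmin : IsLocalMin (fun τ : ℝ => ∫ x, w x * Real.exp (τ * x i)) 0 := by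
    refine Eventually.of_forall fun τ => ?_
    dsimp only
    have e0 : z + EuclideanSpace.single i (0 : ℝ) = z := by
      ext j; rcases eq_or_ne j i with rfl | hj <;> simp [*]
    rw [hF, hF, e0]; exact hz _
  have := hmin.hasDerivAt_eq_zero hder.2
  rw [← this]
  refine integral_congr_ae (Eventually.of_forall fun x => ?_)
  simp [mul_comm]

/-- The step involves the first moment at the lowered variance, while the first order condition
concerns `v` itself. Continuity bridges the two. -/
theorem tendsto_integral_mul_tiltDens [NeZero m] {R : ℝ} (hR : ∀ᵐ u ∂m, ‖u‖ ≤ R)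
    {v : Fin n → ℝ} (hv : ∀ i, 0 < v i) (i : Fin n) {p : ℝ} (hp0 : 0 < p) (hp1 : p < 1)
    (z : EuclideanSpace ℝ (Fin n)) :
    Tendsto (fun t => ∫ x, x i * tiltDens p m (Function.update v i t) z x) (𝓝 (v i))
      (𝓝 (∫ x, x i * tiltDens p m v z x)) := by
  obtain ⟨lo, hlo, hi, hhi, h1, h2⟩ := exists_bounds v hv
  obtain ⟨K, hK, c, hc, hbd⟩ := exists_tiltDens_le (m := m) hR (half_pos hlo)
    (by linarith : 0 < hi + 1) hp0 hp1
  have hev1 : ∀ᶠ t in 𝓝 (v i), ∀ j, lo / 2 ≤ Function.update v i t j := by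
    filter_upwards [lt_mem_nhds (show lo / 2 < v i by linarith [h1 i])] with t ht j
    rcases eq_or_ne j i with rfl | hj
    · simpa using ht.le
    · simp [hj]; linarith [h1 j]
  have hev2 : ∀ᶠ t in 𝓝 (v i), ∀ j, Function.update v i t j ≤ hi + 1 := by
    filter_upwards [gt_mem_nhds (show v i < hi + 1 by linarith [h2 i])] with t ht j
    rcases eq_or_ne j i with rfl | hj
    · simpa using ht.le
    · simp [hj]; linarith [h2 j]
  have hlim : Tendsto (fun t => Function.update v i t) (𝓝 (v i)) (𝓝 v) := by
    have : Continuous fun t => Function.update v i t := by fun_prop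
    have := this.tendsto (v i)
    rwa [Function.update_eq_self] at this
  refine tendsto_integral_filter_of_dominated_convergence
    (fun x => K * Real.exp (-c * ‖x‖ ^ 2 + (‖z‖ + 1) * ‖x‖)) ?_ ?_
    ((integrable_exp_neg_sq_add hc _).const_mul _) ?_
  · filter_upwards [hev1] with t ht
    exact ((by fun_prop : Measurable fun x : EuclideanSpace ℝ (Fin n) => x i).mul
      (measurable_tiltDens (fun j => (half_pos hlo).trans_le (ht j)) z)).aestronglyMeasurable
  · filter_upwards [hev1, hev2] with t ht1 ht2
    refine Eventually.of_forall fun x => ?_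
    rw [norm_mul, Real.norm_of_nonneg (tiltDens_nonneg _ _ _ _)]
    have h3 : ‖x i‖ ≤ Real.exp ‖x‖ := by
      have := abs_apply_le_norm x i
      rw [Real.norm_eq_abs]; linarith [Real.add_one_le_exp ‖x‖]
    refine (mul_le_mul h3 (hbd _ ht1 ht2 z x) (tiltDens_nonneg _ _ _ _) (Real.exp_pos _).le).trans
      (le_of_eq ?_)
    rw [add_mul, ← add_assoc, one_mul, Real.exp_add _ ‖x‖]; ring
  · refine Eventually.of_forall fun x => ?_
    refine Tendsto.const_mul _ ?_
    unfold tiltDens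
    refine Tendsto.mul_const _ ?_
    have h3 := tendsto_smoothLaplace hR hp0 (half_pos hlo) (by linarith : 0 < hi + 1) hev1 hev2 hlim x
    have h4 := (ENNReal.tendsto_toReal (smoothLaplace_ne_top hR hp0 hv x)).comp h3
    refine (Real.continuousAt_rpow_const _ _ (Or.inl ?_)).tendsto.comp h4
    exact (ENNReal.toReal_pos (smoothLaplace_ne_zero hR hp0 hv x) (smoothLaplace_ne_top hR hp0 hv x)).ne'

theorem minTilted_smoothLaplace_ne_top [NeZero m] {R : ℝ} (hR : ∀ᵐ u ∂m, ‖u‖ ≤ R)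
    {v : Fin n → ℝ} (hv : ∀ i, 0 < v i) {p : ℝ} (hp0 : 0 < p) (hp1 : p < 1) :
    minTilted (p / (1 - p)) (smoothLaplace p m v) ≠ ⊤ := by
  refine ne_top_of_le_ne_top ?_ (iInf_le _ 0)
  rw [(tilted_smoothLaplace hR hp0 hp1 hv 0).2]
  exact ENNReal.ofReal_ne_top

/-- The minimizer `z` at the larger variance is a competitor at the smaller one. Its first moment
tends to 0 as `s` tends to `v i`, so the squared moment in the step makes only an `o(ε²)`
contribution. -/
theorem minTilted_left_dini [NeZero m] {R : ℝ} (hR0 : 0 ≤ R) (hR : ∀ᵐ u ∂m, ‖u‖ ≤ R)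
    {v : Fin n → ℝ} (hv : ∀ i, 0 < v i) (i : Fin n) {p : ℝ} (hp0 : 0 < p) (hp1 : p < 1)
    {e : ℝ} (he : 0 < e) :
    ∀ᶠ s in 𝓝[<] (v i),
      (minTilted (p / (1 - p)) (smoothLaplace p m (Function.update v i s))).toReal ≤
        (minTilted (p / (1 - p)) (smoothLaplace p m v)).toReal + e * (v i - s) := by
  have hQ : 0 < p / (1 - p) := div_pos hp0 (by linarith)
  obtain ⟨lo, hlo, hi, hhi, h1, h2⟩ := exists_bounds v hv
  obtain ⟨C, hC, hCb⟩ := exists_smoothLaplace_le (m := m) hR hlo hhi hp0 1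
  obtain ⟨z, hz⟩ := exists_tilted_eq_minTilted hQ (measurable_smoothLaplace hv) hC
    (hCb v h1 h2) (minTilted_smoothLaplace_ne_top hR hv hp0 hp1)
  have hBpos := integral_tiltDens_pos hR hv hp0 hp1 z
  have hk : (minTilted (p / (1 - p)) (smoothLaplace p m v)).toReal = ∫ x, tiltDens p m v z x := by
    rw [← hz, (tilted_smoothLaplace hR hp0 hp1 hv z).2, ENNReal.toReal_ofReal hBpos.le]
  have hzmin : ∀ z', ∫ x, tiltDens p m v z x ≤ ∫ x, tiltDens p m v z' x := by
    intro z'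
    have : tilted (p / (1 - p)) (smoothLaplace p m v) z ≤ tilted (p / (1 - p)) (smoothLaplace p m v) z' :=
      hz.le.trans (iInf_le _ _)
    rw [(tilted_smoothLaplace hR hp0 hp1 hv z).2, (tilted_smoothLaplace hR hp0 hp1 hv z').2] at this
    exact (ENNReal.ofReal_le_ofReal_iff (integral_tiltDens_pos hR hv hp0 hp1 z').le).1 this
  obtain ⟨C₁, hC₁, C₂, hC₂, H⟩ := integral_tiltDens_step hR0 hR hv i hp0 hp1 z hBpos
  have hlim := tendsto_integral_mul_tiltDens hR hv i hp0 hp1 z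
  rw [integral_mul_tiltDens_eq_zero hR hv i hp0 hp1 hzmin] at hlim
  have hlim2 : Tendsto (fun s => C₁ * √(v i - s) +
      C₂ * (∫ x, x i * tiltDens p m (Function.update v i s) z x) ^ 2) (𝓝[<] (v i)) (𝓝 0) := by
    have h3 : Tendsto (fun s => C₁ * √(v i - s)) (𝓝 (v i)) (𝓝 0) := by
      have : Continuous fun s => C₁ * √(v i - s) := by fun_prop
      have := this.tendsto (v i)
      simpa using this
    have h4 := (hlim.pow 2).const_mul C₂
    have := (h3.add h4).mono_left (nhdsWithin_le_nhds (s := Set.Iio (v i)))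
    simpa using this
  filter_upwards [hlim2.eventually (gt_mem_nhds he), self_mem_nhdsWithin,
    nhdsWithin_le_nhds (lt_mem_nhds (show v i / 2 < v i by linarith [hv i]))] with s hs hs1 hs2
  have hs1' : 0 < v i - s := sub_pos.2 hs1
  have hsq : √(v i - s) ^ 2 = v i - s := Real.sq_sqrt hs1'.le
  -- The step is taken with `ε² = v i - s`, so an error `o(ε²)` is `o(v i - s)`.
  have h5 := H (√(v i - s)) (Real.sqrt_pos.2 hs1') (by rw [hsq]; linarith)
  rw [hsq, sub_sub_cancel] at h5
  have hv' := update_pos hv i (by linarith [hv i] : 0 < s)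
  have h6 : (minTilted (p / (1 - p)) (smoothLaplace p m (Function.update v i s))).toReal ≤
      ∫ x, tiltDens p m (Function.update v i s) z x := by
    have h7 := integral_tiltDens_pos hR hv' hp0 hp1 z
    refine ENNReal.toReal_le_of_le_ofReal h7.le ?_
    rw [← (tilted_smoothLaplace hR hp0 hp1 hv' z).2]
    exact iInf_le _ _
  rw [hk]
  refine h6.trans (h5.trans ?_)
  have h8 : √(v i - s) ^ 3 = √(v i - s) * (v i - s) := by rw [pow_succ, hsq, mul_comm]
  rw [h8]
  have := mul_le_mul_of_nonneg_right hs.le hs1'.le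
  linarith

/-- If it failed, minimizing tilts along a sequence of variances would have values at most `c`, and
the direct method would produce a tilt with value at most `c` at `v`. The argument is two-sided;
only the right side is used. -/
theorem minTilted_right_lsc [NeZero m] {R : ℝ} (hR : ∀ᵐ u ∂m, ‖u‖ ≤ R)
    {v : Fin n → ℝ} (hv : ∀ i, 0 < v i) (i : Fin n) {p : ℝ} (hp0 : 0 < p) (hp1 : p < 1)
    {c : ℝ} (hc : c < (minTilted (p / (1 - p)) (smoothLaplace p m v)).toReal) :
    ∀ᶠ s in 𝓝 (v i),
      c < (minTilted (p / (1 - p)) (smoothLaplace p m (Function.update v i s))).toReal := by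
  have hQ : 0 < p / (1 - p) := div_pos hp0 (by linarith)
  by_contra hcon
  obtain ⟨lo, hlo, hi, hhi, h1, h2⟩ := exists_bounds v hv
  have hfreq : ∃ᶠ s in 𝓝 (v i), (minTilted (p / (1 - p))
      (smoothLaplace p m (Function.update v i s))).toReal ≤ c := by
    rw [Filter.not_eventually] at hcon
    exact hcon.mono fun s hs => not_lt.1 hs
  have hev : ∀ᶠ s in 𝓝 (v i), lo / 2 < s ∧ s < hi + 1 :=
    (lt_mem_nhds (by linarith [h1 i])).and (gt_mem_nhds (by linarith [h2 i]))
  obtain ⟨s, hslim, hs⟩ := exists_seq_forall_of_frequently (hfreq.and_eventually hev)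
  have hb1 : ∀ k j, lo / 2 ≤ Function.update v i (s k) j := by
    intro k j
    rcases eq_or_ne j i with rfl | hj
    · simpa using (hs k).2.1.le
    · simp [hj]; linarith [h1 j]
  have hb2 : ∀ k j, Function.update v i (s k) j ≤ hi + 1 := by
    intro k j
    rcases eq_or_ne j i with rfl | hj
    · simpa using (hs k).2.2.le
    · simp [hj]; linarith [h2 j]
  have hpos : ∀ k j, 0 < Function.update v i (s k) j := fun k j => (half_pos hlo).trans_le (hb1 k j)
  obtain ⟨C, hC, hCb⟩ := exists_smoothLaplace_le (m := m) hR (half_pos hlo)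
    (by linarith : 0 < hi + 1) hp0 1
  have hz : ∀ k, ∃ z, tilted (p / (1 - p)) (smoothLaplace p m (Function.update v i (s k))) z
      ≤ ENNReal.ofReal c := by
    intro k
    obtain ⟨z, hz⟩ := exists_tilted_eq_minTilted hQ (measurable_smoothLaplace (m := m) (hpos k)) hC
      (hCb _ (hb1 k) (hb2 k)) (minTilted_smoothLaplace_ne_top hR (hpos k) hp0 hp1)
    refine ⟨z, ?_⟩
    rw [hz, ← ENNReal.ofReal_toReal (minTilted_smoothLaplace_ne_top hR (hpos k) hp0 hp1)]
    exact ENNReal.ofReal_le_ofReal (hs k).1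
  choose z hz using hz
  have hvlim : Tendsto (fun k => Function.update v i (s k)) atTop (𝓝 v) := by
    have : Continuous fun t => Function.update v i t := by fun_prop
    have := (this.tendsto (v i)).comp hslim
    rwa [Function.update_eq_self] at this
  obtain ⟨w, hw⟩ := exists_tilted_le_of_tendsto hQ
    (X := fun k => smoothLaplace p m (Function.update v i (s k))) (Y := smoothLaplace p m v)
    (fun k => measurable_smoothLaplace (hpos k))
    (fun x => (tendsto_smoothLaplace hR hp0 (half_pos hlo) (by linarith : 0 < hi + 1)
      (Eventually.of_forall hb1) (Eventually.of_forall hb2) hvlim x).limsup_eq.le)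
    hC (fun k => hCb _ (hb1 k) (hb2 k)) ENNReal.ofReal_ne_top tendsto_const_nhds hz
  have h3 : minTilted (p / (1 - p)) (smoothLaplace p m v) ≤ ENNReal.ofReal c := (iInf_le _ w).trans hw
  have hc0 : 0 ≤ c := (ENNReal.toReal_nonneg).trans (hs 0).1
  have := ENNReal.toReal_le_of_le_ofReal hc0 h3
  linarith

theorem minTilted_update_mono [NeZero m] {R : ℝ} (hR0 : 0 ≤ R) (hR : ∀ᵐ u ∂m, ‖u‖ ≤ R)
    {v : Fin n → ℝ} (hv : ∀ i, 0 < v i) (i : Fin n) {p : ℝ} (hp0 : 0 < p) (hp1 : p < 1)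
    {t : ℝ} (ht : v i ≤ t) :
    minTilted (p / (1 - p)) (smoothLaplace p m v) ≤
      minTilted (p / (1 - p)) (smoothLaplace p m (Function.update v i t)) := by
  have hupd : ∀ r : ℝ, v i ≤ r → ∀ j, 0 < Function.update v i r j :=
    fun r hr => update_pos hv i ((hv i).trans_le hr)
  have key := le_of_left_dini_of_right_lsc
    (k := fun r => (minTilted (p / (1 - p)) (smoothLaplace p m (Function.update v i r))).toReal) ht
    (fun r hr e he => by
      have := minTilted_left_dini (m := m) hR0 hR (hupd r hr.1.le) i hp0 hp1 he
      simpa using this)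
    (fun r hr c hc => by
      have := minTilted_right_lsc (m := m) hR (hupd r hr.1) i hp0 hp1 hc
      simp only [Function.update_self, Function.update_idem] at this
      exact nhdsWithin_le_nhds this)
  simp only [Function.update_eq_self] at key
  exact (ENNReal.toReal_le_toReal (minTilted_smoothLaplace_ne_top hR hv hp0 hp1)
    (minTilted_smoothLaplace_ne_top hR (hupd t ht) hp0 hp1)).1 key

/-- The isotropic kernel is a product, so the variances can be raised from `s` to `t` one coordinate
at a time; this is why diagonal covariances are needed. -/
theorem minTilted_smoothLaplace_mono [NeZero m] {R : ℝ} (hR0 : 0 ≤ R) (hR : ∀ᵐ u ∂m, ‖u‖ ≤ R)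
    {p : ℝ} (hp0 : 0 < p) (hp1 : p < 1) {s t : ℝ} (hs : 0 < s) (hst : s ≤ t) :
    minTilted (p / (1 - p)) (smoothLaplace p m fun _ : Fin n => s) ≤
      minTilted (p / (1 - p)) (smoothLaplace p m fun _ : Fin n => t) := by
  have key : ∀ S : Finset (Fin n), minTilted (p / (1 - p)) (smoothLaplace p m fun _ : Fin n => s) ≤
      minTilted (p / (1 - p)) (smoothLaplace p m fun j : Fin n => if j ∈ S then t else s) := by
    intro S
    induction S using Finset.induction_on with
    | empty => simp
    | insert a S ha ih =>
      refine ih.trans ?_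
      have := minTilted_update_mono (m := m) hR0 hR (v := fun j : Fin n => if j ∈ S then t else s)
        (fun j => by split_ifs <;> linarith) a hp0 hp1 (t := t) (by simp [ha, hst])
      refine this.trans (le_of_eq ?_)
      congr 2
      ext j
      rcases eq_or_ne j a with rfl | hj
      · simp
      · simp [hj]
  simpa using key Finset.univ

end

/-! ### The heat flow -/

theorem prodKer_const {t : ℝ} (ht : 0 < t) (w : EuclideanSpace ℝ (Fin n)) :
    prodKer (fun _ => t) w
      = Real.exp (-‖w‖ ^ 2 / (2 * t)) / (2 * Real.pi * t) ^ ((n : ℝ) / 2) := by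
  unfold prodKer gaussKer
  rw [Finset.prod_div_distrib, prod_exp_eq, Finset.prod_const, Finset.card_univ, Fintype.card_fin,
    Real.sqrt_eq_rpow, ← Real.rpow_natCast _ n, ← Real.rpow_mul (by positivity)]
  congr 2
  ring

theorem heatFlow_zero (f : EuclideanSpace ℝ (Fin n) → ℝ≥0∞) : heatFlow f 0 = f := by
  ext x; simp [heatFlow]

theorem heatFlow_of_pos (f : EuclideanSpace ℝ (Fin n) → ℝ≥0∞) {t : ℝ} (ht : 0 < t)
    (x : EuclideanSpace ℝ (Fin n)) :
    heatFlow f t x = ∫⁻ y, f y * ENNReal.ofReal (prodKer (fun _ => t) (x - y)) := by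
  unfold heatFlow
  rw [if_neg ht.ne']
  simp_rw [prodKer_const ht]

theorem measurable_prodKer_sub (v : Fin n → ℝ) :
    Measurable fun q : EuclideanSpace ℝ (Fin n) × EuclideanSpace ℝ (Fin n) =>
      ENNReal.ofReal (prodKer v (q.1 - q.2)) :=
  (((continuous_prodKer v).comp (continuous_fst.sub continuous_snd)).measurable).ennreal_ofReal

theorem measurable_prodKer_const_sub (v : Fin n → ℝ) (x : EuclideanSpace ℝ (Fin n)) :
    Measurable fun y : EuclideanSpace ℝ (Fin n) => ENNReal.ofReal (prodKer v (x - y)) :=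
  (((continuous_prodKer v).comp (continuous_const.sub continuous_id)).measurable).ennreal_ofReal

theorem measurable_prodKer_sub_const (v : Fin n → ℝ) (y : EuclideanSpace ℝ (Fin n)) :
    Measurable fun x : EuclideanSpace ℝ (Fin n) => ENNReal.ofReal (prodKer v (x - y)) :=
  (((continuous_prodKer v).comp (continuous_id.sub continuous_const)).measurable).ennreal_ofReal

theorem measurable_heatFlow {f : EuclideanSpace ℝ (Fin n) → ℝ≥0∞} (hf : Measurable f) {t : ℝ}
    (ht : 0 ≤ t) : Measurable (heatFlow f t) := by
  rcases ht.eq_or_lt with rfl | ht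
  · rwa [heatFlow_zero]
  · rw [funext (heatFlow_of_pos f ht)]
    exact Measurable.lintegral_prod_right' (f := fun q : EuclideanSpace ℝ (Fin n) ×
      EuclideanSpace ℝ (Fin n) => f q.2 * ENNReal.ofReal (prodKer (fun _ => t) (q.1 - q.2)))
      ((hf.comp measurable_snd).mul (measurable_prodKer_sub _))

theorem heatFlow_mono {f g : EuclideanSpace ℝ (Fin n) → ℝ≥0∞} (h : ∀ x, f x ≤ g x) {t : ℝ}
    (ht : 0 ≤ t) (x : EuclideanSpace ℝ (Fin n)) : heatFlow f t x ≤ heatFlow g t x := by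
  rcases ht.eq_or_lt with rfl | ht
  · simpa [heatFlow_zero] using h x
  · rw [heatFlow_of_pos f ht, heatFlow_of_pos g ht]
    exact lintegral_mono fun y => mul_le_mul_left (h y) _

theorem heatFlow_iSup {f : ℕ → EuclideanSpace ℝ (Fin n) → ℝ≥0∞} (hf : ∀ k, Measurable (f k))
    (hmono : Monotone f) {t : ℝ} (ht : 0 ≤ t) (x : EuclideanSpace ℝ (Fin n)) :
    heatFlow (fun y => ⨆ k, f k y) t x = ⨆ k, heatFlow (f k) t x := by
  rcases ht.eq_or_lt with rfl | ht
  · simp [heatFlow_zero]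
  · simp_rw [heatFlow_of_pos _ ht, ENNReal.iSup_mul]
    rw [lintegral_iSup]
    · intro k
      exact (hf k).mul (measurable_prodKer_const_sub _ x)
    · intro k l hkl y
      exact mul_le_mul_left (hmono hkl y) _

theorem lintegral_prodKer {t : ℝ} (ht : 0 < t) :
    ∫⁻ w : EuclideanSpace ℝ (Fin n), ENNReal.ofReal (prodKer (fun _ => t) w) = 1 := by
  have h1 := GaussianFourier.integral_rexp_neg_mul_sq_norm (V := EuclideanSpace ℝ (Fin n))
    (b := 1 / (2 * t)) (by positivity)
  have e : ∀ w : EuclideanSpace ℝ (Fin n), prodKer (fun _ => t) w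
      = Real.exp (-(1 / (2 * t)) * ‖w‖ ^ 2) / (2 * Real.pi * t) ^ ((n : ℝ) / 2) := by
    intro w
    rw [prodKer_const ht]
    congr 2
    ring
  have h2 : Integrable fun w : EuclideanSpace ℝ (Fin n) => prodKer (fun _ => t) w := by
    simp_rw [e]
    have := integrable_exp_neg_sq_add (n := n) (c := 1 / (2 * t)) (by positivity) 0
    simp only [zero_mul, add_zero] at this
    exact this.div_const _
  rw [← ofReal_integral_eq_lintegral_ofReal h2
    (Eventually.of_forall fun w => (prodKer_pos (fun _ => ht) w).le)]
  simp_rw [e]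
  rw [integral_div, h1, finrank_euclideanSpace_fin, show Real.pi / (1 / (2 * t)) = 2 * Real.pi * t by
    field_simp, div_self (by positivity), ENNReal.ofReal_one]

theorem lintegral_heatFlow {f : EuclideanSpace ℝ (Fin n) → ℝ≥0∞} (hf : Measurable f) {t : ℝ}
    (ht : 0 ≤ t) : ∫⁻ x, heatFlow f t x = ∫⁻ x, f x := by
  rcases ht.eq_or_lt with rfl | ht
  · rw [heatFlow_zero]
  · simp_rw [heatFlow_of_pos f ht]
    rw [lintegral_lintegral_swap]
    · refine lintegral_congr fun y => ?_
      have hm : Measurable fun x : EuclideanSpace ℝ (Fin n) =>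
          ENNReal.ofReal (prodKer (fun _ => t) (x - y)) :=
        measurable_prodKer_sub_const _ y
      rw [lintegral_const_mul _ hm, lintegral_sub_right_eq_self
        (fun w => ENNReal.ofReal (prodKer (fun _ => t) w)), lintegral_prodKer ht, mul_one]
    · exact ((hf.comp measurable_snd).mul (measurable_prodKer_sub _)).aemeasurable

theorem heatFlow_eq_smooth {f : EuclideanSpace ℝ (Fin n) → ℝ≥0∞} (hf : Measurable f)
    [IsFiniteMeasure (volume.withDensity f)] {t : ℝ} (ht : 0 < t) (x : EuclideanSpace ℝ (Fin n)) :
    heatFlow f t x = ENNReal.ofReal (smooth (volume.withDensity f) (fun _ => t) x) := by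
  have hm : Measurable fun y : EuclideanSpace ℝ (Fin n) =>
      ENNReal.ofReal (prodKer (fun _ => t) (x - y)) :=
    measurable_prodKer_const_sub _ x
  unfold smooth
  rw [heatFlow_of_pos f ht, ofReal_integral_eq_lintegral_ofReal (integrable_prodKer (fun _ => ht) x)
    (Eventually.of_forall fun u => (prodKer_pos (fun _ => ht) _).le),
    lintegral_withDensity_eq_lintegral_mul _ hf hm]
  rfl

theorem prodKer_mul_exp_inner {t : ℝ} (ht : 0 < t) (x w : EuclideanSpace ℝ (Fin n)) :
    prodKer (fun _ => t) w * Real.exp (inner ℝ x w)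
      = Real.exp (t * ‖x‖ ^ 2 / 2) * prodKer (fun _ => t) (w - t • x) := by
  rw [prodKer_const ht, prodKer_const ht, div_mul_eq_mul_div, mul_div_assoc', ← Real.exp_add,
    ← Real.exp_add, @norm_sub_sq_real, inner_smul_right, norm_smul, Real.norm_of_nonneg ht.le,
    real_inner_comm]
  congr 2
  field_simp
  ring

theorem lintegral_prodKer_mul_exp {t : ℝ} (ht : 0 < t) (x y : EuclideanSpace ℝ (Fin n)) :
    ∫⁻ u, ENNReal.ofReal (prodKer (fun _ => t) (u - y)) * ENNReal.ofReal (Real.exp (inner ℝ x u))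
      = ENNReal.ofReal (Real.exp (t * ‖x‖ ^ 2 / 2)) * ENNReal.ofReal (Real.exp (inner ℝ x y)) := by
  have e : ∀ u, ENNReal.ofReal (prodKer (fun _ => t) (u - y)) *
      ENNReal.ofReal (Real.exp (inner ℝ x u))
      = (ENNReal.ofReal (Real.exp (t * ‖x‖ ^ 2 / 2)) * ENNReal.ofReal (Real.exp (inner ℝ x y))) *
        ENNReal.ofReal (prodKer (fun _ => t) (u - (y + t • x))) := by
    intro u
    rw [← ENNReal.ofReal_mul (prodKer_pos (fun _ => ht) _).le, ← ENNReal.ofReal_mul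
      (Real.exp_pos _).le, ← ENNReal.ofReal_mul (by positivity)]
    congr 1
    have := prodKer_mul_exp_inner ht x (u - y)
    rw [← sub_sub, mul_right_comm, ← this, mul_assoc, ← Real.exp_add, inner_sub_right,
      sub_add_cancel]
  simp_rw [e]
  rw [lintegral_const_mul' _ _ (ENNReal.mul_ne_top ENNReal.ofReal_ne_top ENNReal.ofReal_ne_top),
    lintegral_sub_right_eq_self (fun w => ENNReal.ofReal (prodKer (fun _ => t) w)),
    lintegral_prodKer ht, mul_one]

/-- Jensen for the heat kernel, a probability density, in the form of Hölder's inequality against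
the constant 1. -/
theorem heatFlow_rpow_le {f : EuclideanSpace ℝ (Fin n) → ℝ≥0∞} (hf : Measurable f) {t : ℝ}
    (ht : 0 < t) {r : ℝ} (hr : 1 < r) (x : EuclideanSpace ℝ (Fin n)) :
    heatFlow f t x ^ r ≤ heatFlow (fun y => f y ^ r) t x := by
  have hm : Measurable fun y : EuclideanSpace ℝ (Fin n) =>
      ENNReal.ofReal (prodKer (fun _ => t) (x - y)) :=
    measurable_prodKer_const_sub _ x
  set μ := (volume : Measure (EuclideanSpace ℝ (Fin n))).withDensity
    fun y => ENNReal.ofReal (prodKer (fun _ => t) (x - y)) with hμ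
  have hmass : μ Set.univ = 1 := by
    rw [hμ, withDensity_apply _ MeasurableSet.univ, Measure.restrict_univ,
      lintegral_sub_left_eq_self (fun w => ENNReal.ofReal (prodKer (fun _ => t) w)),
      lintegral_prodKer ht]
  have e : ∀ g : EuclideanSpace ℝ (Fin n) → ℝ≥0∞, Measurable g →
      heatFlow g t x = ∫⁻ y, g y ∂μ := by
    intro g hg
    rw [heatFlow_of_pos g ht, hμ, lintegral_withDensity_eq_lintegral_mul _ hm hg]
    exact lintegral_congr fun y => mul_comm _ _
  rw [e f hf, e _ (hf.pow_const r)]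
  have := ENNReal.lintegral_mul_le_Lp_mul_Lq μ (Real.HolderConjugate.conjExponent hr) hf.aemeasurable
    (aemeasurable_const (b := (1 : ℝ≥0∞)))
  simp only [Pi.mul_apply, mul_one, ENNReal.one_rpow, lintegral_const, hmass] at this
  calc (∫⁻ y, f y ∂μ) ^ r ≤ ((∫⁻ y, f y ^ r ∂μ) ^ (1 / r)) ^ r :=
        ENNReal.rpow_le_rpow this (by linarith)
    _ = ∫⁻ y, f y ^ r ∂μ := by
        rw [← ENNReal.rpow_mul, one_div_mul_cancel (by linarith), ENNReal.rpow_one]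

/-- Jensen moves the power inside the heat flow, and the Laplace transform of a Gaussian convolution
is a product. The factor tends to 1 as `t` tends to 0, which is the limsup bound needed at time
zero. -/
theorem laplaceRoot_heatFlow_le {f : EuclideanSpace ℝ (Fin n) → ℝ≥0∞} (hf : Measurable f) {t : ℝ}
    (ht : 0 < t) {p : ℝ} (hp0 : 0 < p) (hp1 : p < 1) (x : EuclideanSpace ℝ (Fin n)) :
    laplaceRoot p (heatFlow f t) x
      ≤ ENNReal.ofReal (Real.exp (t * ‖x‖ ^ 2 / 2)) * laplaceRoot p f x := by
  have hr : 1 < 1 / p := by rw [lt_div_iff₀ hp0]; linarith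
  have hE : Measurable fun u : EuclideanSpace ℝ (Fin n) =>
      ENNReal.ofReal (Real.exp (inner ℝ x u)) :=
    (Real.measurable_exp.comp (measurable_const.inner measurable_id)).ennreal_ofReal
  have hfr : Measurable fun y => f y ^ (1 / p) := hf.pow_const _
  unfold laplaceRoot laplace
  calc ∫⁻ u, heatFlow f t u ^ (1 / p) * ENNReal.ofReal (Real.exp (inner ℝ x u))
      ≤ ∫⁻ u, heatFlow (fun y => f y ^ (1 / p)) t u * ENNReal.ofReal (Real.exp (inner ℝ x u)) :=
        lintegral_mono fun u => mul_le_mul_left (heatFlow_rpow_le hf ht hr u) _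
    _ = ∫⁻ u, ∫⁻ y, f y ^ (1 / p) * (ENNReal.ofReal (prodKer (fun _ => t) (u - y)) *
          ENNReal.ofReal (Real.exp (inner ℝ x u))) := by
        refine lintegral_congr fun u => ?_
        rw [heatFlow_of_pos _ ht, ← lintegral_mul_const' _ _ ENNReal.ofReal_ne_top]
        exact lintegral_congr fun y => mul_assoc _ _ _
    _ = ∫⁻ y, ∫⁻ u, f y ^ (1 / p) * (ENNReal.ofReal (prodKer (fun _ => t) (u - y)) *
          ENNReal.ofReal (Real.exp (inner ℝ x u))) := by
        refine lintegral_lintegral_swap (Measurable.aemeasurable ?_)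
        exact (hfr.comp measurable_snd).mul
          ((measurable_prodKer_sub _).mul (hE.comp measurable_fst))
    _ = ∫⁻ y, ENNReal.ofReal (Real.exp (t * ‖x‖ ^ 2 / 2)) *
          (f y ^ (1 / p) * ENNReal.ofReal (Real.exp (inner ℝ x y))) := by
        refine lintegral_congr fun y => ?_
        have hm : Measurable fun u : EuclideanSpace ℝ (Fin n) =>
            ENNReal.ofReal (prodKer (fun _ => t) (u - y)) * ENNReal.ofReal (Real.exp (inner ℝ x u)) :=
          (measurable_prodKer_sub_const _ y).mul hE
        rw [lintegral_const_mul _ hm, lintegral_prodKer_mul_exp ht]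
        ring
    _ = _ := lintegral_const_mul' _ _ ENNReal.ofReal_ne_top

/-! ### Truncation -/

/-- The truncation of a function at height `k`, restricted to the ball of radius `k`. -/
noncomputable def truncate (f : EuclideanSpace ℝ (Fin n) → ℝ≥0∞) (k : ℕ) :
    EuclideanSpace ℝ (Fin n) → ℝ≥0∞ :=
  (Metric.closedBall 0 k).indicator fun x => min (f x) k

theorem measurable_truncate {f : EuclideanSpace ℝ (Fin n) → ℝ≥0∞} (hf : Measurable f) (k : ℕ) :
    Measurable (truncate f k) :=
  (hf.min measurable_const).indicator measurableSet_closedBall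

theorem truncate_le (f : EuclideanSpace ℝ (Fin n) → ℝ≥0∞) (k : ℕ) (x : EuclideanSpace ℝ (Fin n)) :
    truncate f k x ≤ f x :=
  Set.indicator_le' (fun _ _ => min_le_left _ _) (fun _ _ => zero_le) x

theorem truncate_le_indicator (f : EuclideanSpace ℝ (Fin n) → ℝ≥0∞) (k : ℕ)
    (x : EuclideanSpace ℝ (Fin n)) :
    truncate f k x ≤ (Metric.closedBall 0 (k : ℝ)).indicator (fun _ => (k : ℝ≥0∞)) x :=
  Set.indicator_le_indicator (min_le_right _ _)

theorem truncate_eq_zero (f : EuclideanSpace ℝ (Fin n) → ℝ≥0∞) {k : ℕ}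
    {x : EuclideanSpace ℝ (Fin n)} (hx : (k : ℝ) < ‖x‖) : truncate f k x = 0 :=
  Set.indicator_of_notMem (by simpa using hx) _

theorem monotone_truncate (f : EuclideanSpace ℝ (Fin n) → ℝ≥0∞) : Monotone (truncate f) := by
  intro k l hkl x
  have h1 : (k : ℝ≥0∞) ≤ l := by exact_mod_cast hkl
  have h2 : (k : ℝ) ≤ l := by exact_mod_cast hkl
  exact (Set.indicator_le_indicator_of_subset (Metric.closedBall_subset_closedBall h2)
    (fun _ => zero_le) x).trans (Set.indicator_le_indicator (min_le_min_left _ h1))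

theorem iSup_truncate_add (f : EuclideanSpace ℝ (Fin n) → ℝ≥0∞) (k₀ : ℕ)
    (x : EuclideanSpace ℝ (Fin n)) : ⨆ k, truncate f (k + k₀) x = f x := by
  refine le_antisymm (iSup_le fun k => truncate_le f _ x) ?_
  obtain ⟨N, hN⟩ := exists_nat_ge ‖x‖
  have key : ∀ k : ℕ, min (f x) k ≤ ⨆ k, truncate f (k + k₀) x := by
    intro k
    refine le_trans ?_ (le_iSup _ (k + N))
    have hx : x ∈ Metric.closedBall (0 : EuclideanSpace ℝ (Fin n)) ((k + N + k₀ : ℕ) : ℝ) := by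
      rw [mem_closedBall_zero_iff]; push_cast
      have : (0 : ℝ) ≤ k := by positivity
      have : (0 : ℝ) ≤ k₀ := by positivity
      linarith
    unfold truncate
    rw [Set.indicator_of_mem hx]
    refine min_le_min_left _ ?_
    push_cast
    rw [add_assoc]
    exact le_self_add
  calc f x = min (f x) (⨆ k : ℕ, (k : ℝ≥0∞)) := by rw [ENNReal.iSup_natCast, min_top_right]
    _ = ⨆ k : ℕ, min (f x) k := inf_iSup_eq _ _
    _ ≤ _ := iSup_le key

theorem lintegral_truncate_rpow_ne_top (f : EuclideanSpace ℝ (Fin n) → ℝ≥0∞) (k : ℕ) {r : ℝ}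
    (hr : 0 < r) : ∫⁻ x, truncate f k x ^ r ≠ ⊤ := by
  have h1 : ∫⁻ x, truncate f k x ^ r ≤ ∫⁻ x : EuclideanSpace ℝ (Fin n),
      (Metric.closedBall 0 (k : ℝ)).indicator (fun _ => (k : ℝ≥0∞) ^ r) x := by
    refine lintegral_mono fun x => ?_
    dsimp only
    refine (ENNReal.rpow_le_rpow (truncate_le_indicator f k x) hr.le).trans (le_of_eq ?_)
    by_cases hx : x ∈ Metric.closedBall (0 : EuclideanSpace ℝ (Fin n)) (k : ℝ)
    · rw [Set.indicator_of_mem hx, Set.indicator_of_mem hx]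
    · rw [Set.indicator_of_notMem hx, Set.indicator_of_notMem hx, ENNReal.zero_rpow_of_pos hr]
  rw [lintegral_indicator measurableSet_closedBall, setLIntegral_const] at h1
  exact (h1.trans_lt (ENNReal.mul_lt_top (ENNReal.rpow_lt_top_of_nonneg hr.le
    (ENNReal.natCast_ne_top k)) measure_closedBall_lt_top)).ne

theorem lintegral_truncate_ne_top (f : EuclideanSpace ℝ (Fin n) → ℝ≥0∞) (k : ℕ) :
    ∫⁻ x, truncate f k x ≠ ⊤ := by
  simpa using lintegral_truncate_rpow_ne_top f k one_pos

theorem lintegral_eq_iSup_truncate_add {f : EuclideanSpace ℝ (Fin n) → ℝ≥0∞} (hf : Measurable f)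
    (k₀ : ℕ) : ∫⁻ x, f x = ⨆ k, ∫⁻ x, truncate f (k + k₀) x := by
  rw [← lintegral_iSup (fun k => measurable_truncate hf _)
    (fun k l hkl => monotone_truncate f (by omega))]
  exact lintegral_congr fun x => (iSup_truncate_add f k₀ x).symm

/-- Starting the truncations at `k₀` makes every one of them nonzero, hence their tilted integrals
at positive times finite, as the decreasing limit requires. -/
theorem exists_lintegral_truncate_ne_zero {f : EuclideanSpace ℝ (Fin n) → ℝ≥0∞} (hf : Measurable f)
    (h0 : ∫⁻ x, f x ≠ 0) : ∃ k₀, ∀ k, ∫⁻ x, truncate f (k + k₀) x ≠ 0 := by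
  rw [lintegral_eq_iSup_truncate_add hf 0] at h0
  obtain ⟨k₀, hk⟩ : ∃ k, ∫⁻ x, truncate f (k + 0) x ≠ 0 := by
    by_contra! h
    exact h0 (iSup_eq_bot.2 h)
  refine ⟨k₀, fun k hk' => hk ?_⟩
  exact le_antisymm ((lintegral_mono (monotone_truncate f (by omega))).trans hk'.le) zero_le

theorem isFiniteMeasure_withDensity_truncate (f : EuclideanSpace ℝ (Fin n) → ℝ≥0∞) (k : ℕ) :
    IsFiniteMeasure (volume.withDensity (truncate f k)) :=
  isFiniteMeasure_withDensity (lintegral_truncate_ne_top f k)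

theorem neZero_withDensity_truncate {f : EuclideanSpace ℝ (Fin n) → ℝ≥0∞} {k : ℕ}
    (h0 : ∫⁻ x, truncate f k x ≠ 0) : NeZero (volume.withDensity (truncate f k)) := by
  refine ⟨fun h => h0 ?_⟩
  rw [← Measure.restrict_univ (μ := volume), ← withDensity_apply _ MeasurableSet.univ, h]
  rfl

theorem ae_withDensity_truncate (f : EuclideanSpace ℝ (Fin n) → ℝ≥0∞) (k : ℕ) :
    ∀ᵐ u ∂(volume.withDensity (truncate f k)), ‖u‖ ≤ k := by
  have hs : {u : EuclideanSpace ℝ (Fin n) | ‖u‖ ≤ k}ᶜ = {u | (k : ℝ) < ‖u‖} := by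
    ext u; simp
  rw [ae_iff]
  change volume.withDensity (truncate f k) {u : EuclideanSpace ℝ (Fin n) | ‖u‖ ≤ k}ᶜ = 0
  have hm : MeasurableSet {u : EuclideanSpace ℝ (Fin n) | (k : ℝ) < ‖u‖} :=
    measurableSet_lt measurable_const measurable_norm
  rw [hs, withDensity_apply _ hm, setLIntegral_congr_fun (g := fun _ => 0) hm
    (fun u hu => truncate_eq_zero f hu), lintegral_zero]

/-! ### Monotonicity along the heat flow -/

theorem laplaceRoot_heatFlow_truncate {f : EuclideanSpace ℝ (Fin n) → ℝ≥0∞} (hf : Measurable f)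
    (k : ℕ) {t : ℝ} (ht : 0 < t) (p : ℝ) :
    laplaceRoot p (heatFlow (truncate f k) t)
      = smoothLaplace p (volume.withDensity (truncate f k)) fun _ => t := by
  have := isFiniteMeasure_withDensity_truncate f k
  unfold smoothLaplace
  rw [funext (heatFlow_eq_smooth (measurable_truncate hf k) ht)]

theorem minTilted_heatFlow_truncate_le_of_pos {f : EuclideanSpace ℝ (Fin n) → ℝ≥0∞}
    (hf : Measurable f) {k : ℕ} (h0 : ∫⁻ x, truncate f k x ≠ 0) {p : ℝ} (hp0 : 0 < p) (hp1 : p < 1)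
    {s t : ℝ} (hs : 0 < s) (hst : s ≤ t) :
    minTilted (p / (1 - p)) (laplaceRoot p (heatFlow (truncate f k) s))
      ≤ minTilted (p / (1 - p)) (laplaceRoot p (heatFlow (truncate f k) t)) := by
  have := isFiniteMeasure_withDensity_truncate f k
  have := neZero_withDensity_truncate h0
  rw [laplaceRoot_heatFlow_truncate hf k hs, laplaceRoot_heatFlow_truncate hf k (hs.trans_le hst)]
  exact minTilted_smoothLaplace_mono k.cast_nonneg (ae_withDensity_truncate f k) hp0 hp1 hs hst

theorem tilted_heatFlow_truncate_ne_top {f : EuclideanSpace ℝ (Fin n) → ℝ≥0∞}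
    (hf : Measurable f) {k : ℕ} (h0 : ∫⁻ x, truncate f k x ≠ 0) {p Q : ℝ} (hp : 0 < p) (hQ : 0 < Q)
    {t : ℝ} (ht : 0 < t) (z : EuclideanSpace ℝ (Fin n)) :
    tilted Q (laplaceRoot p (heatFlow (truncate f k) t)) z ≠ ⊤ := by
  have := isFiniteMeasure_withDensity_truncate f k
  have := neZero_withDensity_truncate h0
  obtain ⟨c, hc, C, hC, h⟩ := exists_le_smooth (ae_withDensity_truncate f k) ht ht
  refine (tilted_laplaceRoot_lt_top hp hQ hc hC (fun y => ?_) z).ne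
  rw [heatFlow_eq_smooth (measurable_truncate hf k) ht]
  exact ENNReal.ofReal_le_ofReal (h _ (fun _ => le_rfl) (fun _ => le_rfl) y)

theorem laplaceRoot_truncate_le (f : EuclideanSpace ℝ (Fin n) → ℝ≥0∞) (k : ℕ) (p : ℝ)
    {x : EuclideanSpace ℝ (Fin n)} (hx : ‖x‖ ≤ 1) (hp : 0 < p) :
    laplaceRoot p (truncate f k) x
      ≤ ENNReal.ofReal (Real.exp k) * ∫⁻ y, truncate f k y ^ (1 / p) := by
  unfold laplaceRoot laplace
  rw [← lintegral_const_mul' _ _ ENNReal.ofReal_ne_top]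
  refine lintegral_mono fun y => ?_
  dsimp only
  rcases le_or_gt ‖y‖ (k : ℝ) with hy | hy
  · rw [mul_comm]
    refine mul_le_mul_left (ENNReal.ofReal_le_ofReal (Real.exp_le_exp.2 ?_)) _
    calc inner ℝ x y ≤ ‖x‖ * ‖y‖ := real_inner_le_norm _ _
      _ ≤ 1 * k := by gcongr
      _ = k := one_mul _
  · rw [truncate_eq_zero f hy, ENNReal.zero_rpow_of_pos (by positivity), zero_mul, mul_zero]

/-- Extends monotonicity to the initial time without any continuity of `f`: almost minimizing tilts
at the times `t / (j + 1)` have values close to at most `K`, and the direct method with the Jensen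
bound passes to the limit. -/
theorem minTilted_truncate_le_heatFlow {f : EuclideanSpace ℝ (Fin n) → ℝ≥0∞}
    (hf : Measurable f) {k : ℕ} (h0 : ∫⁻ x, truncate f k x ≠ 0) {p : ℝ} (hp0 : 0 < p) (hp1 : p < 1)
    {t : ℝ} (ht : 0 < t) :
    minTilted (p / (1 - p)) (laplaceRoot p (truncate f k))
      ≤ minTilted (p / (1 - p)) (laplaceRoot p (heatFlow (truncate f k) t)) := by
  have hQ : 0 < p / (1 - p) := div_pos hp0 (by linarith)
  set K := minTilted (p / (1 - p)) (laplaceRoot p (heatFlow (truncate f k) t)) with hK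
  have hKtop : K ≠ ⊤ := ne_top_of_le_ne_top
    (tilted_heatFlow_truncate_ne_top hf h0 hp0 hQ ht 0) (iInf_le _ 0)
  set τ : ℕ → ℝ := fun j => t / (j + 1) with hτ
  have hτ0 : ∀ j, 0 < τ j := fun j => by positivity
  have hτt : ∀ j, τ j ≤ t := fun j => div_le_self ht.le (by
    have : (0 : ℝ) ≤ j := j.cast_nonneg
    linarith)
  have hτlim : Tendsto τ atTop (𝓝 0) := by
    have := (tendsto_one_div_add_atTop_nhds_zero_nat (𝕜 := ℝ)).const_mul t
    simpa [hτ, div_eq_mul_inv] using this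
  have hex : ∀ j : ℕ, ∃ z, tilted (p / (1 - p)) (laplaceRoot p (heatFlow (truncate f k) (τ j))) z
      ≤ K + (j + 1 : ℝ≥0∞)⁻¹ := by
    intro j
    have h1 : minTilted (p / (1 - p)) (laplaceRoot p (heatFlow (truncate f k) (τ j)))
        < K + (j + 1 : ℝ≥0∞)⁻¹ :=
      (minTilted_heatFlow_truncate_le_of_pos hf h0 hp0 hp1 (hτ0 j) (hτt j)).trans_lt
        (ENNReal.lt_add_right hKtop (by simp [ENNReal.inv_eq_zero]))
    obtain ⟨z, hz⟩ := iInf_lt_iff.1 h1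
    exact ⟨z, hz.le⟩
  choose z hz using hex
  have hlim : Tendsto (fun j : ℕ => K + (j + 1 : ℝ≥0∞)⁻¹) atTop (𝓝 K) := by
    have := (tendsto_const_nhds (x := K)).add
      ((tendsto_add_atTop_iff_nat 1).2 ENNReal.tendsto_inv_nat_nhds_zero)
    simpa using this
  have hbound : ∀ j x, laplaceRoot p (heatFlow (truncate f k) (τ j)) x
      ≤ ENNReal.ofReal (Real.exp (τ j * ‖x‖ ^ 2 / 2)) * laplaceRoot p (truncate f k) x :=
    fun j x => laplaceRoot_heatFlow_le (measurable_truncate hf k) (hτ0 j) hp0 hp1 x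
  have hlimsup : ∀ x, limsup (fun j => laplaceRoot p (heatFlow (truncate f k) (τ j)) x) atTop
      ≤ laplaceRoot p (truncate f k) x := by
    intro x
    have h1 : Tendsto (fun j => ENNReal.ofReal (Real.exp (τ j * ‖x‖ ^ 2 / 2)) *
        laplaceRoot p (truncate f k) x) atTop (𝓝 (laplaceRoot p (truncate f k) x)) := by
      have h2 : Tendsto (fun j => ENNReal.ofReal (Real.exp (τ j * ‖x‖ ^ 2 / 2))) atTop (𝓝 1) := by
        have h3 := ((hτlim.mul_const (‖x‖ ^ 2)).div_const 2).rexp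
        have h4 := ENNReal.tendsto_ofReal h3
        simpa using h4
      have := ENNReal.Tendsto.mul_const (b := laplaceRoot p (truncate f k) x) h2 (Or.inl one_ne_zero)
      simpa using this
    rw [← h1.limsup_eq]
    exact limsup_le_limsup (Eventually.of_forall fun j => hbound j x)
  have hball : ∀ j x, ‖x‖ ≤ 1 → laplaceRoot p (heatFlow (truncate f k) (τ j)) x
      ≤ ENNReal.ofReal (Real.exp (t / 2)) *
        (ENNReal.ofReal (Real.exp k) * ∫⁻ y, truncate f k y ^ (1 / p)) := by
    intro j x hx
    refine (hbound j x).trans (mul_le_mul' (ENNReal.ofReal_le_ofReal (Real.exp_le_exp.2 ?_))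
      (laplaceRoot_truncate_le f k p hx hp0))
    have h1 : ‖x‖ ^ 2 ≤ 1 := pow_le_one₀ (norm_nonneg x) hx
    have h2 := hτt j
    have h3 := (hτ0 j).le
    nlinarith
  obtain ⟨w, hw⟩ := exists_tilted_le_of_tendsto hQ
    (X := fun j => laplaceRoot p (heatFlow (truncate f k) (τ j)))
    (Y := laplaceRoot p (truncate f k))
    (C := ENNReal.ofReal (Real.exp (t / 2)) *
      (ENNReal.ofReal (Real.exp k) * ∫⁻ y, truncate f k y ^ (1 / p)))
    (fun j => measurable_laplaceRoot (measurable_heatFlow (measurable_truncate hf k) (hτ0 j).le))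
    hlimsup
    (ENNReal.mul_ne_top ENNReal.ofReal_ne_top (ENNReal.mul_ne_top ENNReal.ofReal_ne_top
      (lintegral_truncate_rpow_ne_top f k (by positivity))))
    hball hKtop hlim hz
  exact (iInf_le _ w).trans hw

theorem minTilted_heatFlow_truncate_mono {f : EuclideanSpace ℝ (Fin n) → ℝ≥0∞}
    (hf : Measurable f) {k : ℕ} (h0 : ∫⁻ x, truncate f k x ≠ 0) {p : ℝ} (hp0 : 0 < p) (hp1 : p < 1)
    {s t : ℝ} (hs : 0 ≤ s) (hst : s ≤ t) :
    minTilted (p / (1 - p)) (laplaceRoot p (heatFlow (truncate f k) s))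
      ≤ minTilted (p / (1 - p)) (laplaceRoot p (heatFlow (truncate f k) t)) := by
  rcases hst.eq_or_lt with rfl | hst'
  · exact le_rfl
  rcases hs.eq_or_lt with rfl | hs
  · rw [heatFlow_zero]
    exact minTilted_truncate_le_heatFlow hf h0 hp0 hp1 hst'
  · exact minTilted_heatFlow_truncate_le_of_pos hf h0 hp0 hp1 hs hst

theorem minTilted_anti {Q : ℝ} (hQ : 0 < Q) {X Y : EuclideanSpace ℝ (Fin n) → ℝ≥0∞}
    (h : ∀ x, X x ≤ Y x) : minTilted Q Y ≤ minTilted Q X :=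
  iInf_mono fun z => tilted_anti hQ h z

/-- For fixed `z`, the tilted integral at time `t` is the infimum over truncations. Each of these
dominates the minimum for the truncation at time `s`, which dominates that for `f` because the
truncation is smaller than `f`. -/
theorem minTilted_heatFlow_mono {f : EuclideanSpace ℝ (Fin n) → ℝ≥0∞}
    (hf : Measurable f) (h0 : ∫⁻ x, f x ≠ 0) {p : ℝ} (hp0 : 0 < p) (hp1 : p < 1)
    {s t : ℝ} (hs : 0 ≤ s) (hst : s ≤ t) :
    minTilted (p / (1 - p)) (laplaceRoot p (heatFlow f s))
      ≤ minTilted (p / (1 - p)) (laplaceRoot p (heatFlow f t)) := by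
  rcases hst.eq_or_lt with rfl | hst'
  · exact le_rfl
  have hQ : 0 < p / (1 - p) := div_pos hp0 (by linarith)
  have ht : 0 < t := hs.trans_lt hst'
  obtain ⟨k₀, hk₀⟩ := exists_lintegral_truncate_ne_zero hf h0
  refine le_iInf fun z => ?_
  have hmono : Monotone fun k => truncate f (k + k₀) := fun k l hkl =>
    monotone_truncate f (by omega)
  have e : heatFlow f t = fun y => ⨆ k, heatFlow (truncate f (k + k₀)) t y := by
    ext y
    rw [← heatFlow_iSup (fun k => measurable_truncate hf _) hmono ht.le]
    simp_rw [iSup_truncate_add]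
  rw [e, tilted_laplaceRoot_iSup hp0 hQ
    (fun k => measurable_heatFlow (measurable_truncate hf _) ht.le)
    (fun k l hkl y => heatFlow_mono (hmono hkl) ht.le y) z
    (tilted_heatFlow_truncate_ne_top hf (hk₀ 0) hp0 hQ ht z)]
  refine le_iInf fun k => ?_
  calc _ ≤ minTilted (p / (1 - p)) (laplaceRoot p (heatFlow (truncate f (k + k₀)) s)) :=
        minTilted_anti hQ (laplaceRoot_mono hp0 (heatFlow_mono (truncate_le f _) hs))
    _ ≤ minTilted (p / (1 - p)) (laplaceRoot p (heatFlow (truncate f (k + k₀)) t)) :=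
        minTilted_heatFlow_truncate_mono hf (hk₀ k) hp0 hp1 hs hst
    _ ≤ _ := iInf_le _ z

theorem volumeProduct_heatFlow_mono {f : EuclideanSpace ℝ (Fin n) → ℝ≥0∞}
    (hf : Measurable f) {p : ℝ} (hp0 : 0 < p) (hp1 : p < 1) {s t : ℝ} (hs : 0 ≤ s) (hst : s ≤ t) :
    volumeProduct p (heatFlow f s) ≤ volumeProduct p (heatFlow f t) := by
  rw [volumeProduct_eq hp0 hp1, volumeProduct_eq hp0 hp1, lintegral_heatFlow hf hs,
    lintegral_heatFlow hf (hs.trans hst)]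
  rcases eq_or_ne (∫⁻ x, f x) 0 with h0 | h0
  · simp [h0]
  · have hp2 : 0 ≤ 1 - p := by linarith
    gcongr
    exact minTilted_heatFlow_mono hf h0 hp0 hp1 hs hst

/-! ### Scaling and the Fokker-Planck flow -/

theorem lintegral_mul_smul (f : EuclideanSpace ℝ (Fin n) → ℝ≥0∞) {c r : ℝ} (hc : 0 < c)
    (hr : 0 < r) : ∫⁻ y, ENNReal.ofReal c * f (r • y)
      = ENNReal.ofReal (c * r⁻¹ ^ n) * ∫⁻ y, f y := by
  rw [lintegral_const_mul' _ _ ENNReal.ofReal_ne_top, lintegral_smul_eq f hr, ← mul_assoc,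
    ← ENNReal.ofReal_mul hc.le]

theorem laplaceRoot_mul_smul {p : ℝ} (f : EuclideanSpace ℝ (Fin n) → ℝ≥0∞)
    {c r : ℝ} (hc : 0 < c) (hr : 0 < r) (x : EuclideanSpace ℝ (Fin n)) :
    laplaceRoot p (fun y => ENNReal.ofReal c * f (r • y)) x
      = ENNReal.ofReal (c ^ (1 / p) * r⁻¹ ^ n) * laplaceRoot p f (r⁻¹ • x) := by
  unfold laplaceRoot laplace
  rw [← lintegral_mul_smul (fun y => f y ^ (1 / p) *
    ENNReal.ofReal (Real.exp (inner ℝ (r⁻¹ • x) y))) (by positivity) hr]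
  refine lintegral_congr fun y => ?_
  dsimp only
  rw [mul_rpow_of_left (by simpa using hc) ENNReal.ofReal_ne_top, ENNReal.ofReal_rpow_of_pos hc,
    inner_smul_left, inner_smul_right, mul_assoc]
  congr 4
  simp [hr.ne']

theorem tilted_mul_smul {Q : ℝ} (X : EuclideanSpace ℝ (Fin n) → ℝ≥0∞) {d r : ℝ} (hd : 0 < d)
    (hr : 0 < r) (z : EuclideanSpace ℝ (Fin n)) :
    tilted Q (fun x => ENNReal.ofReal d * X (r⁻¹ • x)) z
      = ENNReal.ofReal (d ^ (-Q) * r ^ n) * tilted Q X (r • z) := by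
  unfold tilted
  have := lintegral_mul_smul (fun x => X x ^ (-Q) * ENNReal.ofReal (Real.exp (inner ℝ (r • z) x)))
    (c := d ^ (-Q)) (by positivity) (inv_pos.2 hr)
  rw [inv_inv] at this
  rw [← this]
  refine lintegral_congr fun y => ?_
  rw [mul_rpow_of_left (by simpa using hd) ENNReal.ofReal_ne_top, ENNReal.ofReal_rpow_of_pos hd,
    inner_smul_left, inner_smul_right, mul_assoc]
  congr 4
  simp [hr.ne']

theorem minTilted_mul_smul {Q : ℝ} (X : EuclideanSpace ℝ (Fin n) → ℝ≥0∞) {d r : ℝ} (hd : 0 < d)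
    (hr : 0 < r) : minTilted Q (fun x => ENNReal.ofReal d * X (r⁻¹ • x))
      = ENNReal.ofReal (d ^ (-Q) * r ^ n) * minTilted Q X := by
  unfold minTilted
  simp_rw [tilted_mul_smul X hd hr]
  rw [← ENNReal.mul_iInf_of_ne (by simp; positivity) ENNReal.ofReal_ne_top]
  congr 1
  exact (Homeomorph.smulOfNeZero r hr.ne').toEquiv.iInf_congr fun z => rfl

/-- The powers of `c` and `r` coming from the mass and from the tilted minimum cancel: the latter
scales as `c^{-1} r^n` after the power `1 - p`, the former as `c r^{-n}`. -/
theorem volumeProduct_mul_smul {p : ℝ} (hp0 : 0 < p) (hp1 : p < 1)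
    (f : EuclideanSpace ℝ (Fin n) → ℝ≥0∞) {c r : ℝ} (hc : 0 < c) (hr : 0 < r) :
    volumeProduct p (fun y => ENNReal.ofReal c * f (r • y)) = volumeProduct p f := by
  have hp2 : 0 < 1 - p := by linarith
  have hp3 : 1 - p ≠ 0 := hp2.ne'
  rw [volumeProduct_eq hp0 hp1, volumeProduct_eq hp0 hp1, lintegral_mul_smul f hc hr,
    funext (laplaceRoot_mul_smul (p := p) f hc hr), minTilted_mul_smul _ (by positivity) hr,
    mul_left_comm (ENNReal.ofReal (p ^ n)), mul_rpow_of_left (by simp; positivity)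
    ENNReal.ofReal_ne_top, mul_mul_mul_comm, ENNReal.ofReal_rpow_of_pos (by positivity),
    ← ENNReal.ofReal_mul (by positivity)]
  have : c * r⁻¹ ^ n * ((c ^ (1 / p) * r⁻¹ ^ n) ^ (-(p / (1 - p))) * r ^ n) ^ (1 - p) = 1 := by
    -- Taking logarithms makes the identity linear in `log c` and `log r`.
    apply Real.log_injOn_pos (Set.mem_Ioi.2 (by positivity)) (Set.mem_Ioi.2 one_pos)
    rw [Real.log_mul (by positivity) (by positivity), Real.log_mul (by positivity) (by positivity),
      Real.log_rpow (by positivity), Real.log_mul (by positivity) (by positivity),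
      Real.log_rpow (by positivity), Real.log_mul (by positivity) (by positivity),
      Real.log_rpow hc, Real.log_pow, Real.log_pow, Real.log_inv, Real.log_one]
    field_simp
    ring
  rw [this, ENNReal.ofReal_one, one_mul]

theorem fokkerPlanckFlow_eq (f : EuclideanSpace ℝ (Fin n) → ℝ≥0∞) (t : ℝ) :
    fokkerPlanckFlow f t = fun x => ENNReal.ofReal (Real.exp (n * t / 2)) *
      heatFlow f (Real.exp t - 1) (Real.exp (t / 2) • x) := by
  ext x
  unfold fokkerPlanckFlow heatFlow
  rcases eq_or_ne t 0 with rfl | ht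
  · simp
  · have : Real.exp t - 1 ≠ 0 := by
      intro h
      exact ht (Real.exp_eq_one_iff t |>.1 (by linarith))
    rw [if_neg ht, if_neg this]

theorem volumeProduct_fokkerPlanckFlow {p : ℝ} (hp0 : 0 < p) (hp1 : p < 1)
    (f : EuclideanSpace ℝ (Fin n) → ℝ≥0∞) (t : ℝ) :
    volumeProduct p (fokkerPlanckFlow f t) = volumeProduct p (heatFlow f (Real.exp t - 1)) := by
  rw [fokkerPlanckFlow_eq]
  exact volumeProduct_mul_smul hp0 hp1 _ (Real.exp_pos _) (Real.exp_pos _)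

/-! ### The Gaussian bound -/

/-- By evenness the tilts `z` and `-z` give the same value, and their average has weight `cosh (z·x)
≥ 1`. -/
theorem minTilted_eq_of_even {Q : ℝ} {X : EuclideanSpace ℝ (Fin n) → ℝ≥0∞} (hX : Measurable X)
    (heven : ∀ x, X (-x) = X x) : minTilted Q X = tilted Q X 0 := by
  refine le_antisymm (iInf_le _ 0) (le_iInf fun z => ?_)
  have h1 : tilted Q X (-z) = tilted Q X z := by
    unfold tilted
    rw [← lintegral_sub_left_eq_self (fun x => X x ^ (-Q) *
      ENNReal.ofReal (Real.exp (inner ℝ (-z) x))) 0]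
    refine lintegral_congr fun x => ?_
    rw [zero_sub, heven, inner_neg_neg]
  have h2 : tilted Q X 0 + tilted Q X 0 ≤ tilted Q X z + tilted Q X (-z) := by
    unfold tilted
    rw [← lintegral_add_left (measurable_tilt hX 0), ← lintegral_add_left (measurable_tilt hX z)]
    refine lintegral_mono fun x => ?_
    dsimp only
    rw [← mul_add, ← mul_add, ← ENNReal.ofReal_add (Real.exp_pos _).le (Real.exp_pos _).le,
      ← ENNReal.ofReal_add (Real.exp_pos _).le (Real.exp_pos _).le]
    refine mul_le_mul_right (ENNReal.ofReal_le_ofReal ?_) _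
    rw [inner_zero_left, Real.exp_zero, inner_neg_left]
    have := Real.one_le_cosh (inner ℝ z x)
    rw [Real.cosh_eq] at this
    linarith
  rw [h1, ← two_mul, ← two_mul] at h2
  exact (ENNReal.mul_le_mul_iff_right two_ne_zero ENNReal.ofNat_ne_top).1 h2

theorem laplaceRoot_even {p : ℝ} {f : EuclideanSpace ℝ (Fin n) → ℝ≥0∞} (heven : ∀ x, f (-x) = f x)
    (x : EuclideanSpace ℝ (Fin n)) : laplaceRoot p f (-x) = laplaceRoot p f x := by
  unfold laplaceRoot laplace
  rw [← lintegral_sub_left_eq_self (fun y => f y ^ (1 / p) *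
      ENNReal.ofReal (Real.exp (inner ℝ (-x) y))) 0]
  refine lintegral_congr fun y => ?_
  rw [zero_sub, heven, inner_neg_neg]

/-- A radial lower bound for the rescaled heat flow of a function supported in a ball of
radius `R`, with parameter `δ = R / √t`. -/
noncomputable def radialBound (c δ : ℝ) (y : EuclideanSpace ℝ (Fin n)) : ℝ≥0∞ :=
  ENNReal.ofReal (c * Real.exp (-(‖y‖ + δ) ^ 2 / 2))

theorem measurable_radialBound (c δ : ℝ) :
    Measurable (radialBound c δ : EuclideanSpace ℝ (Fin n) → ℝ≥0∞) := by
  unfold radialBound; fun_prop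

theorem radialBound_zero {c : ℝ} (hc : 0 ≤ c) (y : EuclideanSpace ℝ (Fin n)) :
    radialBound c 0 y = ENNReal.ofReal c * gaussian 1 y := by
  unfold radialBound gaussian
  rw [ENNReal.ofReal_mul hc, add_zero, mul_one]

theorem radialBound_anti {c δ δ' : ℝ} (hc : 0 ≤ c) (hδ : 0 ≤ δ) (h : δ ≤ δ')
    (y : EuclideanSpace ℝ (Fin n)) : radialBound c δ' y ≤ radialBound c δ y := by
  unfold radialBound
  apply ENNReal.ofReal_le_ofReal
  have := norm_nonneg y
  gcongr

theorem exists_le_radialBound {c δ : ℝ} (hc : 0 < c) : ∃ a > 0, ∃ b > 0,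
    ∀ y : EuclideanSpace ℝ (Fin n), ENNReal.ofReal (a * Real.exp (-b * ‖y‖ ^ 2))
      ≤ radialBound c δ y := by
  refine ⟨c * Real.exp (-δ ^ 2), by positivity, 1, one_pos, fun y => ENNReal.ofReal_le_ofReal ?_⟩
  rw [mul_assoc, ← Real.exp_add]
  gcongr
  nlinarith [sq_nonneg (‖y‖ - δ)]

theorem iSup_radialBound {c R : ℝ} (hc : 0 ≤ c) (hR : 0 ≤ R) (y : EuclideanSpace ℝ (Fin n)) :
    ⨆ j : ℕ, radialBound c (R / (j + 1)) y = radialBound c 0 y := by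
  refine iSup_eq_of_tendsto (fun i j hij => radialBound_anti hc (by positivity) (by gcongr) y) ?_
  have h1 : Tendsto (fun j : ℕ => R / ((j : ℝ) + 1)) atTop (𝓝 0) := by
    have := (tendsto_one_div_add_atTop_nhds_zero_nat (𝕜 := ℝ)).const_mul R
    simpa [div_eq_mul_inv] using this
  have h2 : Continuous fun δ : ℝ => radialBound c δ y := by
    unfold radialBound
    exact ENNReal.continuous_ofReal.comp (by fun_prop)
  exact (h2.tendsto 0).comp h1

/-- For `u` in the support, `‖r y - u‖ ≤ r (‖y‖ + k / r)`, so each kernel in the rescaled flow at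
time `r²` is bounded below by the same radial profile. -/
theorem radialBound_le_heatFlow {f : EuclideanSpace ℝ (Fin n) → ℝ≥0∞} (hf : Measurable f) {k : ℕ}
    {r : ℝ} (hr : 0 < r) (y : EuclideanSpace ℝ (Fin n)) :
    radialBound ((∫⁻ x, truncate f k x).toReal / (2 * Real.pi) ^ ((n : ℝ) / 2)) (k / r) y
      ≤ ENNReal.ofReal (r ^ n) * heatFlow (truncate f k) (r ^ 2) (r • y) := by
  have hr2 : 0 < r ^ 2 := by positivity
  rw [heatFlow_of_pos _ hr2, ← lintegral_const_mul' _ _ ENNReal.ofReal_ne_top]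
  have e : radialBound ((∫⁻ x, truncate f k x).toReal / (2 * Real.pi) ^ ((n : ℝ) / 2)) (k / r) y
      = ∫⁻ u, truncate f k u * ENNReal.ofReal
        (Real.exp (-(‖y‖ + k / r) ^ 2 / 2) / (2 * Real.pi) ^ ((n : ℝ) / 2)) := by
    rw [lintegral_mul_const _ (measurable_truncate hf k)]
    unfold radialBound
    rw [div_mul_eq_mul_div, mul_div_assoc, ENNReal.ofReal_mul ENNReal.toReal_nonneg,
      ENNReal.ofReal_toReal (lintegral_truncate_ne_top f k)]
  rw [e]
  refine lintegral_mono fun u => ?_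
  dsimp only
  rcases le_or_gt ‖u‖ (k : ℝ) with hu | hu
  · rw [mul_left_comm, ← ENNReal.ofReal_mul (by positivity), prodKer_const hr2]
    refine mul_le_mul_right (ENNReal.ofReal_le_ofReal ?_) _
    have h1 : (2 * Real.pi * r ^ 2) ^ ((n : ℝ) / 2) = (2 * Real.pi) ^ ((n : ℝ) / 2) * r ^ n := by
      rw [Real.mul_rpow (by positivity) (by positivity), ← Real.rpow_natCast r 2,
        ← Real.rpow_mul hr.le, ← Real.rpow_natCast r n]
      congr 2
      push_cast; ring
    have h2 : ‖r • y - u‖ ≤ r * (‖y‖ + k / r) := by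
      refine (norm_sub_le _ _).trans ?_
      rw [norm_smul, Real.norm_of_nonneg hr.le, mul_add, mul_div_cancel₀ _ hr.ne']
      gcongr
    have h3 : ‖r • y - u‖ ^ 2 / (2 * r ^ 2) ≤ (‖y‖ + k / r) ^ 2 / 2 := by
      rw [div_le_div_iff₀ (by positivity) two_pos]
      have := pow_le_pow_left₀ (norm_nonneg _) h2 2
      rw [mul_pow] at this
      linarith
    rw [h1, mul_div_assoc', mul_comm (r ^ n), mul_div_mul_right _ _ (by positivity)]
    refine div_le_div_of_nonneg_right (Real.exp_le_exp.2 ?_) (by positivity)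
    rw [neg_div, neg_div]
    exact neg_le_neg h3
  · rw [truncate_eq_zero f hu, zero_mul]
    exact zero_le

theorem lintegral_gaussian : ∫⁻ y : EuclideanSpace ℝ (Fin n), gaussian 1 y
    = ENNReal.ofReal ((2 * Real.pi) ^ ((n : ℝ) / 2)) := by
  have h := lintegral_prodKer (n := n) one_pos
  have e : ∀ y : EuclideanSpace ℝ (Fin n), gaussian 1 y = ENNReal.ofReal
      ((2 * Real.pi) ^ ((n : ℝ) / 2)) * ENNReal.ofReal (prodKer (fun _ => 1) y) := by
    intro y
    rw [← ENNReal.ofReal_mul (by positivity), prodKer_const one_pos, mul_one (2 * Real.pi),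
      mul_div_cancel₀ _ (by positivity)]
    rfl
  simp_rw [e]
  rw [lintegral_const_mul' _ _ ENNReal.ofReal_ne_top, h, mul_one]

/-- The large time limit, from one side only: a lower bound on the rescaled flow bounds the tilted
integral from above, and the radial bounds increase to `c · gaussian 1`. Testing only `z = 0` loses
nothing in the limit, because the Gaussian is even. -/
theorem volumeProduct_truncate_le_gaussian {f : EuclideanSpace ℝ (Fin n) → ℝ≥0∞}
    (hf : Measurable f) {k : ℕ} (h0 : ∫⁻ x, truncate f k x ≠ 0) {p : ℝ} (hp0 : 0 < p)
    (hp1 : p < 1) : volumeProduct p (truncate f k) ≤ volumeProduct p (gaussian (n := n) 1) := by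
  have hp2 : 0 < 1 - p := by linarith
  have hQ : 0 < p / (1 - p) := div_pos hp0 hp2
  have htop := lintegral_truncate_ne_top f k
  have hkm := measurable_truncate hf k
  set μ := ∫⁻ x, truncate f k x with hμ
  -- With this constant the limiting Gaussian has the mass `μ` of the truncation.
  set c : ℝ := μ.toReal / (2 * Real.pi) ^ ((n : ℝ) / 2) with hcdef
  have hc : 0 < c := div_pos (ENNReal.toReal_pos h0 htop) (by positivity)
  have hle : ∀ j : ℕ, volumeProduct p (truncate f k) ≤ μ * (ENNReal.ofReal (p ^ n) *
      tilted (p / (1 - p)) (laplaceRoot p (radialBound (n := n) c (k / ((j : ℝ) + 1)))) 0)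
        ^ (1 - p) := by
    intro j
    have hr : (0 : ℝ) < (j : ℝ) + 1 := by positivity
    -- Flow up to time `(j + 1)²`, then dilate by `j + 1` with the factor `(j + 1)^n`, which
    -- preserves the mass.
    have h1 := volumeProduct_heatFlow_mono hkm hp0 hp1 le_rfl (sq_nonneg ((j : ℝ) + 1))
    rw [heatFlow_zero, ← volumeProduct_mul_smul hp0 hp1 (heatFlow (truncate f k) (((j : ℝ) + 1) ^ 2))
      (pow_pos hr n) hr, volumeProduct_eq hp0 hp1 (fun y => ENNReal.ofReal (((j : ℝ) + 1) ^ n) *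
        heatFlow (truncate f k) (((j : ℝ) + 1) ^ 2) (((j : ℝ) + 1) • y)), lintegral_mul_smul _ (pow_pos hr n) hr,
      lintegral_heatFlow hkm (sq_nonneg _), ← mul_pow, mul_inv_cancel₀ hr.ne', one_pow,
      ENNReal.ofReal_one, one_mul] at h1
    refine h1.trans ?_
    gcongr
    exact (iInf_le _ 0).trans (tilted_anti hQ (laplaceRoot_mono hp0 (radialBound_le_heatFlow hf hr)) 0)
  have hmono : Monotone fun j : ℕ => radialBound (n := n) c (k / ((j : ℝ) + 1)) :=
    fun i j hij => radialBound_anti hc.le (by positivity) (by gcongr)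
  obtain ⟨a, ha, b, hb, hab⟩ := exists_le_radialBound (n := n) (c := c) (δ := k / ((0 : ℕ) + 1)) hc
  have hinf := tilted_laplaceRoot_iSup (p := p) hp0 hQ
    (fun j : ℕ => measurable_radialBound (n := n) c (k / ((j : ℝ) + 1))) hmono 0
    (tilted_laplaceRoot_lt_top hp0 hQ ha hb hab 0).ne
  simp_rw [iSup_radialBound hc.le (Nat.cast_nonneg k), radialBound_zero hc.le] at hinf
  have hanti : Antitone fun j : ℕ => tilted (p / (1 - p))
      (laplaceRoot p (radialBound (n := n) c (k / ((j : ℝ) + 1)))) 0 :=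
    fun i j hij => tilted_anti hQ (laplaceRoot_mono hp0 (hmono hij)) 0
  have hlim := tendsto_atTop_iInf hanti
  rw [← hinf] at hlim
  have hlim2 := ENNReal.Tendsto.const_mul (a := μ) (((ENNReal.continuous_rpow_const
    (y := 1 - p)).tendsto _).comp (ENNReal.Tendsto.const_mul (a := ENNReal.ofReal (p ^ n)) hlim
      (Or.inr ENNReal.ofReal_ne_top))) (Or.inr htop)
  refine (ge_of_tendsto' hlim2 hle).trans (le_of_eq ?_)
  have heven : ∀ y : EuclideanSpace ℝ (Fin n),
      ENNReal.ofReal c * gaussian 1 (-y) = ENNReal.ofReal c * gaussian 1 y := by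
    intro y; unfold gaussian; rw [norm_neg]
  have hgm : Measurable fun y : EuclideanSpace ℝ (Fin n) => ENNReal.ofReal c * gaussian 1 y := by
    unfold gaussian; fun_prop
  have hmass : ∫⁻ y : EuclideanSpace ℝ (Fin n), ENNReal.ofReal c * gaussian 1 y = μ := by
    rw [lintegral_const_mul' _ _ ENNReal.ofReal_ne_top, lintegral_gaussian,
      ← ENNReal.ofReal_mul hc.le, hcdef, div_mul_cancel₀ _ (by positivity), ENNReal.ofReal_toReal htop]
  have hM := volumeProduct_mul_smul hp0 hp1 (gaussian (n := n) 1) hc one_pos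
  simp_rw [one_smul] at hM
  rw [← hM, volumeProduct_eq hp0 hp1, hmass,
    minTilted_eq_of_even (measurable_laplaceRoot hgm) (laplaceRoot_even heven)]

/-- The mass of `f` is the supremum of the masses of its truncations, while its tilted minimum is at
most theirs; the argument also covers infinite mass. -/
theorem volumeProduct_le_gaussian {f : EuclideanSpace ℝ (Fin n) → ℝ≥0∞}
    (hf : Measurable f) {p : ℝ} (hp0 : 0 < p) (hp1 : p < 1) :
    volumeProduct p f ≤ volumeProduct p (gaussian (n := n) 1) := by
  have hp2 : 0 < 1 - p := by linarith
  have hQ : 0 < p / (1 - p) := div_pos hp0 hp2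
  rcases eq_or_ne (∫⁻ x, f x) 0 with h0 | h0
  · rw [volumeProduct_eq hp0 hp1, h0, zero_mul]
    exact zero_le
  obtain ⟨k₀, hk₀⟩ := exists_lintegral_truncate_ne_zero hf h0
  rw [volumeProduct_eq hp0 hp1, lintegral_eq_iSup_truncate_add hf k₀, ENNReal.iSup_mul]
  refine iSup_le fun k => le_trans ?_ (volumeProduct_truncate_le_gaussian hf (hk₀ k) hp0 hp1)
  rw [volumeProduct_eq hp0 hp1]
  gcongr
  exact minTilted_anti hQ (laplaceRoot_mono hp0 (truncate_le f _))

end LpVolume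

/-! ### The theorem for both flows. -/

theorem theorem1p5 (n : ℕ) (p : ℝ) (hp0 : 0 < p) (hp1 : p < 1)
    (f : EuclideanSpace ℝ (Fin n) → ℝ≥0∞) (hf : Measurable f) :
    (MonotoneOn (fun t : ℝ => LpVolume.volumeProduct p (LpVolume.heatFlow f t)) (Set.Ici 0) ∧
      ∀ t : ℝ, 0 ≤ t → LpVolume.volumeProduct p (LpVolume.heatFlow f t) ≤
        LpVolume.volumeProduct p (LpVolume.gaussian (n := n) 1)) ∧
    (MonotoneOn (fun t : ℝ => LpVolume.volumeProduct p (LpVolume.fokkerPlanckFlow f t))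
        (Set.Ici 0) ∧
      ∀ t : ℝ, 0 ≤ t → LpVolume.volumeProduct p (LpVolume.fokkerPlanckFlow f t) ≤
        LpVolume.volumeProduct p (LpVolume.gaussian (n := n) 1)) := by
  have hexp : ∀ t : ℝ, 0 ≤ t → 0 ≤ Real.exp t - 1 := fun t ht =>
    sub_nonneg.2 (Real.one_le_exp ht)
  refine ⟨⟨fun s hs t _ hst => LpVolume.volumeProduct_heatFlow_mono hf hp0 hp1 hs hst,
    fun t ht => LpVolume.volumeProduct_le_gaussian (LpVolume.measurable_heatFlow hf ht) hp0 hp1⟩,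
    fun s hs t _ hst => ?_, fun t ht => ?_⟩
  · simp_rw [LpVolume.volumeProduct_fokkerPlanckFlow hp0 hp1]
    exact LpVolume.volumeProduct_heatFlow_mono hf hp0 hp1 (hexp s hs)
      (sub_le_sub_right (Real.exp_le_exp.2 hst) 1)
  · rw [LpVolume.volumeProduct_fokkerPlanckFlow hp0 hp1]
    exact LpVolume.volumeProduct_le_gaussian (LpVolume.measurable_heatFlow hf (hexp t ht)) hp0 hp1
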